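/- For integers $k\ge 3$ and $N,M\ge 1$ let $\Phi=\Phi_1\wedge\dots\wedge\Phi_M$, $\Phi_i=\Phi_{i1}\vee\dots\vee\Phi_{ik}$, be chosen uniformly at random among all $(2N)^{kM}$ formulas with $\Phi_{ij}\in L=\{x_1,\neg x_1,\dots,x_N,\neg x_N\}$ (repetitions allowed), and let $V=\{x_1,\dots,x_N\}$. For $l\in L$ the degree $D_l$ is the number of occurrences of $l$ in $\Phi$. Let $\varepsilon_k=\Theta_k(2^{-k/3})$, $r=2^k\ln 2-\frac{1+\ln 2}{2}-\varepsilon_k$ and $M=\lceil rN\rceil$. The pruned formula $\Phi'$ is obtained from $\Phi$ as follows. (PR1) Let $U$ be the set of all variables $x$ with $\max\{|D_x-kr/2|,|D_{\neg x}-kr/2|\}>k^32^{k/2}$. (PR2) While there is a clause that features at least three (distinct) variables from $U$, remove all such clauses, and add to $U$ every variable $x$ such that in the reduced formula the degree of $x$ or the degree of $\neg x$ differs from $kr/2$ by more than $k^32^{k/2}$. (PR3) Remove the variables in $U$ (that is, all literals on them) from all the remaining clauses. Let $V'=V\setminus U$ be the variable set of $\Phi'$, let $L'=\{x,\neg x:x\in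 V'\}$, and for $l\in L'$ let $d_l$ be the degree of $l$ in $\Phi'$. There are an absolute constant $C>0$ and, for every sufficiently large $k$, a constant $c_k>0$ independent of $N$ such that with probability tending to $1$ as $N\to\infty$ ($k$ fixed) all of the following hold: 1. Every satisfying assignment $\sigma':V'\to\{\text{true},\text{false}\}$ of $\Phi'$ extends to a satisfying assignment of $\Phi$. 2. $|V'|\ge(1-\exp(-k^2))N$ and $\sum_{x\in V\setminus V'}(D_x+D_{\neg x})\le\exp(-k^2)N$. 3. For all integers $d^+,d^-$ with $|d^+-kr/2|\le k^32^{k/2}$ and $|d^--kr/2|\le k^32^{k/2}$, $$\frac{|\{l\in L':d_l=d^+,\ d_{\neg l}=d^-\}|}{2N}\ge c_k$$ and $$\left|\frac{|\{l\in L':d_l=d^+,\ d_{\neg l}=d^-\}|}{2N}-\mathbb P[\mathrm{Po}(kr/2)=d^+]\,\mathbb P[\mathrm{Po}(kr/2)=d^-]\right|\le C\exp(-k^2),$$ where $\mathrm{Po}(\mu)$ denotes a Poisson variable with mean $\mu$. (The threshold for $k$ and the constants $c_k$ may depend on the sequence $(\varepsilon_k)_k$; $C$ does not.) -/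

import Mathlib

open scoped NNReal ENNReal Topology Asymptotics
open Filter

namespace RandomSAT

/-- Literals over the variables `x_0, …, x_{N-1}`: `(x, true)` is the positive literal `x`,
`(x, false)` is its negation `¬x`. -/
abbrev Literal (N : ℕ) : Type := Fin N × Bool

/-- The negation of a literal. -/
def neg {N : ℕ} (l : Literal N) : Literal N := (l.1, !l.2)

/-- `k`-CNF formulas with `N` variables and `M` (ordered) clauses, each being an ordered `k`-tuple
of literals, repetitions allowed: `Φ i j` is the `j`-th literal of the `i`-th clause. -/
abbrev Formula (k N M : ℕ) : Type := Fin M → Fin k → Literal N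

/-- The assignment `σ` satisfies `Φ`. -/
def Satisfies {k N M : ℕ} (σ : Fin N → Bool) (Φ : Formula k N M) : Prop :=
  ∀ i, ∃ j, σ (Φ i j).1 = (Φ i j).2

/-- The degree of the literal `l` in the formula consisting of the clauses of `Φ` with index
in `A`: the number of occurrences of `l`. -/
def degreeIn {k N M : ℕ} (Φ : Formula k N M) (A : Finset (Fin M)) (l : Literal N) : ℕ :=
  (Finset.univ.filter fun p : Fin M × Fin k => p.1 ∈ A ∧ Φ p.1 p.2 = l).card

/-- The degree `D_l` of the literal `l` in `Φ`. -/
def degree {k N M : ℕ} (Φ : Formula k N M) (l : Literal N) : ℕ :=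
  degreeIn Φ Finset.univ l

/-- The set of (distinct) variables featured by the `i`-th clause. -/
def clauseVars {k N M : ℕ} (Φ : Formula k N M) (i : Fin M) : Finset (Fin N) :=
  Finset.univ.image fun j => (Φ i j).1

/-- The clauses with index in `A` that feature at least three variables from `U`. -/
def heavyClauses {k N M : ℕ} (Φ : Formula k N M) (A : Finset (Fin M)) (U : Finset (Fin N)) :
    Finset (Fin M) :=
  A.filter fun i => 3 ≤ (clauseVars Φ i ∩ U).card

/-- The tolerance `k³ 2^{k/2}` for the deviation of degrees from `k r / 2`. -/
noncomputable def tol (k : ℕ) : ℝ := (k : ℝ) ^ 3 * (2 : ℝ) ^ ((k : ℝ) / 2)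

open Classical in
/-- The variables `x` such that, in the formula consisting of the clauses with index in `A`, the
degree of `x` or the degree of `¬x` differs from `k r / 2` by more than `k³ 2^{k/2}`. -/
noncomputable def irregularVars {k N M : ℕ} (r : ℝ) (Φ : Formula k N M) (A : Finset (Fin M)) :
    Finset (Fin N) :=
  Finset.univ.filter fun x =>
    tol k < max |(degreeIn Φ A (x, true) : ℝ) - k * r / 2|
      |(degreeIn Φ A (x, false) : ℝ) - k * r / 2|

/-- The loop PR2. The state consists of the set `A` of clauses still present and of the set `U` of
variables; while some present clause features at least three variables from `U`, all such clauses
are removed and the variables that are irregular in the reduced formula are added to `U`. -/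
noncomputable def pruneLoop {k N M : ℕ} (r : ℝ) (Φ : Formula k N M) (A : Finset (Fin M))
    (U : Finset (Fin N)) : Finset (Fin M) × Finset (Fin N) :=
  if (heavyClauses Φ A U).Nonempty then
    pruneLoop r Φ (A \ heavyClauses Φ A U) (U ∪ irregularVars r Φ (A \ heavyClauses Φ A U))
  else (A, U)
termination_by A.card
decreasing_by
  exact Finset.card_lt_card (Finset.sdiff_ssubset (Finset.filter_subset _ _) (by assumption))

/-- The outcome of PR1 (start from the irregular variables of `Φ`) followed by PR2. -/
noncomputable def pruneResult {k N M : ℕ} (r : ℝ) (Φ : Formula k N M) :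
    Finset (Fin M) × Finset (Fin N) :=
  pruneLoop r Φ Finset.univ (irregularVars r Φ Finset.univ)

/-- The (indices of the) clauses that survive the pruning. -/
noncomputable def prunedClauses {k N M : ℕ} (r : ℝ) (Φ : Formula k N M) : Finset (Fin M) :=
  (pruneResult r Φ).1

/-- The variable set `V' = V \ U` of the pruned formula `Φ'`. -/
noncomputable def prunedVars {k N M : ℕ} (r : ℝ) (Φ : Formula k N M) : Finset (Fin N) :=
  Finset.univ \ (pruneResult r Φ).2

/-- The literal slots of the pruned formula `Φ'` (PR3): those slots of the surviving clauses whose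
underlying variable has not been removed. -/
noncomputable def prunedSlots {k N M : ℕ} (r : ℝ) (Φ : Formula k N M) :
    Finset (Fin M × Fin k) :=
  Finset.univ.filter fun p => p.1 ∈ prunedClauses r Φ ∧ (Φ p.1 p.2).1 ∈ prunedVars r Φ

/-- The set `L'` of literals of the pruned formula. -/
noncomputable def prunedLits {k N M : ℕ} (r : ℝ) (Φ : Formula k N M) : Finset (Literal N) :=
  Finset.univ.filter fun l => l.1 ∈ prunedVars r Φ

/-- The degree `d_l` of the literal `l` in the pruned formula `Φ'`. -/
noncomputable def prunedDegree {k N M : ℕ} (r : ℝ) (Φ : Formula k N M) (l : Literal N) : ℕ :=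
  ((prunedSlots r Φ).filter fun p => Φ p.1 p.2 = l).card

/-- The assignment `σ'` of the variables in `V'` satisfies the pruned formula `Φ'`: each surviving
clause has a literal that has not been removed and that is true under `σ'`. -/
def SatisfiesPruned {k N M : ℕ} (r : ℝ) (Φ : Formula k N M)
    (σ' : {x // x ∈ prunedVars r Φ} → Bool) : Prop :=
  ∀ i ∈ prunedClauses r Φ, ∃ j, ∃ h : (i, j) ∈ prunedSlots r Φ,
    σ' ⟨(Φ i j).1, (Finset.mem_filter.mp h).2.2⟩ = (Φ i j).2

/-- The probability `P[Po(μ) = d]` for an integer `d`. -/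
noncomputable def poissonProb (μ : ℝ) (d : ℤ) : ℝ :=
  (ProbabilityTheory.poissonMeasure μ.toNNReal).real {n : ℕ | (n : ℤ) = d}

/-- The fraction of the `2N` literals of `Φ` that are literals `l` of `Φ'` with `d_l = a` and
`d_{¬l} = b`. -/
noncomputable def degreeFraction {k N M : ℕ} (r : ℝ) (Φ : Formula k N M) (a b : ℤ) : ℝ :=
  (((prunedLits r Φ).filter fun l =>
    (prunedDegree r Φ l : ℤ) = a ∧ (prunedDegree r Φ (neg l) : ℤ) = b).card : ℝ) / (2 * N)

/-- The clause density `r = 2^k ln 2 - (1 + ln 2)/2 - ε_k`. -/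
noncomputable def density (ε : ℕ → ℝ) (k : ℕ) : ℝ :=
  2 ^ k * Real.log 2 - (1 + Real.log 2) / 2 - ε k

/-- The event, for a formula `Φ`, that the three properties of the pruning hold, with constant `C`
in the error term `O_k(exp(-k²))` and constant `c` in the lower bound `Ω(1)`. -/
structure PruningGood {k N M : ℕ} (r C c : ℝ) (Φ : Formula k N M) : Prop where
  extend : ∀ σ' : {x // x ∈ prunedVars r Φ} → Bool, SatisfiesPruned r Φ σ' →
    ∃ σ : Fin N → Bool, (∀ x : {x // x ∈ prunedVars r Φ}, σ x = σ' x) ∧ Satisfies σ Φ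
  card_vars : (1 - Real.exp (-(k : ℝ) ^ 2)) * N ≤ ((prunedVars r Φ).card : ℝ)
  sum_degree : ((∑ x ∈ Finset.univ \ prunedVars r Φ,
    (degree Φ (x, true) + degree Φ (x, false)) : ℕ) : ℝ) ≤ Real.exp (-(k : ℝ) ^ 2) * N
  lower : ∀ dp dm : ℤ, |(dp : ℝ) - k * r / 2| ≤ tol k → |(dm : ℝ) - k * r / 2| ≤ tol k →
    c ≤ degreeFraction r Φ dp dm
  approx : ∀ dp dm : ℤ, |(dp : ℝ) - k * r / 2| ≤ tol k → |(dm : ℝ) - k * r / 2| ≤ tol k →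
    |degreeFraction r Φ dp dm - poissonProb (k * r / 2) dp * poissonProb (k * r / 2) dm|
      ≤ C * Real.exp (-(k : ℝ) ^ 2)

end RandomSAT

/-!
By a first and second moment computation, based on an exact count (`pr_degree_eq`), the fraction of
variables `x` such that `x` and `¬x` have degrees `a` and `b` concentrates around the product of the
Poisson probabilities of `a` and `b` (`whp_degCount`). With the Chernoff bound for Poisson tails,
this shows that with high probability at most `uN` variables are *stray*, that is, have a degree
further than half the tolerance from `kr/2`, where `u = exp(-k²)²`; summing the degrees of all other
variables shows that stray variables have few occurrences in total
(`whp_card_strayVars_le`, `whp_sum_degree_strayVars_le`).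

The random formula is also expanding (`whp_expanding`): a set `Y` of at most `4uN` variables has at
most `|Y|` clauses that feature three of its elements. In such a formula the stray variables lie in
a set `F` of size at most `4uN` that is closed: variables outside `F` occur rarely in clauses
featuring three variables from `F` (`exists_closed_superset`). By induction, the pruning removes
only variables from `F` and clauses featuring three variables from `F`. This bounds the number of
removed variables and the change of the degree statistics. Moreover, Hall's theorem matches the
removed clauses to distinct removed variables, so that satisfying assignments extend
(`exists_extension`).

The error `exp(-k²)` exceeds many of the Poisson probabilities in question, so the lower bound on
the degree statistics needs another argument: at most half of the variables `w` with given degrees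
are *damaged*, that is, removed or changed in degree. For a set `X` of `m` such variables, consider
all formulas obtained from a given one by resampling the literals next to variables from `X`.
A closed set `F` that contains the stray variables and the neighbours of `X` *shields* the other
variables for all these formulas at once. If the new literals lie on distinct variables, then a
variable `w` of `X` can only be damaged when one of its new neighbours lies in `F`
(`not_damaged_of_resampled`). As `F` does not depend on the resampled literals, these events are
nearly independent and of probability at most `1/8` each. Thus the `m`-th moment of the number of
damaged variables is smaller by a factor `8⁻ᵐ`, up to `o(1)`, than that of the number of variables
with the given degrees (`ex_damagedCount_pow_le`), and Markov's inequality applies with `m`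
arbitrarily large (`whp_damagedCount_le`).
-/

namespace RandomSAT

/-! ### Probabilities on finite uniform spaces -/

open Classical in
/-- The probability of `P` under the uniform distribution on a finite type. -/
noncomputable def pr {Ω : Type*} [Fintype Ω] (P : Ω → Prop) : ℝ :=
  ((Finset.univ.filter P).card : ℝ) / Fintype.card Ω

/-- The expectation of `f` under the uniform distribution on a finite type. -/
noncomputable def ex {Ω : Type*} [Fintype Ω] (f : Ω → ℝ) : ℝ :=
  (∑ ω, f ω) / Fintype.card Ω

section pr

variable {Ω : Type*} [Fintype Ω]

lemma pr_eq (P : Ω → Prop) [DecidablePred P] :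
    pr P = ((Finset.univ.filter P).card : ℝ) / Fintype.card Ω := by
  unfold pr; congr!

lemma pr_nonneg (P : Ω → Prop) : 0 ≤ pr P := by unfold pr; positivity

lemma pr_le_one (P : Ω → Prop) : pr P ≤ 1 := by
  classical
  unfold pr
  apply div_le_one_of_le₀ _ (by positivity)
  exact_mod_cast Finset.card_le_univ _

lemma pr_mono {P Q : Ω → Prop} (h : ∀ ω, P ω → Q ω) : pr P ≤ pr Q := by
  classical
  unfold pr
  gcongr with ω
  exact fun hω => h _ hω

lemma pr_or_le (P Q : Ω → Prop) : pr (fun ω => P ω ∨ Q ω) ≤ pr P + pr Q := by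
  classical
  rw [pr_eq, pr_eq, pr_eq, ← add_div, Finset.filter_or]
  gcongr
  exact_mod_cast Finset.card_union_le _ _

lemma pr_exists_le {ι : Type*} (s : Finset ι) (P : ι → Ω → Prop) :
    pr (fun ω => ∃ i ∈ s, P i ω) ≤ ∑ i ∈ s, pr (P i) := by
  classical
  induction s using Finset.induction_on with
  | empty => simp [pr]
  | insert a s ha ih =>
    rw [Finset.sum_insert ha]
    refine le_trans (pr_mono (Q := fun ω => P a ω ∨ ∃ i ∈ s, P i ω) ?_) ?_
    · intro ω; simp
    · exact (pr_or_le _ _).trans (by gcongr)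

open Classical in
lemma ex_indicator (P : Ω → Prop) : ex (fun ω => if P ω then (1 : ℝ) else 0) = pr P := by
  unfold ex pr
  rw [Finset.sum_boole]

lemma ex_mono {f g : Ω → ℝ} (h : ∀ ω, f ω ≤ g ω) : ex f ≤ ex g := by
  unfold ex
  gcongr with ω
  exact h ω

lemma ex_nonneg {f : Ω → ℝ} (h : ∀ ω, 0 ≤ f ω) : 0 ≤ ex f :=
  div_nonneg (Finset.sum_nonneg fun ω _ => h ω) (by positivity)

lemma ex_add (f g : Ω → ℝ) : ex (fun ω => f ω + g ω) = ex f + ex g := by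
  unfold ex; rw [Finset.sum_add_distrib, add_div]

lemma ex_const_mul (c : ℝ) (f : Ω → ℝ) : ex (fun ω => c * f ω) = c * ex f := by
  unfold ex; rw [← Finset.mul_sum, mul_div_assoc]

lemma ex_const [Nonempty Ω] (c : ℝ) : ex (fun _ : Ω => c) = c := by
  unfold ex
  have : (Fintype.card Ω : ℝ) ≠ 0 := by exact_mod_cast Fintype.card_ne_zero
  simp [this]

lemma ex_finset_sum {ι : Type*} (s : Finset ι) (f : ι → Ω → ℝ) :
    ex (fun ω => ∑ i ∈ s, f i ω) = ∑ i ∈ s, ex (f i) := by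
  unfold ex; rw [Finset.sum_comm, Finset.sum_div]

/-- Markov's inequality. -/
lemma mul_pr_le_ex {f : Ω → ℝ} (hf : ∀ ω, 0 ≤ f ω) (t : ℝ) :
    t * pr (fun ω => t ≤ f ω) ≤ ex f := by
  classical
  rw [← ex_indicator, ← ex_const_mul]
  apply ex_mono
  intro ω
  split_ifs with h
  · simpa using h
  · simpa using hf ω

end pr

/-- The events `P N` hold with probability tending to `1` as `N → ∞`. -/
def Whp {Ω : ℕ → Type*} [∀ N, Fintype (Ω N)] (P : ∀ N, Ω N → Prop) : Prop :=
  Tendsto (fun N => pr fun ω : Ω N => ¬ P N ω) atTop (𝓝 0)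

section Whp

variable {Ω : ℕ → Type*} [∀ N, Fintype (Ω N)]

lemma Whp.of_pr_le {P : ∀ N, Ω N → Prop} {b : ℕ → ℝ} (hb : Tendsto b atTop (𝓝 0))
    (h : ∀ᶠ N in atTop, pr (fun ω : Ω N => ¬ P N ω) ≤ b N) : Whp P :=
  tendsto_of_tendsto_of_tendsto_of_le_of_le' tendsto_const_nhds hb
    (Eventually.of_forall fun _ => pr_nonneg _) h

lemma Whp.mono {P Q : ∀ N, Ω N → Prop} (hP : Whp P)
    (h : ∀ᶠ N in atTop, ∀ ω, P N ω → Q N ω) : Whp Q := by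
  refine Whp.of_pr_le hP ?_
  filter_upwards [h] with N hN
  exact pr_mono fun ω hω hPω => hω (hN ω hPω)

lemma Whp.and {P Q : ∀ N, Ω N → Prop} (hP : Whp P) (hQ : Whp Q) :
    Whp (fun N ω => P N ω ∧ Q N ω) := by
  refine Whp.of_pr_le (b := fun N => pr (fun ω : Ω N => ¬ P N ω) + pr (fun ω : Ω N => ¬ Q N ω))
    (by simpa using Tendsto.add hP hQ) (Eventually.of_forall fun N => ?_)
  refine le_trans (pr_mono ?_) (pr_or_le _ _)
  intro ω; tauto

lemma Whp.forall_mem {ι : Type*} (s : Finset ι) {P : ι → ∀ N, Ω N → Prop}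
    (h : ∀ i ∈ s, Whp (P i)) : Whp (fun N ω => ∀ i ∈ s, P i N ω) := by
  refine Whp.of_pr_le (b := fun N => ∑ i ∈ s, pr (fun ω : Ω N => ¬ P i N ω))
    (by simpa using tendsto_finsetSum s h) (Eventually.of_forall fun N => ?_)
  refine le_trans (pr_mono ?_) (pr_exists_le _ _)
  intro ω; push Not; exact id

/-- Chebyshev's inequality in the form of convergence in probability. -/
lemma Whp.of_tendsto_ex_sq {f : ∀ N, Ω N → ℝ} {c : ℝ}
    (h : Tendsto (fun N => ex fun ω : Ω N => (f N ω - c) ^ 2) atTop (𝓝 0)) {δ : ℝ} (hδ : 0 < δ) :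
    Whp (fun N ω => |f N ω - c| ≤ δ) := by
  refine Whp.of_pr_le (b := fun N => (ex fun ω : Ω N => (f N ω - c) ^ 2) / δ ^ 2)
    (by simpa using h.div_const (δ ^ 2)) (Eventually.of_forall fun N => ?_)
  rw [le_div_iff₀ (by positivity), mul_comm]
  refine le_trans ?_ (mul_pr_le_ex (fun ω => sq_nonneg _) (δ ^ 2))
  gcongr
  apply pr_mono
  intro ω hω
  rw [← sq_abs (f N ω - c)]
  gcongr
  exact (not_le.mp hω).le

lemma Whp.tendsto_uniformOn [∀ N, MeasurableSpace (Ω N)] [∀ N, MeasurableSingletonClass (Ω N)]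
    {P : ∀ N, Ω N → Prop} (hne : ∀ᶠ N in atTop, Nonempty (Ω N)) (h : Whp P) :
    Tendsto (fun N => ProbabilityTheory.uniformOn (Set.univ : Set (Ω N)) {ω | P N ω})
      atTop (𝓝 1) := by
  classical
  have h1 : Tendsto (fun N => ENNReal.ofReal (1 - pr fun ω : Ω N => ¬ P N ω)) atTop (𝓝 1) := by
    have := ENNReal.tendsto_ofReal ((tendsto_const_nhds (x := (1 : ℝ))).sub h)
    simpa using this
  refine h1.congr' ?_
  filter_upwards [hne] with N hN
  rw [ProbabilityTheory.uniformOn_univ]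
  have hc : (0 : ℝ) < Fintype.card (Ω N) := by exact_mod_cast Fintype.card_pos
  have h2 : 1 - pr (fun ω : Ω N => ¬ P N ω) = pr (P N) := by
    rw [pr_eq, pr_eq, eq_div_iff hc.ne', sub_mul, div_mul_cancel₀ _ hc.ne', one_mul,
      sub_eq_iff_eq_add]
    have := Finset.card_filter_add_card_filter_not (s := (Finset.univ : Finset (Ω N))) (P N)
    rw [Finset.card_univ] at this
    exact_mod_cast this.symm
  rw [h2, pr_eq, ENNReal.ofReal_div_of_pos hc, ENNReal.ofReal_natCast, ENNReal.ofReal_natCast]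
  congr 1
  rw [MeasureTheory.Measure.count_apply_finite _ (Set.toFinite _)]
  congr 2
  ext; simp

end Whp

/-! ### The joint law of the degrees of finitely many literals -/

section Counting

variable {β : Type*} [Fintype β] [DecidableEq β]

/-- Splitting the maps with prescribed fibre sizes according to the value at `0`. -/
lemma card_cons_fibers (L : Finset β) (n : ℕ) (a : β → ℕ) :
    (Finset.univ.filter fun f : Fin (n + 1) → β =>
        ∀ l ∈ L, (Finset.univ.filter fun i => f i = l).card = a l).card =
      ∑ b : β, (Finset.univ.filter fun g : Fin n → β =>
        ∀ l ∈ L, (if b = l then 1 else 0) + (Finset.univ.filter fun i => g i = l).card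
          = a l).card := by
  have := Fintype.card_congr ((Fin.consEquiv (fun _ : Fin (n + 1) => β)).symm.subtypeEquiv
    (p := fun f => ∀ l ∈ L, (Finset.univ.filter fun i => f i = l).card = a l)
    (q := fun bg => ∀ l ∈ L, (if bg.1 = l then 1 else 0) +
      (Finset.univ.filter fun i => bg.2 i = l).card = a l) ?_)
  · rw [Fintype.card_subtype, Fintype.card_subtype] at this
    rw [this, Finset.card_filter, Fintype.sum_prod_type]
    simp_rw [Finset.card_filter]
  · intro f
    refine forall₂_congr fun l _ => ?_
    rw [Fin.card_filter_univ_succ]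
    simp only [Fin.consEquiv, Equiv.coe_fn_symm_mk, Fin.tail]
    by_cases h : f 0 = l <;> simp only [h, if_true, if_false, add_comm, zero_add] <;>
      exact iff_of_eq (by congr!)

/-- The number of maps from an `n`-element set whose fibres over the elements `l` of `L` have the
prescribed sizes `a l`. -/
lemma card_fibers_fin (L : Finset β) (n : ℕ) : ∀ a : β → ℕ,
    (Finset.univ.filter fun f : Fin n → β =>
        ∀ l ∈ L, (Finset.univ.filter fun i => f i = l).card = a l).card *
      ∏ l ∈ L, (a l).factorial =
    n.descFactorial (∑ l ∈ L, a l) * (Fintype.card β - L.card) ^ (n - ∑ l ∈ L, a l) := by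
  induction n with
  | zero =>
    intro a
    by_cases h : ∀ l ∈ L, a l = 0
    · have h1 : ∑ l ∈ L, a l = 0 := Finset.sum_eq_zero h
      have h2 : ∏ l ∈ L, (a l).factorial = 1 := Finset.prod_eq_one fun l hl => by simp [h l hl]
      rw [h1, h2, Finset.filter_true_of_mem]
      · simp
      · intro f _ l hl; simp [h l hl]
    · have h1 : ∑ l ∈ L, a l ≠ 0 := by rwa [Ne, Finset.sum_eq_zero_iff]
      rw [Finset.filter_false_of_mem]
      · rw [(Nat.descFactorial_eq_zero_iff_lt).mpr (Nat.pos_of_ne_zero h1)]; simp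
      · intro f _ hf
        apply h
        intro l hl
        rw [← hf l hl]; simp
  | succ n ih =>
    intro a
    set s := ∑ l ∈ L, a l with hs
    set q := Fintype.card β - L.card with hq
    rw [card_cons_fibers, Finset.sum_mul]
    have key : ∀ b : β, (Finset.univ.filter fun g : Fin n → β =>
        ∀ l ∈ L, (if b = l then 1 else 0) + (Finset.univ.filter fun i => g i = l).card
          = a l).card * ∏ l ∈ L, (a l).factorial =
        if b ∈ L then a b * (n.descFactorial (s - 1) * q ^ (n - (s - 1)))
        else n.descFactorial s * q ^ (n - s) := by
      intro b
      split_ifs with hb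
      · rcases Nat.eq_zero_or_pos (a b) with h0 | h0
        · rw [Finset.filter_false_of_mem]
          · simp [h0]
          · intro g _ hg
            have := hg b hb
            simp [h0] at this
        · have ih' := ih (Function.update a b (a b - 1))
          have hsum : ∑ l ∈ L, Function.update a b (a b - 1) l = s - 1 := by
            rw [Finset.sum_update_of_mem hb, hs, ← Finset.add_sum_erase L a hb,
              Finset.sdiff_singleton_eq_erase]
            omega
          have hprod : ∏ l ∈ L, (a l).factorial =
              a b * ∏ l ∈ L, (Function.update a b (a b - 1) l).factorial := by
            rw [← Finset.mul_prod_erase L _ hb, ← Finset.mul_prod_erase L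
              (fun l => (Function.update a b (a b - 1) l).factorial) hb, ← mul_assoc]
            congr 1
            · simp [Nat.mul_factorial_pred h0.ne']
            · refine Finset.prod_congr rfl fun l hl => ?_
              rw [Function.update_of_ne (Finset.ne_of_mem_erase hl)]
          rw [hsum] at ih'
          rw [← ih', hprod, mul_left_comm]
          congr 3
          refine Finset.filter_congr fun g _ => forall₂_congr fun l hl => ?_
          by_cases hbl : b = l
          · subst hbl; simp; omega
          · simp [hbl, Function.update_of_ne (Ne.symm hbl)]
      · rw [← ih a]
        congr 2
        refine Finset.filter_congr fun g _ => forall₂_congr fun l hl => ?_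
        have : b ≠ l := fun h => hb (h ▸ hl)
        simp [this]
    rw [Finset.sum_congr rfl fun b _ => key b, Finset.sum_ite, Finset.sum_const,
      Finset.filter_mem_eq_inter, Finset.univ_inter, ← Finset.sum_mul, ← hs]
    have hcard : (Finset.univ.filter fun b => b ∉ L).card = q := by
      rw [Finset.filter_not, Finset.card_sdiff_of_subset (Finset.filter_subset _ _)]
      simp [hq]
    rw [hcard, smul_eq_mul]
    clear_value s q
    rcases s with _ | t
    · simp [pow_succ, mul_comm]
    · simp only [Nat.add_sub_cancel, Nat.succ_descFactorial_succ, Nat.descFactorial_succ]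
      rcases lt_trichotomy n t with h | h | h
      · simp [(Nat.descFactorial_eq_zero_iff_lt).mpr h]
      · subst h; simp
      · obtain ⟨d, rfl⟩ : ∃ d, n = t + 1 + d := ⟨n - (t + 1), by omega⟩
        have e1 : t + 1 + d - t = d + 1 := by omega
        have e2 : t + 1 + d - (t + 1) = d := by omega
        have e3 : t + 1 + d + 1 - (t + 1) = d + 1 := by omega
        rw [e1, e2, e3]; ring

lemma card_fibers {α : Type*} [Fintype α] [DecidableEq α] (L : Finset β) (a : β → ℕ) :
    (Finset.univ.filter fun f : α → β =>
        ∀ l ∈ L, (Finset.univ.filter fun i => f i = l).card = a l).card *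
      ∏ l ∈ L, (a l).factorial =
    (Fintype.card α).descFactorial (∑ l ∈ L, a l) *
      (Fintype.card β - L.card) ^ (Fintype.card α - ∑ l ∈ L, a l) := by
  rw [← card_fibers_fin L (Fintype.card α) a]
  congr 1
  refine Finset.card_equiv ((Fintype.equivFin α).arrowCongr (Equiv.refl β)) fun f => ?_
  simp only [Finset.mem_filter_univ]
  refine forall₂_congr fun l _ => ?_
  rw [Finset.card_equiv (Fintype.equivFin α)
    (t := Finset.univ.filter fun i => (Fintype.equivFin α).arrowCongr (Equiv.refl β) f i = l)]
  intro i
  simp [Equiv.arrowCongr]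

end Counting

lemma degree_eq {k N M : ℕ} (Φ : Formula k N M) (l : Literal N) :
    degree Φ l = (Finset.univ.filter fun p : Fin M × Fin k => Φ p.1 p.2 = l).card := by
  simp [degree, degreeIn]

/-- The probability that each literal `l` of a finite set `L` has the prescribed degree `a l`. -/
lemma pr_degree_eq {k N M : ℕ} (L : Finset (Literal N)) (a : Literal N → ℕ) :
    pr (fun Φ : Formula k N M => ∀ l ∈ L, degree Φ l = a l) =
      ((M * k).descFactorial (∑ l ∈ L, a l) : ℝ) *
        (((2 * N - L.card : ℕ) : ℝ) ^ (M * k - ∑ l ∈ L, a l)) /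
        ((2 * N : ℝ) ^ (M * k) * ∏ l ∈ L, ((a l).factorial : ℝ)) := by
  classical
  have h1 := card_fibers (α := Fin M × Fin k) L a
  have h2 : (Finset.univ.filter fun Φ : Formula k N M => ∀ l ∈ L, degree Φ l = a l).card =
      (Finset.univ.filter fun f : Fin M × Fin k → Literal N =>
        ∀ l ∈ L, (Finset.univ.filter fun i => f i = l).card = a l).card := by
    refine Finset.card_equiv (Equiv.curry (Fin M) (Fin k) (Literal N)).symm fun Φ => ?_
    simp only [Finset.mem_filter_univ]
    refine forall₂_congr fun l _ => ?_
    rw [degree_eq]; rfl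
  have h3 : Fintype.card (Formula k N M) = (2 * N) ^ (M * k) := by
    simp [Fintype.card_pi, mul_comm N 2, mul_comm M k, pow_mul]
  rw [pr_eq, h2, h3]
  rw [show Fintype.card (Literal N) = 2 * N by simp [mul_comm],
    show Fintype.card (Fin M × Fin k) = M * k by simp] at h1
  have hp : (0 : ℝ) < ∏ l ∈ L, ((a l).factorial : ℝ) :=
    Finset.prod_pos fun l _ => by exact_mod_cast Nat.factorial_pos _
  have h4 : ((Finset.univ.filter fun f : Fin M × Fin k → Literal N =>
        ∀ l ∈ L, (Finset.univ.filter fun i => f i = l).card = a l).card : ℝ) =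
      ((M * k).descFactorial (∑ l ∈ L, a l) : ℝ) *
        (((2 * N - L.card : ℕ) : ℝ) ^ (M * k - ∑ l ∈ L, a l)) /
        ∏ l ∈ L, ((a l).factorial : ℝ) := by
    rw [eq_div_iff hp.ne']
    exact_mod_cast h1
  rw [h4]
  push_cast
  rw [div_div, mul_comm (∏ l ∈ L, ((a l).factorial : ℝ))]

/-! ### A Poisson law of large numbers for the degrees -/

/-- The weight `e^{-μ} μ^n / n!` of `n` under the Poisson distribution with mean `μ`. -/
noncomputable def poi (μ : ℝ) (n : ℕ) : ℝ := Real.exp (-μ) * μ ^ n / n.factorial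

/-- The number of variables `x` such that `x` has degree `a` and `¬x` has degree `b`. -/
def degCount {k N M : ℕ} (Φ : Formula k N M) (a b : ℕ) : ℕ :=
  (Finset.univ.filter fun x : Fin N => degree Φ (x, true) = a ∧ degree Φ (x, false) = b).card

/-- The factor of `pr_degree_eq` without the factorials, for `q` literals of total degree `s` in
a formula with `n N` slots, converges to its Poisson value. -/
lemma tendsto_descFactorial_mul_pow (q s : ℕ) {n : ℕ → ℕ} {μ : ℝ} (hμ : 0 < μ)
    (hn : Tendsto (fun N : ℕ => (n N : ℝ) / (2 * N)) atTop (𝓝 μ)) :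
    Tendsto (fun N : ℕ => ((n N).descFactorial s : ℝ) * (((2 * N - q : ℕ) : ℝ) ^ (n N - s)) /
      (2 * N : ℝ) ^ (n N)) atTop (𝓝 (μ ^ s * Real.exp (-(q * μ)))) := by
  have h2N : Tendsto (fun N : ℕ => (2 * N : ℝ)) atTop atTop :=
    tendsto_natCast_atTop_atTop.const_mul_atTop (by norm_num)
  have hninf : Tendsto n atTop atTop := by
    rw [← tendsto_natCast_atTop_iff (R := ℝ)]
    refine (hn.pos_mul_atTop hμ h2N).congr' ?_
    filter_upwards [eventually_gt_atTop 0] with N hN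
    have : (N : ℝ) ≠ 0 := by exact_mod_cast hN.ne'
    field_simp
  have h1 : Tendsto (fun N : ℕ => ((n N).descFactorial s : ℝ) / (2 * N : ℝ) ^ s) atTop
      (𝓝 (μ ^ s)) := by
    have he : Asymptotics.IsEquivalent atTop (fun N : ℕ => ((n N).descFactorial s : ℝ))
        (fun N : ℕ => (n N : ℝ) ^ s) := (isEquivalent_descFactorial s).comp_tendsto hninf
    have he2 := he.div (Asymptotics.IsEquivalent.refl (u := fun N : ℕ => (2 * N : ℝ) ^ s))
    refine he2.symm.tendsto_nhds ?_
    simp_rw [Pi.div_def, ← div_pow]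
    exact hn.pow s
  have h2 : Tendsto (fun N : ℕ => ((n N - s : ℕ) : ℝ) / (2 * N)) atTop (𝓝 μ) := by
    have : Tendsto (fun N : ℕ => (n N : ℝ) / (2 * N) - s / (2 * N)) atTop (𝓝 (μ - 0)) :=
      hn.sub (h2N.const_div_atTop _)
    rw [sub_zero] at this
    refine this.congr' ?_
    filter_upwards [hninf.eventually_ge_atTop s] with N hN
    rw [Nat.cast_sub hN, sub_div]
  have h3 : Tendsto (fun N : ℕ => (2 * N : ℝ) * Real.log (1 + (-q : ℝ) / (2 * N))) atTop
      (𝓝 (-q)) := (Real.tendsto_mul_log_one_add_div_atTop (-q : ℝ)).comp h2N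
  have h4 : Tendsto (fun N : ℕ => (1 + (-q : ℝ) / (2 * N)) ^ (n N - s)) atTop
      (𝓝 (Real.exp (-(q * μ)))) := by
    have h5 := (Real.continuous_exp.tendsto _).comp (h2.mul h3)
    rw [show μ * -(q : ℝ) = -(q * μ) by ring] at h5
    refine h5.congr' ?_
    filter_upwards [h2N.eventually_gt_atTop q, eventually_gt_atTop 0] with N hN hN0
    have hN0' : (0 : ℝ) < N := by exact_mod_cast hN0
    have hpos : 0 < 1 + (-q : ℝ) / (2 * N) := by
      rw [neg_div, ← sub_eq_add_neg, sub_pos, div_lt_one (by positivity)]; exact hN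
    calc Real.exp (((n N - s : ℕ) : ℝ) / (2 * N) * (2 * N * Real.log (1 + (-q : ℝ) / (2 * N))))
        = Real.exp (((n N - s : ℕ) : ℝ) * Real.log (1 + (-q : ℝ) / (2 * N))) := by
          congr 1; field_simp
      _ = _ := by rw [Real.exp_nat_mul, Real.exp_log hpos]
  refine (h1.mul h4).congr' ?_
  filter_upwards [h2N.eventually_gt_atTop q, eventually_gt_atTop 0,
    hninf.eventually_ge_atTop s] with N hN hN0 hs
  have hN0' : (0 : ℝ) < N := by exact_mod_cast hN0
  have hq : q ≤ 2 * N := by exact_mod_cast hN.le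
  rw [Nat.cast_sub hq]
  obtain ⟨d, hd⟩ := Nat.exists_eq_add_of_le hs
  rw [hd, Nat.add_sub_cancel_left, pow_add]
  rw [show 1 + (-q : ℝ) / (2 * N) = ((2 * N : ℕ) - q : ℝ) / (2 * N) by
    push_cast; field_simp; ring, div_pow]
  field_simp

lemma pr_degree_pair_eq {k N M : ℕ} (S : Finset (Fin N)) (a b : ℕ) :
    pr (fun Φ : Formula k N M => ∀ x ∈ S, degree Φ (x, true) = a ∧ degree Φ (x, false) = b) =
      ((M * k).descFactorial (S.card * (a + b)) : ℝ) *
        (((2 * N - S.card * 2 : ℕ) : ℝ) ^ (M * k - S.card * (a + b))) /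
        (2 * N : ℝ) ^ (M * k) / ((a.factorial : ℝ) * b.factorial) ^ S.card := by
  have := pr_degree_eq (k := k) (M := M) (S ×ˢ (Finset.univ : Finset Bool))
    (fun l => if l.2 then a else b)
  rw [Finset.sum_product, Finset.prod_product] at this
  simp only [Fintype.univ_bool, Finset.mem_singleton, Bool.true_eq_false, not_false_eq_true,
    Finset.sum_insert, Finset.sum_singleton, Finset.prod_insert, Finset.prod_singleton,
    if_true, Bool.false_eq_true, if_false, Finset.sum_const, Finset.prod_const, smul_eq_mul,
    Finset.card_product, Finset.card_insert_of_notMem, Finset.card_singleton] at this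
  rw [div_div, ← this]
  congr 1
  ext Φ
  simp only [Finset.mem_product, Finset.mem_insert, Finset.mem_singleton, Prod.forall,
    Bool.forall_bool]
  simp
  exact ⟨fun h x => ⟨fun hx => (h x hx).2, fun hx => (h x hx).1⟩,
    fun h x hx => ⟨(h x).2 hx, (h x).1 hx⟩⟩

section LocalLaw

variable {k : ℕ} {M : ℕ → ℕ} {μ : ℝ}

lemma tendsto_pr_degree_pair (hμ : 0 < μ)
    (hM : Tendsto (fun N : ℕ => ((M N * k : ℕ) : ℝ) / (2 * N)) atTop (𝓝 μ)) (a b q : ℕ) :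
    Tendsto (fun N : ℕ => ((M N * k).descFactorial (q * (a + b)) : ℝ) *
        (((2 * N - q * 2 : ℕ) : ℝ) ^ (M N * k - q * (a + b))) /
        (2 * N : ℝ) ^ (M N * k) / ((a.factorial : ℝ) * b.factorial) ^ q) atTop
      (𝓝 ((poi μ a * poi μ b) ^ q)) := by
  convert (tendsto_descFactorial_mul_pow (q * 2) (q * (a + b)) hμ hM).div_const _ using 2
  unfold poi
  rw [show -(((q * 2 : ℕ) : ℝ) * μ) = q * (-μ + -μ) by push_cast; ring, Real.exp_nat_mul,
    Real.exp_add, mul_comm q (a + b), pow_mul, ← mul_pow, ← div_pow]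
  congr 1
  rw [pow_add]
  field_simp

/-- The numbers of variables with given degrees obey a law of large numbers, the degrees of a
literal and of its negation behaving like independent Poisson variables. -/
lemma whp_degCount (hμ : 0 < μ)
    (hM : Tendsto (fun N : ℕ => ((M N * k : ℕ) : ℝ) / (2 * N)) atTop (𝓝 μ)) (a b : ℕ)
    {δ : ℝ} (hδ : 0 < δ) :
    Whp (fun N (Φ : Formula k N (M N)) =>
      |(degCount Φ a b : ℝ) / N - poi μ a * poi μ b| ≤ δ) := by
  classical
  apply Whp.of_tendsto_ex_sq _ hδ
  set P := poi μ a * poi μ b with hP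
  set G : ℕ → ℕ → ℝ := fun q N => ((M N * k).descFactorial (q * (a + b)) : ℝ) *
        (((2 * N - q * 2 : ℕ) : ℝ) ^ (M N * k - q * (a + b))) /
        (2 * N : ℝ) ^ (M N * k) / ((a.factorial : ℝ) * b.factorial) ^ q with hG
  have hG1 := tendsto_pr_degree_pair hμ hM a b 1
  have hG2 := tendsto_pr_degree_pair hμ hM a b 2
  rw [← hP] at hG1 hG2
  have hlim : Tendsto (fun N : ℕ => 1 / (N : ℝ) + G 2 N - 2 * P * G 1 N + P ^ 2) atTop (𝓝 0) := by
    have := ((tendsto_one_div_atTop_nhds_zero_nat (𝕜 := ℝ)).add hG2).sub (hG1.const_mul (2 * P))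
    have := this.add_const (P ^ 2)
    convert this using 2
    ring
  refine tendsto_of_tendsto_of_tendsto_of_le_of_le' tendsto_const_nhds hlim
    (Eventually.of_forall fun N => ex_nonneg fun ω => sq_nonneg _) ?_
  filter_upwards [eventually_gt_atTop 0] with N hN
  have hN' : (0 : ℝ) < N := by exact_mod_cast hN
  have : Nonempty (Formula k N (M N)) := ⟨fun _ _ => (⟨0, hN⟩, true)⟩
  set I : Fin N → Formula k N (M N) → ℝ := fun x Φ =>
    if degree Φ (x, true) = a ∧ degree Φ (x, false) = b then 1 else 0 with hI
  have hX : ∀ Φ : Formula k N (M N), (degCount Φ a b : ℝ) = ∑ x, I x Φ := by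
    intro Φ; simp [degCount, hI]
  have h1 : ∀ x, ex (I x) = G 1 N := by
    intro x
    have := pr_degree_pair_eq (k := k) (M := M N) {x} a b
    rw [Finset.card_singleton] at this
    simp only [hG]
    rw [← this, ← ex_indicator]
    congr 1; ext Φ
    simp [hI]
  have h2 : ∀ x y, x ≠ y → ex (fun Φ => I x Φ * I y Φ) = G 2 N := by
    intro x y hxy
    have := pr_degree_pair_eq (k := k) (M := M N) {x, y} a b
    rw [Finset.card_pair hxy] at this
    simp only [hG]
    rw [← this, ← ex_indicator]
    congr 1; ext Φ
    simp only [hI, ← ite_and, Finset.mem_insert, Finset.mem_singleton, forall_eq_or_imp, forall_eq,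
      mul_ite, mul_one, mul_zero]
    by_cases h : degree Φ (x, true) = a ∧ degree Φ (x, false) = b <;> simp [h]
  have hG2n : 0 ≤ G 2 N := by simp only [hG]; positivity
  have h3 : ∀ x y, ex (fun Φ => I x Φ * I y Φ) ≤ (if x = y then 1 else 0) + G 2 N := by
    intro x y
    by_cases hxy : x = y
    · rw [if_pos hxy]
      refine le_trans (ex_mono (g := fun _ => 1) fun Φ => ?_) ?_
      · simp only [hI]; split_ifs <;> simp
      · rw [ex_const]; linarith
    · rw [if_neg hxy, zero_add, h2 x y hxy]
  have h4 : ex (fun Φ : Formula k N (M N) => (degCount Φ a b : ℝ)) = N * G 1 N := by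
    simp_rw [hX]; rw [ex_finset_sum]; simp [h1]
  have h5 : ex (fun Φ : Formula k N (M N) => (degCount Φ a b : ℝ) ^ 2) ≤ N + N ^ 2 * G 2 N := by
    simp_rw [hX, sq, Finset.sum_mul_sum]
    rw [ex_finset_sum]
    simp_rw [ex_finset_sum]
    refine (Finset.sum_le_sum fun x _ => Finset.sum_le_sum fun y _ => h3 x y).trans ?_
    simp [Finset.sum_add_distrib]
    apply le_of_eq; ring
  have h6 : ex (fun Φ : Formula k N (M N) => ((degCount Φ a b : ℝ) / N - P) ^ 2) =
      (1 / (N : ℝ) ^ 2) * ex (fun Φ : Formula k N (M N) => (degCount Φ a b : ℝ) ^ 2) +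
      ((-(2 * P) / N) * ex (fun Φ : Formula k N (M N) => (degCount Φ a b : ℝ)) + P ^ 2) := by
    have hP2 : P ^ 2 = ex fun _ : Formula k N (M N) => P ^ 2 := (ex_const _).symm
    rw [hP2, ← ex_const_mul, ← ex_const_mul, ← ex_add, ← ex_add]
    congr 1; ext Φ
    field_simp
    ring
  rw [h6, h4]
  have h7 : (1 / (N : ℝ) ^ 2) * ex (fun Φ : Formula k N (M N) => (degCount Φ a b : ℝ) ^ 2) ≤
      1 / (N : ℝ) ^ 2 * (N + N ^ 2 * G 2 N) := by gcongr
  have h8 : 1 / (N : ℝ) ^ 2 * (N + N ^ 2 * G 2 N) = 1 / N + G 2 N := by field_simp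
  have h9 : -(2 * P) / N * (N * G 1 N) = -(2 * P * G 1 N) := by field_simp
  rw [h9]; linarith

end LocalLaw

/-! ### Tails of the Poisson distribution -/

lemma poi_nonneg {μ : ℝ} (hμ : 0 ≤ μ) (n : ℕ) : 0 ≤ poi μ n := by unfold poi; positivity

lemma poi_pos {μ : ℝ} (hμ : 0 < μ) (n : ℕ) : 0 < poi μ n := by unfold poi; positivity

lemma poissonProb_natCast {μ : ℝ} (hμ : 0 ≤ μ) (n : ℕ) : poissonProb μ (n : ℤ) = poi μ n := by
  have : {m : ℕ | (m : ℤ) = (n : ℤ)} = {n} := by ext; simp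
  rw [poissonProb, this, ProbabilityTheory.poissonMeasure_real_singleton, Real.coe_toNNReal _ hμ,
    poi]

/-- The moment generating function of the Poisson distribution. -/
lemma hasSum_poi_mul_exp (μ s : ℝ) :
    HasSum (fun n : ℕ => poi μ n * Real.exp (s * n)) (Real.exp (μ * (Real.exp s - 1))) := by
  have h := (NormedSpace.expSeries_div_hasSum_exp (μ * Real.exp s)).mul_left (Real.exp (-μ))
  rw [← Real.exp_eq_exp_ℝ, ← Real.exp_add] at h
  have e1 : (fun n : ℕ => poi μ n * Real.exp (s * n)) =
      fun n : ℕ => Real.exp (-μ) * ((μ * Real.exp s) ^ n / n.factorial) := by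
    ext n
    rw [poi, mul_comm s, Real.exp_nat_mul, mul_pow]; ring
  rw [e1, show μ * (Real.exp s - 1) = -μ + μ * Real.exp s by ring]
  exact h

/-- The derivative of the moment generating function of the Poisson distribution. -/
lemma hasSum_natCast_mul_poi_mul_exp (μ s : ℝ) :
    HasSum (fun n : ℕ => n * (poi μ n * Real.exp (s * n)))
      (μ * Real.exp s * Real.exp (μ * (Real.exp s - 1))) := by
  rw [← hasSum_nat_add_iff' 1]
  have h := (hasSum_poi_mul_exp μ s).mul_left (μ * Real.exp s)
  have e1 : (fun n : ℕ => ((n + 1 : ℕ) : ℝ) * (poi μ (n + 1) * Real.exp (s * (n + 1 : ℕ)))) =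
      fun n : ℕ => μ * Real.exp s * (poi μ n * Real.exp (s * n)) := by
    ext n
    rw [poi, poi, Nat.factorial_succ, pow_succ]
    push_cast
    rw [mul_add, mul_one, Real.exp_add]
    field_simp
  rw [e1]
  simpa using h

/-- The natural numbers within distance `τ` of `μ`. -/
noncomputable def window (μ τ : ℝ) : Finset ℕ :=
  (Finset.range (⌈μ + τ⌉₊ + 1)).filter fun n => |(n : ℝ) - μ| ≤ τ

lemma mem_window {μ τ : ℝ} {n : ℕ} : n ∈ window μ τ ↔ |(n : ℝ) - μ| ≤ τ := by
  rw [window, Finset.mem_filter, and_iff_right_iff_imp]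
  intro h
  rw [Finset.mem_range]
  have h1 : (n : ℝ) ≤ μ + τ := by linarith [(abs_le.mp h).2]
  have h2 := h1.trans (Nat.le_ceil _)
  have h3 : n ≤ ⌈μ + τ⌉₊ := by exact_mod_cast h2
  omega

lemma hasSum_sub_finset_le {w v : ℕ → ℝ} {W V : ℝ} (hw : HasSum w W) (hv : HasSum v V)
    (s : Finset ℕ) (hv0 : ∀ n, 0 ≤ v n) (h : ∀ n ∉ s, w n ≤ v n) : W - ∑ n ∈ s, w n ≤ V := by
  have h1 : HasSum (fun n => if n ∈ s then w n else 0) (∑ n ∈ s, w n) := by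
    have := hasSum_sum_of_ne_finset_zero (f := fun n => if n ∈ s then w n else 0) (s := s)
      (L := SummationFilter.unconditional ℕ)
      (by intro b hb; simp [hb])
    simpa using this
  refine hasSum_le (fun n => ?_) (hw.sub h1) hv
  by_cases hn : n ∈ s
  · simpa [hn] using hv0 n
  · simpa [hn] using h n hn

section Tail

variable {μ τ : ℝ}

/-- The moment generating function of the centred Poisson variable is subgaussian near `0`. -/
lemma exp_mul_sub_le {s : ℝ} (hμ : 0 < μ) (hs : |s| ≤ 1) :
    Real.exp (-(s * μ)) * Real.exp (μ * (Real.exp s - 1)) ≤ Real.exp (μ * s ^ 2) := by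
  rw [← Real.exp_add]
  have := (abs_le.mp (Real.abs_exp_sub_one_sub_id_le hs)).2
  gcongr
  nlinarith

/-- Outside the window `|n - μ| ≤ τ`, the indicator is at most an exponential weight. -/
lemma one_le_exp_add_exp {t : ℝ} (ht : 0 ≤ t) {x : ℝ} (h : ¬ |x| ≤ τ) :
    1 ≤ Real.exp (-(t * τ)) * (Real.exp (t * x) + Real.exp (-t * x)) := by
  have h1 : Real.exp (t * τ) ≤ Real.exp (t * x) + Real.exp (-t * x) := by
    rcases le_or_gt 0 x with hx | hx
    · rw [abs_of_nonneg hx] at h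
      have : Real.exp (t * τ) ≤ Real.exp (t * x) := by gcongr; linarith
      linarith [Real.exp_pos (-t * x)]
    · rw [abs_of_neg hx] at h
      have : Real.exp (t * τ) ≤ Real.exp (-t * x) := by
        rw [neg_mul, ← mul_neg]; gcongr; linarith
      linarith [Real.exp_pos (t * x)]
  calc (1 : ℝ) = Real.exp (-(t * τ)) * Real.exp (t * τ) := by rw [← Real.exp_add]; simp
    _ ≤ _ := by gcongr

/-- Chernoff's bound for the mass of a Poisson variable outside a window around its mean, and for
the part of the mean that this mass carries. -/
lemma window_sums (hμ : 0 < μ) (hτ : 0 ≤ τ) (hτμ : τ ≤ 2 * μ) :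
    1 - 2 * Real.exp (-(τ ^ 2 / (4 * μ))) ≤ ∑ n ∈ window μ τ, poi μ n ∧
      μ * (1 - 6 * Real.exp (-(τ ^ 2 / (4 * μ)))) ≤ ∑ n ∈ window μ τ, n * poi μ n := by
  -- the optimal exponential tilt
  set t := τ / (2 * μ) with ht
  have ht0 : 0 ≤ t := by positivity
  have ht1 : t ≤ 1 := by rw [ht, div_le_one (by positivity)]; exact hτμ
  have htabs : |t| ≤ 1 := by rwa [abs_of_nonneg ht0]
  have htabs' : |-t| ≤ 1 := by rwa [abs_neg]
  set E := Real.exp (-(t * τ)) with hE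
  have hEE : E * Real.exp (μ * t ^ 2) = Real.exp (-(τ ^ 2 / (4 * μ))) := by
    rw [hE, ← Real.exp_add]; congr 1; rw [ht]; field_simp; ring
  have e1 : ∀ n : ℕ, ∀ s : ℝ, Real.exp (s * ((n : ℝ) - μ)) =
      Real.exp (-(s * μ)) * Real.exp (s * n) := by
    intro n s; rw [← Real.exp_add]; congr 1; ring
  have hsum0 := ((hasSum_poi_mul_exp μ t).mul_left (Real.exp (-(t * μ)))).add
    ((hasSum_poi_mul_exp μ (-t)).mul_left (Real.exp (-(-t * μ)))) |>.mul_left E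
  have hsum1 := ((hasSum_natCast_mul_poi_mul_exp μ t).mul_left (Real.exp (-(t * μ)))).add
    ((hasSum_natCast_mul_poi_mul_exp μ (-t)).mul_left (Real.exp (-(-t * μ)))) |>.mul_left E
  have hp : HasSum (poi μ) 1 := by simpa using hasSum_poi_mul_exp μ 0
  have hm : HasSum (fun n : ℕ => n * poi μ n) μ := by
    simpa using hasSum_natCast_mul_poi_mul_exp μ 0
  have b1 := exp_mul_sub_le hμ htabs
  have b2 := exp_mul_sub_le hμ htabs'
  rw [neg_sq] at b2
  have hE0 : 0 < E := Real.exp_pos _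
  constructor
  · have h := hasSum_sub_finset_le hp hsum0 (window μ τ)
      (fun n => by have := poi_nonneg hμ.le n; positivity) (fun n hn => by
        rw [mem_window] at hn
        have h1 := one_le_exp_add_exp ht0 hn
        rw [e1, e1] at h1
        have h2 := mul_le_mul_of_nonneg_left h1 (poi_nonneg hμ.le n)
        rw [mul_one] at h2
        refine h2.trans (le_of_eq ?_)
        rw [hE]; ring)
    have : E * (Real.exp (-(t * μ)) * Real.exp (μ * (Real.exp t - 1)) +
        Real.exp (-(-t * μ)) * Real.exp (μ * (Real.exp (-t) - 1))) ≤
        E * (Real.exp (μ * t ^ 2) + Real.exp (μ * t ^ 2)) := by gcongr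
    rw [mul_add, mul_add, hEE] at this
    rw [mul_add] at h
    linarith
  · have h := hasSum_sub_finset_le hm hsum1 (window μ τ)
      (fun n => by have := poi_nonneg hμ.le n; positivity) (fun n hn => by
        rw [mem_window] at hn
        have h1 := one_le_exp_add_exp ht0 hn
        rw [e1, e1] at h1
        have h2 := mul_le_mul_of_nonneg_left h1
          (mul_nonneg (Nat.cast_nonneg n) (poi_nonneg hμ.le n))
        rw [mul_one] at h2
        refine h2.trans (le_of_eq ?_)
        rw [hE]; ring)
    have h3 : Real.exp t ≤ 3 := by
      have : Real.exp t ≤ Real.exp 1 := by gcongr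
      linarith [Real.exp_one_lt_d9]
    have h4 : Real.exp (-t) ≤ 3 := by
      have : Real.exp (-t) ≤ Real.exp 0 := by gcongr; linarith
      rw [Real.exp_zero] at this; linarith
    have : E * (μ * Real.exp t * (Real.exp (-(t * μ)) * Real.exp (μ * (Real.exp t - 1))) +
        μ * Real.exp (-t) * (Real.exp (-(-t * μ)) * Real.exp (μ * (Real.exp (-t) - 1)))) ≤
        E * (μ * 3 * Real.exp (μ * t ^ 2) + μ * 3 * Real.exp (μ * t ^ 2)) := by gcongr
    have e3 : E * (μ * 3 * Real.exp (μ * t ^ 2) + μ * 3 * Real.exp (μ * t ^ 2)) =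
        6 * μ * Real.exp (-(τ ^ 2 / (4 * μ))) := by rw [← hEE]; ring
    rw [e3] at this
    have e4 : E * (Real.exp (-(t * μ)) * (μ * Real.exp t * Real.exp (μ * (Real.exp t - 1))) +
        Real.exp (-(-t * μ)) * (μ * Real.exp (-t) * Real.exp (μ * (Real.exp (-t) - 1)))) =
        E * (μ * Real.exp t * (Real.exp (-(t * μ)) * Real.exp (μ * (Real.exp t - 1))) +
        μ * Real.exp (-t) * (Real.exp (-(-t * μ)) * Real.exp (μ * (Real.exp (-t) - 1)))) := by
      ring
    rw [e4] at h
    linarith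

/-- For two independent Poisson variables `A, B` with mean `μ`, both in a window around `μ` except
on an event of tiny probability, and that event contributes little to the mean of `A + B`. -/
lemma window_pair_sums (hμ : 0 < μ) (hτ : 0 ≤ τ) (hτμ : τ ≤ 2 * μ) {ρ : ℝ}
    (hρ : Real.exp (-(τ ^ 2 / (4 * μ))) ≤ ρ) (hρ1 : ρ ≤ 1 / 8) :
    1 - 4 * ρ ≤ ∑ a ∈ window μ τ, ∑ b ∈ window μ τ, poi μ a * poi μ b ∧
      2 * μ * (1 - 8 * ρ) ≤
        ∑ a ∈ window μ τ, ∑ b ∈ window μ τ, ((a : ℝ) + b) * (poi μ a * poi μ b) := by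
  obtain ⟨h1, h2⟩ := window_sums hμ hτ hτμ
  have hρ0 : 0 < ρ := (Real.exp_pos _).trans_le hρ
  set A := ∑ n ∈ window μ τ, poi μ n with hA
  set B := ∑ n ∈ window μ τ, n * poi μ n with hB
  have hA1 : 1 - 2 * ρ ≤ A := by linarith
  have hB1 : μ * (1 - 6 * ρ) ≤ B := by
    refine le_trans ?_ h2
    gcongr
  constructor
  · rw [← Finset.sum_mul_sum, ← hA]
    nlinarith
  · have e : ∑ a ∈ window μ τ, ∑ b ∈ window μ τ, ((a : ℝ) + b) * (poi μ a * poi μ b) =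
        2 * (B * A) := by
      have e1 : ∀ a b : ℕ, ((a : ℝ) + b) * (poi μ a * poi μ b) =
          (a * poi μ a) * poi μ b + poi μ a * (b * poi μ b) := by intros; ring
      simp_rw [e1, Finset.sum_add_distrib]
      rw [← Finset.sum_mul_sum, ← Finset.sum_mul_sum]
      ring
    rw [e]
    have h3 : μ * (1 - 6 * ρ) * (1 - 2 * ρ) ≤ B * A := by
      apply mul_le_mul hB1 hA1 (by linarith)
      refine le_trans ?_ hB1
      apply mul_nonneg hμ.le; linarith
    nlinarith [mul_pos hμ (mul_pos hρ0 hρ0)]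

end Tail

/-! ### Control of the pruning by a closed set of variables -/

section Prune

variable {k N M : ℕ}

lemma mem_heavyClauses {Φ : Formula k N M} {A : Finset (Fin M)} {U : Finset (Fin N)} {i : Fin M} :
    i ∈ heavyClauses Φ A U ↔ i ∈ A ∧ 3 ≤ (clauseVars Φ i ∩ U).card := by
  simp [heavyClauses]

lemma heavyClauses_mono (Φ : Formula k N M) {A B : Finset (Fin M)} {U V : Finset (Fin N)}
    (hAB : A ⊆ B) (hUV : U ⊆ V) : heavyClauses Φ A U ⊆ heavyClauses Φ B V := by
  intro i hi
  rw [mem_heavyClauses] at hi ⊢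
  exact ⟨hAB hi.1, hi.2.trans (Finset.card_le_card (Finset.inter_subset_inter_left hUV))⟩

lemma pruneLoop_bounds {r : ℝ} {Φ : Formula k N M} {F : Finset (Fin N)}
    (hF : ∀ A, Finset.univ \ heavyClauses Φ Finset.univ F ⊆ A → irregularVars r Φ A ⊆ F)
    (A : Finset (Fin M)) (U : Finset (Fin N)) :
    Finset.univ \ heavyClauses Φ Finset.univ F ⊆ A → U ⊆ F →
      Finset.univ \ heavyClauses Φ Finset.univ F ⊆ (pruneLoop r Φ A U).1 ∧
        (pruneLoop r Φ A U).2 ⊆ F := by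
  induction A, U using pruneLoop.induct (r := r) (Φ := Φ) with
  | case1 A U h ih =>
    intro hA hU
    rw [pruneLoop, if_pos h]
    have hA' : Finset.univ \ heavyClauses Φ Finset.univ F ⊆ A \ heavyClauses Φ A U := by
      intro i hi
      rw [Finset.mem_sdiff] at hi ⊢
      refine ⟨hA (by simpa using hi), fun hi' => hi.2 ?_⟩
      exact heavyClauses_mono Φ (Finset.subset_univ _) hU hi'
    exact ih hA' (Finset.union_subset hU (hF _ hA'))
  | case2 A U h =>
    intro hA hU
    rw [pruneLoop, if_neg h]
    exact ⟨hA, hU⟩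

/-- If no variable outside `F` can become irregular by the removal of clauses featuring three
variables from `F`, then the pruning removes only variables in `F` and such clauses. -/
lemma pruneResult_bounds {r : ℝ} {Φ : Formula k N M} {F : Finset (Fin N)}
    (hF : ∀ A, Finset.univ \ heavyClauses Φ Finset.univ F ⊆ A → irregularVars r Φ A ⊆ F) :
    Finset.univ \ heavyClauses Φ Finset.univ F ⊆ prunedClauses r Φ ∧
      Finset.univ \ F ⊆ prunedVars r Φ := by
  obtain ⟨h1, h2⟩ := pruneLoop_bounds hF Finset.univ (irregularVars r Φ Finset.univ)
    (Finset.subset_univ _) (hF _ (Finset.subset_univ _))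
  exact ⟨h1, Finset.sdiff_subset_sdiff le_rfl h2⟩

/-- Every clause removed by the loop features at least three of the variables finally removed. -/
lemma pruneLoop_removed {r : ℝ} {Φ : Formula k N M} (A : Finset (Fin M)) (U : Finset (Fin N)) :
    (∀ i ∉ A, 3 ≤ (clauseVars Φ i ∩ U).card) →
      ∀ i ∉ (pruneLoop r Φ A U).1, 3 ≤ (clauseVars Φ i ∩ (pruneLoop r Φ A U).2).card := by
  induction A, U using pruneLoop.induct (r := r) (Φ := Φ) with
  | case1 A U h ih =>
    intro hA
    rw [pruneLoop, if_pos h]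
    refine ih fun i hi => ?_
    have h3 : 3 ≤ (clauseVars Φ i ∩ U).card := by
      by_cases hiA : i ∈ A
      · simp only [Finset.mem_sdiff, hiA, true_and, not_not, mem_heavyClauses] at hi
        exact hi
      · exact hA i hiA
    exact h3.trans (Finset.card_le_card
      (Finset.inter_subset_inter_left Finset.subset_union_left))
  | case2 A U h =>
    intro hA
    rw [pruneLoop, if_neg h]
    exact hA

lemma three_le_of_notMem_prunedClauses {r : ℝ} {Φ : Formula k N M} {i : Fin M}
    (hi : i ∉ prunedClauses r Φ) :
    3 ≤ (clauseVars Φ i ∩ (Finset.univ \ prunedVars r Φ)).card := by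
  have : Finset.univ \ prunedVars r Φ = (pruneResult r Φ).2 := by
    rw [prunedVars, sdiff_sdiff_right_self, Finset.inf_eq_inter, Finset.univ_inter]
  rw [this]
  exact pruneLoop_removed Finset.univ _ (fun i hi => absurd (Finset.mem_univ i) hi) i hi

/-- Any set `Y` of at most `v` variables is such that at most `|Y|` clauses feature three of its
elements. -/
def Expanding (Φ : Formula k N M) (v : ℝ) : Prop :=
  ∀ Y : Finset (Fin N), (Y.card : ℝ) ≤ v → (heavyClauses Φ Finset.univ Y).card ≤ Y.card

/-- By Hall's theorem the removed clauses can be satisfied by distinct removed variables. -/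
lemma exists_extension {r v : ℝ} {Φ : Formula k N M} (hΦ : Expanding Φ v)
    (hv : ((Finset.univ \ prunedVars r Φ).card : ℝ) ≤ v)
    (σ' : {x // x ∈ prunedVars r Φ} → Bool) (hσ' : SatisfiesPruned r Φ σ') :
    ∃ σ : Fin N → Bool, (∀ x : {x // x ∈ prunedVars r Φ}, σ x = σ' x) ∧ Satisfies σ Φ := by
  classical
  set U := Finset.univ \ prunedVars r Φ with hU
  let t : {i // i ∉ prunedClauses r Φ} → Finset (Fin N) := fun i => clauseVars Φ i ∩ U
  have hall : ∀ s : Finset {i // i ∉ prunedClauses r Φ}, s.card ≤ (s.biUnion t).card := by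
    intro s
    have hY : s.biUnion t ⊆ U := Finset.biUnion_subset.mpr fun i _ => Finset.inter_subset_right
    have h1 := hΦ (s.biUnion t) (le_trans (by exact_mod_cast Finset.card_le_card hY) hv)
    refine le_trans ?_ h1
    rw [← Finset.card_map (Function.Embedding.subtype _)]
    apply Finset.card_le_card
    intro i hi
    rw [Finset.mem_map] at hi
    obtain ⟨j, hj, rfl⟩ := hi
    rw [mem_heavyClauses]
    refine ⟨Finset.mem_univ _, (three_le_of_notMem_prunedClauses j.2).trans ?_⟩
    refine Finset.card_le_card (Finset.subset_inter Finset.inter_subset_left ?_)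
    exact Finset.subset_biUnion_of_mem t hj
  obtain ⟨f, hfinj, hf⟩ := (Finset.all_card_le_biUnion_card_iff_exists_injective t).mp hall
  have hj : ∀ i : {i // i ∉ prunedClauses r Φ}, ∃ j, (Φ i j).1 = f i := by
    intro i
    have := (Finset.mem_inter.mp (hf i)).1
    simpa [clauseVars] using this
  choose j hj using hj
  refine ⟨fun x => if h : x ∈ prunedVars r Φ then σ' ⟨x, h⟩
    else if h' : ∃ i, f i = x then (Φ h'.choose (j h'.choose)).2 else true, ?_, ?_⟩
  · intro x; simp
  · intro i
    by_cases hi : i ∈ prunedClauses r Φ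
    · obtain ⟨j', h, hj'⟩ := hσ' i hi
      refine ⟨j', ?_⟩
      simp only
      rw [dif_pos (Finset.mem_filter.mp h).2.2]
      exact hj'
    · refine ⟨j ⟨i, hi⟩, ?_⟩
      have hfU : f ⟨i, hi⟩ ∉ prunedVars r Φ := by
        have := (Finset.mem_inter.mp (hf ⟨i, hi⟩)).2
        rw [hU, Finset.mem_sdiff] at this
        exact this.2
      have hex : ∃ i', f i' = f ⟨i, hi⟩ := ⟨_, rfl⟩
      have hx := hj ⟨i, hi⟩
      rw [← hx] at hfU hex
      have hc : hex.choose = ⟨i, hi⟩ := hfinj (hex.choose_spec.trans hx)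
      simp only
      rw [dif_neg hfU, dif_pos hex, hc]

/-- The number of occurrences of the variable `x` in the clauses with index in `A`. -/
def varDegreeIn (Φ : Formula k N M) (A : Finset (Fin M)) (x : Fin N) : ℕ :=
  (Finset.univ.filter fun p : Fin M × Fin k => p.1 ∈ A ∧ (Φ p.1 p.2).1 = x).card

lemma degreeIn_le_varDegreeIn (Φ : Formula k N M) (A : Finset (Fin M)) (l : Literal N) :
    degreeIn Φ A l ≤ varDegreeIn Φ A l.1 := by
  apply Finset.card_le_card
  intro p
  simp only [Finset.mem_filter_univ]
  rintro ⟨h1, h2⟩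
  exact ⟨h1, by rw [h2]⟩

lemma degreeIn_mono (Φ : Formula k N M) {A B : Finset (Fin M)} (h : A ⊆ B) (l : Literal N) :
    degreeIn Φ A l ≤ degreeIn Φ B l := by
  apply Finset.card_le_card
  intro p
  simp only [Finset.mem_filter_univ]
  rintro ⟨h1, h2⟩
  exact ⟨h h1, h2⟩

lemma varDegreeIn_mono (Φ : Formula k N M) {A B : Finset (Fin M)} (h : A ⊆ B) (x : Fin N) :
    varDegreeIn Φ A x ≤ varDegreeIn Φ B x := by
  apply Finset.card_le_card
  intro p
  simp only [Finset.mem_filter_univ]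
  rintro ⟨h1, h2⟩
  exact ⟨h h1, h2⟩

lemma degreeIn_le_add (Φ : Formula k N M) {A B C : Finset (Fin M)} (h : C ⊆ A ∪ B)
    (l : Literal N) : degreeIn Φ C l ≤ degreeIn Φ A l + degreeIn Φ B l := by
  classical
  refine le_trans (Finset.card_le_card ?_) (Finset.card_union_le _ _)
  intro p
  simp only [Finset.mem_union, Finset.mem_filter_univ]
  rintro ⟨h1, h2⟩
  rcases Finset.mem_union.mp (h h1) with h | h
  · exact Or.inl ⟨h, h2⟩
  · exact Or.inr ⟨h, h2⟩

lemma degreeIn_le_degree (Φ : Formula k N M) (A : Finset (Fin M)) (l : Literal N) :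
    degreeIn Φ A l ≤ degree Φ l := degreeIn_mono Φ (Finset.subset_univ _) l

lemma sum_varDegreeIn (Φ : Formula k N M) (A : Finset (Fin M)) :
    ∑ x, varDegreeIn Φ A x = A.card * k := by
  classical
  have h := Finset.card_eq_sum_card_fiberwise (f := fun p : Fin M × Fin k => (Φ p.1 p.2).1)
    (s := A ×ˢ Finset.univ) (t := Finset.univ) (fun _ _ => Finset.mem_univ _)
  rw [Finset.card_product, Finset.card_univ, Fintype.card_fin] at h
  rw [h]
  refine Finset.sum_congr rfl fun x _ => ?_
  rw [varDegreeIn]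
  congr 1
  ext p
  simp

lemma degreeIn_true_add_false (Φ : Formula k N M) (A : Finset (Fin M)) (x : Fin N) :
    degreeIn Φ A (x, true) + degreeIn Φ A (x, false) = varDegreeIn Φ A x := by
  classical
  rw [degreeIn, degreeIn, varDegreeIn, ← Finset.card_union_of_disjoint]
  · congr 1
    ext p
    simp only [Finset.mem_union, Finset.mem_filter_univ, Prod.ext_iff]
    cases (Φ p.1 p.2).2 <;> simp
  · rw [Finset.disjoint_filter]
    rintro p _ ⟨_, h1⟩ ⟨_, h2⟩
    rw [h1] at h2
    simp at h2

/-- In an expanding formula, a small set `F₀` of variables is contained in a set `F` at most twice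
as large such that any variable outside `F` occurs at most `t` times in clauses that feature three
variables from `F`. -/
lemma exists_closed_superset {Φ : Formula k N M} {v t : ℝ} (hΦ : Expanding Φ (2 * v))
    (ht : 0 < t) (hkt : 2 * k ≤ t) (F₀ : Finset (Fin N)) (hF₀ : (F₀.card : ℝ) ≤ v) :
    ∃ F, F₀ ⊆ F ∧ (F.card : ℝ) ≤ 2 * v ∧
      ∀ y ∉ F, (varDegreeIn Φ (heavyClauses Φ Finset.univ F) y : ℝ) ≤ t := by
  classical
  let G : Finset (Fin N) → Finset (Fin N) := fun F => F₀ ∪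
    Finset.univ.filter fun y => t < varDegreeIn Φ (heavyClauses Φ Finset.univ F) y
  have hGmono : ∀ F F', F ⊆ F' → G F ⊆ G F' := by
    intro F F' h
    refine Finset.union_subset_union_right fun y => ?_
    simp only [Finset.mem_filter_univ]
    intro hy
    refine hy.trans_le ?_
    exact_mod_cast varDegreeIn_mono Φ (heavyClauses_mono Φ le_rfl h) y
  have hGcard : ∀ F, (F.card : ℝ) ≤ 2 * v → ((G F).card : ℝ) ≤ 2 * v := by
    intro F hF
    have h1 : ((Finset.univ.filter fun y =>
        t < varDegreeIn Φ (heavyClauses Φ Finset.univ F) y).card : ℝ) * t ≤ 2 * v * k := by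
      calc _ = ∑ y ∈ Finset.univ.filter fun y =>
            t < varDegreeIn Φ (heavyClauses Φ Finset.univ F) y, t := by
            rw [Finset.sum_const, nsmul_eq_mul]
        _ ≤ ∑ y ∈ Finset.univ.filter fun y =>
            t < varDegreeIn Φ (heavyClauses Φ Finset.univ F) y,
              (varDegreeIn Φ (heavyClauses Φ Finset.univ F) y : ℝ) :=
            Finset.sum_le_sum fun y hy => (Finset.mem_filter_univ y |>.mp hy).le
        _ ≤ ∑ y, (varDegreeIn Φ (heavyClauses Φ Finset.univ F) y : ℝ) :=
            Finset.sum_le_sum_of_subset_of_nonneg (Finset.filter_subset _ _)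
              fun _ _ _ => Nat.cast_nonneg _
        _ = (heavyClauses Φ Finset.univ F).card * k := by
            exact_mod_cast sum_varDegreeIn Φ _
        _ ≤ F.card * k := by gcongr; exact hΦ F hF
        _ ≤ 2 * v * k := by gcongr
    have hv : 0 ≤ v := (Nat.cast_nonneg _).trans hF₀
    have h2 : ((Finset.univ.filter fun y =>
        t < varDegreeIn Φ (heavyClauses Φ Finset.univ F) y).card : ℝ) ≤ v := by
      have : 2 * v * k ≤ v * t := by nlinarith
      exact le_of_mul_le_mul_right (h1.trans this) ht
    have h3 : ((G F).card : ℝ) ≤ F₀.card + (Finset.univ.filter fun y =>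
        t < varDegreeIn Φ (heavyClauses Φ Finset.univ F) y).card := by
      exact_mod_cast Finset.card_union_le _ _
    linarith
  -- a maximal small set among those with `F ⊆ G F` is a fixed point of `G`
  obtain ⟨F, hF, hmax⟩ := Finset.exists_max_image
    (Finset.univ.filter fun F : Finset (Fin N) => (F.card : ℝ) ≤ 2 * v ∧ F ⊆ G F) Finset.card
    ⟨F₀, by
      simp only [Finset.mem_filter_univ]
      refine ⟨?_, Finset.subset_union_left⟩
      have : (0 : ℝ) ≤ F₀.card := Nat.cast_nonneg _
      linarith⟩
  simp only [Finset.mem_filter_univ] at hF hmax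
  have hfix : F = G F :=
    Finset.eq_of_subset_of_card_le hF.2 (hmax (G F) ⟨hGcard F hF.1, hGmono _ _ hF.2⟩)
  refine ⟨F, by rw [hfix]; exact Finset.subset_union_left, hF.1, fun y hy => ?_⟩
  by_contra! hlt
  apply hy
  rw [hfix]
  exact Finset.mem_union_right _ (by simpa using hlt)

lemma notMem_irregularVars {r : ℝ} {Φ : Formula k N M} {A : Finset (Fin M)} {x : Fin N}
    (h : ∀ s : Bool, |(degreeIn Φ A (x, s) : ℝ) - k * r / 2| ≤ tol k) :
    x ∉ irregularVars r Φ A := by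
  simp only [irregularVars, Finset.mem_filter_univ, not_lt]
  exact max_le (h true) (h false)

/-- The set of variables for which the degree of the variable or of its negation differs from
`k r / 2` by more than half the tolerance. -/
noncomputable def strayVars (r : ℝ) (Φ : Formula k N M) : Finset (Fin N) := by
  classical
  exact Finset.univ.filter fun x => ¬ ∀ s : Bool, |(degree Φ (x, s) : ℝ) - k * r / 2| ≤ tol k / 2

lemma notMem_strayVars {r : ℝ} {Φ : Formula k N M} {x : Fin N} :
    x ∉ strayVars r Φ ↔ ∀ s : Bool, |(degree Φ (x, s) : ℝ) - k * r / 2| ≤ tol k / 2 := by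
  simp [strayVars]

/-- A set `F` as provided by `exists_closed_superset` confines the pruning: a variable outside `F`
starts within half the tolerance and loses at most another half. -/
lemma prune_bounds_of_closed {r : ℝ} {Φ : Formula k N M} {F : Finset (Fin N)}
    (hF₀ : strayVars r Φ ⊆ F)
    (hF : ∀ y ∉ F, (varDegreeIn Φ (heavyClauses Φ Finset.univ F) y : ℝ) ≤ tol k / 2) :
    Finset.univ \ heavyClauses Φ Finset.univ F ⊆ prunedClauses r Φ ∧
      Finset.univ \ F ⊆ prunedVars r Φ := by
  apply pruneResult_bounds
  intro A hA y hy
  by_contra hyF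
  refine notMem_irregularVars (fun s => ?_) hy
  have h1 := abs_le.mp (notMem_strayVars.mp (fun h => hyF (hF₀ h)) s)
  have h2 : (degreeIn Φ A (y, s) : ℝ) ≤ degree Φ (y, s) := by
    exact_mod_cast degreeIn_le_degree Φ A _
  have h3 : (degree Φ (y, s) : ℝ) ≤ degreeIn Φ A (y, s) +
      varDegreeIn Φ (heavyClauses Φ Finset.univ F) y := by
    have h4 : degree Φ (y, s) ≤ degreeIn Φ A (y, s) +
      degreeIn Φ (heavyClauses Φ Finset.univ F) (y, s) := by
      apply degreeIn_le_add
      intro i _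
      by_cases hi : i ∈ heavyClauses Φ Finset.univ F
      · exact Finset.mem_union_right _ hi
      · exact Finset.mem_union_left _ (hA (by simp [hi]))
    have h5 := degreeIn_le_varDegreeIn Φ (heavyClauses Φ Finset.univ F) (y, s)
    exact_mod_cast h4.trans (by simpa using h5)
  have h6 := hF y hyF
  rw [abs_le]
  constructor <;> linarith

lemma prunedDegree_eq {r : ℝ} {Φ : Formula k N M} {l : Literal N} (hl : l.1 ∈ prunedVars r Φ) :
    prunedDegree r Φ l = degreeIn Φ (prunedClauses r Φ) l := by
  rw [prunedDegree, degreeIn, prunedSlots, Finset.filter_filter]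
  congr 1
  refine Finset.filter_congr fun p _ => ?_
  constructor
  · rintro ⟨⟨h1, _⟩, h3⟩; exact ⟨h1, h3⟩
  · rintro ⟨h1, h3⟩; exact ⟨⟨h1, by rwa [h3]⟩, h3⟩

lemma prunedDegree_eq_degree {r : ℝ} {Φ : Formula k N M} {l : Literal N}
    (hl : l.1 ∈ prunedVars r Φ) (h : ∀ i j, (Φ i j).1 = l.1 → i ∈ prunedClauses r Φ) :
    prunedDegree r Φ l = degree Φ l := by
  rw [prunedDegree_eq hl, degree, degreeIn, degreeIn]
  congr 1
  refine Finset.filter_congr fun p _ => ?_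
  constructor
  · rintro ⟨_, h3⟩; exact ⟨Finset.mem_univ _, h3⟩
  · rintro ⟨_, h3⟩; exact ⟨h _ _ (by rw [h3]), h3⟩

/-- The number of literals `l` with degree `a` whose negation has degree `b` is the number of
positive ones plus the number of negative ones. -/
lemma card_literals_degree (Φ : Formula k N M) (a b : ℕ) :
    (Finset.univ.filter fun l : Literal N => degree Φ l = a ∧ degree Φ (neg l) = b).card =
      degCount Φ a b + degCount Φ b a := by
  rw [Finset.card_filter, Fintype.sum_prod_type]
  simp only [Fintype.sum_bool, neg, Bool.not_true, Bool.not_false]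
  rw [Finset.sum_add_distrib, ← Finset.card_filter, ← Finset.card_filter, degCount, degCount]
  congr 2
  exact Finset.filter_congr fun x _ => and_comm

/-- Pruning changes the degree statistics by at most a constant times the size of a closed set that
contains all removed variables. -/
lemma abs_degreeFraction_sub_le {r v : ℝ} {Φ : Formula k N M} {F : Finset (Fin N)}
    (hN : 0 < N) (hv : (F.card : ℝ) ≤ v) (hΦ : Expanding Φ v)
    (h1 : Finset.univ \ heavyClauses Φ Finset.univ F ⊆ prunedClauses r Φ)
    (h2 : Finset.univ \ F ⊆ prunedVars r Φ) (a b : ℕ) :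
    |degreeFraction r Φ a b - ((degCount Φ a b : ℝ) / N + (degCount Φ b a : ℝ) / N) / 2| ≤
      (k + 1) * v / N := by
  classical
  set S₁ := (prunedLits r Φ).filter fun l =>
    (prunedDegree r Φ l : ℤ) = a ∧ (prunedDegree r Φ (neg l) : ℤ) = b with hS₁
  set S₂ := Finset.univ.filter fun l : Literal N => degree Φ l = a ∧ degree Φ (neg l) = b with hS₂
  set E := F ∪ (heavyClauses Φ Finset.univ F).biUnion (clauseVars Φ) with hE
  have hkey : ∀ l : Literal N, l.1 ∉ E → (l ∈ S₁ ↔ l ∈ S₂) := by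
    intro l hl
    have hlF : l.1 ∉ F := fun h => hl (Finset.mem_union_left _ h)
    have hlV : l.1 ∈ prunedVars r Φ := h2 (by simp [hlF])
    have hc : ∀ i j, (Φ i j).1 = l.1 → i ∈ prunedClauses r Φ := by
      intro i j hij
      apply h1
      rw [Finset.mem_sdiff]
      refine ⟨Finset.mem_univ _, fun hi => hl (Finset.mem_union_right _ ?_)⟩
      rw [Finset.mem_biUnion]
      exact ⟨i, hi, Finset.mem_image.mpr ⟨j, Finset.mem_univ _, hij⟩⟩
    have e1 := prunedDegree_eq_degree hlV hc
    have e2 := prunedDegree_eq_degree (l := neg l) hlV hc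
    simp only [hS₁, hS₂, Finset.mem_filter, Finset.mem_univ, true_and, prunedLits, e1, e2, hlV,
      Nat.cast_inj]
  have hEcard : (E.card : ℝ) ≤ (k + 1) * v := by
    have h3 : E.card ≤ F.card + (heavyClauses Φ Finset.univ F).card * k := by
      refine (Finset.card_union_le _ _).trans ?_
      gcongr
      refine Finset.card_biUnion_le_card_mul _ _ _ fun i _ => ?_
      exact Finset.card_image_le.trans (by simp)
    have h4 := hΦ F hv
    have h5 : (E.card : ℝ) ≤ F.card + F.card * k := by
      exact_mod_cast h3.trans (by gcongr)
    have : (F.card : ℝ) * k ≤ v * k := by gcongr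
    linarith
  have hbound : ∀ S T : Finset (Literal N), (∀ l : Literal N, l.1 ∉ E → (l ∈ S → l ∈ T)) →
      (S.card : ℝ) ≤ T.card + 2 * ((k + 1) * v) := by
    intro S T hST
    have h3 : S ⊆ T ∪ E ×ˢ Finset.univ := by
      intro l hl
      by_cases h : l.1 ∈ E
      · exact Finset.mem_union_right _ (by simp [h])
      · exact Finset.mem_union_left _ (hST l h hl)
    have h4 := (Finset.card_le_card h3).trans (Finset.card_union_le _ _)
    rw [Finset.card_product, Finset.card_univ, Fintype.card_bool] at h4
    have h5 : (S.card : ℝ) ≤ T.card + E.card * 2 := by exact_mod_cast h4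
    linarith
  have hb1 := hbound S₁ S₂ fun l hl => (hkey l hl).mp
  have hb2 := hbound S₂ S₁ fun l hl => (hkey l hl).mpr
  have hS2 : (S₂.card : ℝ) = degCount Φ a b + degCount Φ b a := by
    exact_mod_cast card_literals_degree Φ a b
  have hN' : (0 : ℝ) < N := by exact_mod_cast hN
  have e : degreeFraction r Φ a b - ((degCount Φ a b : ℝ) / N + (degCount Φ b a : ℝ) / N) / 2 =
      (S₁.card - S₂.card) / (2 * N) := by
    rw [degreeFraction, hS2]
    field_simp
    congr!
  rw [e, abs_le]
  constructor
  · rw [neg_le_iff_add_nonneg, show ((S₁.card : ℝ) - S₂.card) / (2 * N) + (k + 1) * v / N =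
      (S₁.card - S₂.card + 2 * ((k + 1) * v)) / (2 * N) by field_simp]
    apply div_nonneg <;> linarith
  · rw [div_le_div_iff₀ (by positivity) hN']
    nlinarith

end Prune

/-! ### Expansion of the random formula -/

/-- The coordinates of a uniformly random tuple are independent. -/
lemma pr_forall_mem {ι γ : Type*} [Fintype ι] [DecidableEq ι] [Fintype γ] [Nonempty γ]
    (W : Finset ι) (P : γ → Prop) : pr (fun f : ι → γ => ∀ i ∈ W, P (f i)) = pr P ^ W.card := by
  classical
  have h : (Finset.univ.filter fun f : ι → γ => ∀ i ∈ W, P (f i)) =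
      Fintype.piFinset fun i => if i ∈ W then Finset.univ.filter P else Finset.univ := by
    ext f
    simp only [Finset.mem_filter_univ, Fintype.mem_piFinset]
    refine forall_congr' fun i => ?_
    split_ifs with hi <;> simp [hi]
  have hγ : (Fintype.card γ : ℝ) ≠ 0 := by exact_mod_cast Fintype.card_ne_zero
  rw [pr_eq, pr_eq, h, Fintype.card_piFinset, Fintype.card_fun]
  simp only [apply_ite Finset.card, Finset.card_univ]
  rw [Finset.prod_ite, Finset.prod_const, Finset.prod_const, Finset.filter_mem_eq_inter,
    Finset.univ_inter, Finset.filter_not, Finset.filter_mem_eq_inter, Finset.univ_inter,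
    Finset.card_sdiff_of_subset (Finset.subset_univ _), Finset.card_univ, div_pow]
  rw [div_eq_div_iff (by positivity) (by positivity)]
  push_cast
  rw [mul_assoc, ← pow_add, Nat.sub_add_cancel (Finset.card_le_univ W)]

lemma pr_literal_mem {N : ℕ} (hN : 0 < N) (Y : Finset (Fin N)) :
    pr (fun l : Literal N => l.1 ∈ Y) = Y.card / N := by
  classical
  have h : (Finset.univ.filter fun l : Literal N => l.1 ∈ Y) = Y ×ˢ Finset.univ := by
    ext; simp
  have hN' : (0 : ℝ) < N := by exact_mod_cast hN
  rw [pr_eq, h, Finset.card_product]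
  simp
  field_simp

lemma pr_clause_heavy_le {k N : ℕ} (hN : 0 < N) (Y : Finset (Fin N)) :
    pr (fun c : Fin k → Literal N => 3 ≤ ((Finset.univ.image fun j => (c j).1) ∩ Y).card) ≤
      (k : ℝ) ^ 3 * (Y.card / N) ^ 3 := by
  classical
  have : Nonempty (Literal N) := ⟨(⟨0, hN⟩, true)⟩
  calc _ ≤ pr (fun c : Fin k → Literal N => ∃ W ∈ Finset.powersetCard 3 Finset.univ,
        ∀ j ∈ W, (c j).1 ∈ Y) := by
        apply pr_mono
        intro c hc
        have h1 : 3 ≤ (Finset.univ.filter fun j => (c j).1 ∈ Y).card := by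
          refine hc.trans (le_trans (Finset.card_le_card ?_)
            (Finset.card_image_le (f := fun j => (c j).1)))
          intro x hx
          simp only [Finset.mem_inter, Finset.mem_image, Finset.mem_univ, true_and] at hx
          obtain ⟨⟨j, rfl⟩, hx⟩ := hx
          exact Finset.mem_image_of_mem _ (by simpa using hx)
        obtain ⟨W, hW, hW3⟩ := Finset.exists_subset_card_eq h1
        refine ⟨W, by simp [Finset.mem_powersetCard, hW3], fun j hj => ?_⟩
        simpa using hW hj
    _ ≤ ∑ W ∈ Finset.powersetCard 3 (Finset.univ : Finset (Fin k)),
        pr (fun c : Fin k → Literal N => ∀ j ∈ W, (c j).1 ∈ Y) := pr_exists_le _ _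
    _ = ∑ W ∈ Finset.powersetCard 3 (Finset.univ : Finset (Fin k)), ((Y.card : ℝ) / N) ^ 3 := by
        refine Finset.sum_congr rfl fun W hW => ?_
        rw [pr_forall_mem W fun l : Literal N => l.1 ∈ Y, pr_literal_mem hN,
          (Finset.mem_powersetCard.mp hW).2]
    _ ≤ _ := by
        rw [Finset.sum_const, Finset.card_powersetCard, Finset.card_univ, Fintype.card_fin,
          nsmul_eq_mul]
        gcongr
        exact_mod_cast Nat.choose_le_pow k 3

lemma choose_le_exp_mul_div_pow (n y : ℕ) (hy : 0 < y) :
    (n.choose y : ℝ) ≤ (Real.exp 1 * n / y) ^ y := by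
  have h1 : (n.choose y : ℝ) ≤ (n : ℝ) ^ y / y.factorial := Nat.choose_le_pow_div y n
  have h2 : (y : ℝ) ^ y / y.factorial ≤ Real.exp y :=
    Real.pow_div_factorial_le_exp (y : ℝ) (Nat.cast_nonneg _) y
  have hy' : (0 : ℝ) < y := by exact_mod_cast hy
  have hf : (0 : ℝ) < y.factorial := by exact_mod_cast Nat.factorial_pos y
  refine h1.trans ?_
  rw [div_pow, mul_pow, ← Real.exp_nat_mul, mul_one, div_le_div_iff₀ hf (by positivity)]
  rw [div_le_iff₀ hf] at h2
  nlinarith [pow_nonneg (Nat.cast_nonneg (α := ℝ) n) y]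

lemma sum_pow_mul_div_le {K δ : ℝ} (hK : 0 ≤ K) (hKδ : K * δ ≤ 1 / 2) {N : ℕ} (hN : 0 < N) :
    ∑ y ∈ Finset.Icc 1 ⌊δ * N⌋₊, (K * y / N) ^ y ≤ 4 * K / N := by
  have hN' : (0 : ℝ) < N := by exact_mod_cast hN
  have h1 : ∀ y ∈ Finset.Icc 1 ⌊δ * N⌋₊, (K * y / N) ^ y ≤ 2 * K / N * (y * (1 / 2 : ℝ) ^ y) := by
    intro y hy
    rw [Finset.mem_Icc] at hy
    obtain ⟨z, rfl⟩ : ∃ z, y = z + 1 := ⟨y - 1, by omega⟩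
    have h2 : ((z + 1 : ℕ) : ℝ) ≤ δ * N := by
      apply (Nat.le_floor_iff' (by omega)).mp hy.2
    have h3 : K * (z + 1 : ℕ) / N ≤ 1 / 2 := by
      rw [div_le_iff₀ hN']
      calc K * (z + 1 : ℕ) ≤ K * (δ * N) := by gcongr
        _ ≤ 1 / 2 * N := by rw [← mul_assoc]; gcongr
    have h4 : (K * (z + 1 : ℕ) / N) ^ z ≤ (1 / 2 : ℝ) ^ z := by gcongr
    rw [pow_succ]
    calc (K * (z + 1 : ℕ) / N) ^ z * (K * (z + 1 : ℕ) / N)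
        ≤ (1 / 2 : ℝ) ^ z * (K * (z + 1 : ℕ) / N) := by gcongr
      _ = _ := by rw [pow_succ]; ring
  have h5 : HasSum (fun n : ℕ => (n : ℝ) * (1 / 2 : ℝ) ^ n) 2 := by
    have := hasSum_coe_mul_geometric_of_norm_lt_one (r := (1 / 2 : ℝ)) (by norm_num)
    rwa [show (1 / 2 : ℝ) / (1 - 1 / 2) ^ 2 = 2 by norm_num] at this
  have h6 : ∑ y ∈ Finset.Icc 1 ⌊δ * N⌋₊, (y : ℝ) * (1 / 2 : ℝ) ^ y ≤ 2 :=
    sum_le_hasSum _ (fun _ _ => by positivity) h5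
  calc _ ≤ ∑ y ∈ Finset.Icc 1 ⌊δ * N⌋₊, 2 * K / N * (y * (1 / 2 : ℝ) ^ y) :=
        Finset.sum_le_sum h1
    _ = 2 * K / N * ∑ y ∈ Finset.Icc 1 ⌊δ * N⌋₊, (y * (1 / 2 : ℝ) ^ y) := by rw [Finset.mul_sum]
    _ ≤ 2 * K / N * 2 := by gcongr
    _ = _ := by ring

/-- The first moment bound: the expected number of pairs consisting of a set `Y` of `y` variables
and a set of `y` clauses each featuring three elements of `Y` is at most `(K y / N) ^ y`. -/
lemma pr_not_expanding_le {k N M : ℕ} (hN : 0 < N) {κ δ : ℝ} (hM : (M : ℝ) ≤ κ * N)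
    (hδ : Real.exp 1 ^ 2 * k ^ 3 * κ * δ ≤ 1 / 2) :
    pr (fun Φ : Formula k N M => ¬ Expanding Φ (δ * N)) ≤
      4 * (Real.exp 1 ^ 2 * k ^ 3 * κ) / N := by
  classical
  have hN' : (0 : ℝ) < N := by exact_mod_cast hN
  have hκ : 0 ≤ κ := by
    by_contra! h
    have : (0 : ℝ) ≤ M := Nat.cast_nonneg _
    nlinarith
  have : Nonempty (Literal N) := ⟨(⟨0, hN⟩, true)⟩
  calc _ ≤ pr (fun Φ : Formula k N M => ∃ y ∈ Finset.Icc 1 ⌊δ * N⌋₊,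
        ∃ Y ∈ Finset.powersetCard y (Finset.univ : Finset (Fin N)),
        ∃ W ∈ Finset.powersetCard y (Finset.univ : Finset (Fin M)),
        ∀ i ∈ W, 3 ≤ (clauseVars Φ i ∩ Y).card) := by
        apply pr_mono
        intro Φ hΦ
        simp only [Expanding, not_forall, not_le] at hΦ
        obtain ⟨Y, hY, hlt⟩ := hΦ
        obtain ⟨W, hW, hWcard⟩ := Finset.exists_subset_card_eq hlt.le
        refine ⟨Y.card, ?_, Y, by simp [Finset.mem_powersetCard], W,
          by simp [Finset.mem_powersetCard, hWcard], fun i hi => (mem_heavyClauses.mp (hW hi)).2⟩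
        rw [Finset.mem_Icc]
        have h0 : 0 < Y.card := by
          by_contra! h0
          obtain ⟨i, hi⟩ := Finset.card_pos.mp ((Nat.zero_le _).trans_lt hlt)
          have := (mem_heavyClauses.mp hi).2
          rw [Finset.card_eq_zero.mp (Nat.le_zero.mp h0)] at this
          simp at this
        exact ⟨h0, Nat.le_floor hY⟩
    _ ≤ ∑ y ∈ Finset.Icc 1 ⌊δ * N⌋₊, ∑ Y ∈ Finset.powersetCard y (Finset.univ : Finset (Fin N)),
        ∑ W ∈ Finset.powersetCard y (Finset.univ : Finset (Fin M)),
        pr (fun Φ : Formula k N M => ∀ i ∈ W, 3 ≤ (clauseVars Φ i ∩ Y).card) := by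
        refine (pr_exists_le _ _).trans (Finset.sum_le_sum fun y _ => ?_)
        refine (pr_exists_le _ _).trans (Finset.sum_le_sum fun Y _ => ?_)
        exact pr_exists_le _ _
    _ ≤ ∑ y ∈ Finset.Icc 1 ⌊δ * N⌋₊, ∑ Y ∈ Finset.powersetCard y (Finset.univ : Finset (Fin N)),
        ∑ W ∈ Finset.powersetCard y (Finset.univ : Finset (Fin M)),
        ((k : ℝ) ^ 3 * (y / N) ^ 3) ^ y := by
        refine Finset.sum_le_sum fun y _ => Finset.sum_le_sum fun Y hY =>
          Finset.sum_le_sum fun W hW => ?_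
        have := pr_forall_mem (ι := Fin M) W
          (fun c : Fin k → Literal N => 3 ≤ ((Finset.univ.image fun j => (c j).1) ∩ Y).card)
        refine (le_of_eq this).trans ?_
        rw [(Finset.mem_powersetCard.mp hW).2, ← (Finset.mem_powersetCard.mp hY).2]
        exact pow_le_pow_left₀ (pr_nonneg _) (pr_clause_heavy_le hN Y) _
    _ ≤ ∑ y ∈ Finset.Icc 1 ⌊δ * N⌋₊, ((Real.exp 1 ^ 2 * k ^ 3 * κ) * y / N) ^ y := by
        refine Finset.sum_le_sum fun y hy => ?_
        have hy0 : 0 < y := (Finset.mem_Icc.mp hy).1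
        have hy' : (0 : ℝ) < y := by exact_mod_cast hy0
        rw [Finset.sum_const, Finset.sum_const, Finset.card_powersetCard, Finset.card_powersetCard,
          Finset.card_univ, Finset.card_univ, Fintype.card_fin, Fintype.card_fin, nsmul_eq_mul,
          nsmul_eq_mul]
        calc (N.choose y : ℝ) * (M.choose y * ((k : ℝ) ^ 3 * (y / N) ^ 3) ^ y)
            ≤ (Real.exp 1 * N / y) ^ y * ((Real.exp 1 * (κ * N) / y) ^ y *
              ((k : ℝ) ^ 3 * (y / N) ^ 3) ^ y) := by
              have h1 := choose_le_exp_mul_div_pow N y hy0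
              have h2 := choose_le_exp_mul_div_pow M y hy0
              have h3 : (Real.exp 1 * M / y) ^ y ≤ (Real.exp 1 * (κ * N) / y) ^ y := by gcongr
              gcongr
              exact h2.trans h3
          _ = _ := by
              rw [← mul_pow, ← mul_pow]
              congr 1
              field_simp
    _ ≤ _ := sum_pow_mul_div_le (by positivity) hδ hN

/-- With high probability sets of at most `δ N` variables are expanding, for a suitable constant
`δ`. Three elements per clause are needed: the expected number of `y` clauses on `y` variables is
then of order `(y / N) ^ y`. -/
lemma whp_expanding {k : ℕ} {M : ℕ → ℕ} {κ δ : ℝ}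
    (hM : ∀ᶠ N : ℕ in atTop, (M N : ℝ) ≤ κ * N)
    (hδ : Real.exp 1 ^ 2 * k ^ 3 * κ * δ ≤ 1 / 2) :
    Whp (fun N (Φ : Formula k N (M N)) => Expanding Φ (δ * N)) := by
  refine Whp.of_pr_le (b := fun N : ℕ => 4 * (Real.exp 1 ^ 2 * k ^ 3 * κ) / N)
    (tendsto_const_div_atTop_nhds_zero_nat _) ?_
  filter_upwards [hM, eventually_gt_atTop 0] with N h1 h2
  exact pr_not_expanding_le h2 h1 hδ

/-! ### Resampling the neighbourhood of a few variables -/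

section Resample

variable {k N M : ℕ}

/-- The variable `w` has degree `a` and its negation has degree `b`. -/
def HasDegrees (Φ : Formula k N M) (a b : ℕ) (w : Fin N) : Prop :=
  degree Φ (w, true) = a ∧ degree Φ (w, false) = b

/-- The variable `w` has degrees `a` and `b` in `Φ`, but it is removed by the pruning or one of its
degrees is changed. -/
def Damaged (r : ℝ) (Φ : Formula k N M) (a b : ℕ) (w : Fin N) : Prop :=
  HasDegrees Φ a b w ∧ ¬ (w ∈ prunedVars r Φ ∧ prunedDegree r Φ (w, true) = a ∧
    prunedDegree r Φ (w, false) = b)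

/-- The clauses featuring a variable from `X`. -/
def touched (Φ : Formula k N M) (X : Finset (Fin N)) : Finset (Fin M) :=
  Finset.univ.filter fun i => ∃ j, (Φ i j).1 ∈ X

/-- The slots of the clauses featuring a variable from `X` that are not occupied by such a
variable. -/
def freeSlots (Φ : Formula k N M) (X : Finset (Fin N)) : Finset (Fin M × Fin k) :=
  Finset.univ.filter fun p => p.1 ∈ touched Φ X ∧ (Φ p.1 p.2).1 ∉ X

/-- No clause has two slots occupied by variables from `X`. -/
def Separated (Φ : Formula k N M) (X : Finset (Fin N)) : Prop :=
  ∀ i j j', (Φ i j).1 ∈ X → (Φ i j').1 ∈ X → j = j'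

/-- The set `F`, disjoint from `X`, shields the variables outside `F ∪ X`: they are far from being
irregular, do not occur next to variables from `X`, and are hardly affected by the removal of
clauses featuring three variables from `F`. -/
structure Shields (r : ℝ) (Φ : Formula k N M) (X F : Finset (Fin N)) : Prop where
  disj : Disjoint F X
  notTouched : ∀ y ∉ F, y ∉ X → ∀ i ∈ touched Φ X, ∀ j, (Φ i j).1 ≠ y
  degree_le : ∀ y ∉ F, y ∉ X → ∀ s : Bool, |(degree Φ (y, s) : ℝ) - k * r / 2| ≤ tol k / 2
  occ_le : ∀ y ∉ F, y ∉ X →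
    (varDegreeIn Φ (heavyClauses Φ Finset.univ F) y : ℝ) ≤ tol k / 2 - 1

/-- `Φ` arises from `Φ₀` by replacing the literals in the free slots of `Φ₀` by literals on
variables outside `X`. -/
def Resampled (X : Finset (Fin N)) (Φ₀ Φ : Formula k N M) : Prop :=
  ∀ p : Fin M × Fin k, (p ∈ freeSlots Φ₀ X → (Φ p.1 p.2).1 ∉ X) ∧
    (p ∉ freeSlots Φ₀ X → Φ p.1 p.2 = Φ₀ p.1 p.2)

lemma mem_touched {Φ : Formula k N M} {X : Finset (Fin N)} {i : Fin M} :
    i ∈ touched Φ X ↔ ∃ j, (Φ i j).1 ∈ X := by simp [touched]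

lemma mem_freeSlots {Φ : Formula k N M} {X : Finset (Fin N)} {p : Fin M × Fin k} :
    p ∈ freeSlots Φ X ↔ p.1 ∈ touched Φ X ∧ (Φ p.1 p.2).1 ∉ X := by simp [freeSlots]

variable {X : Finset (Fin N)} {Φ₀ Φ : Formula k N M}

lemma Resampled.eq_of_mem (h : Resampled X Φ₀ Φ) {i : Fin M} {j : Fin k}
    (hX : (Φ₀ i j).1 ∈ X) : Φ i j = Φ₀ i j :=
  (h (i, j)).2 fun hp => (mem_freeSlots.mp hp).2 hX

lemma Resampled.mem_iff (h : Resampled X Φ₀ Φ) (i : Fin M) (j : Fin k) :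
    (Φ i j).1 ∈ X ↔ (Φ₀ i j).1 ∈ X := by
  by_cases hp : (i, j) ∈ freeSlots Φ₀ X
  · exact iff_of_false ((h (i, j)).1 hp) (mem_freeSlots.mp hp).2
  · rw [(h (i, j)).2 hp]

lemma Resampled.eq_literal_iff (h : Resampled X Φ₀ Φ) {l : Literal N} (hl : l.1 ∈ X) (i : Fin M)
    (j : Fin k) : Φ i j = l ↔ Φ₀ i j = l := by
  by_cases hX : (Φ₀ i j).1 ∈ X
  · rw [h.eq_of_mem hX]
  · have hX' := (h.mem_iff i j).not.mpr hX
    exact iff_of_false (fun e => hX' (e ▸ hl)) (fun e => hX (e ▸ hl))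

lemma Resampled.touched_eq (h : Resampled X Φ₀ Φ) : touched Φ X = touched Φ₀ X := by
  ext i
  simp only [mem_touched, h.mem_iff]

lemma Resampled.freeSlots_eq (h : Resampled X Φ₀ Φ) : freeSlots Φ X = freeSlots Φ₀ X := by
  ext p
  rw [mem_freeSlots, mem_freeSlots, h.touched_eq, h.mem_iff]

lemma Resampled.refl (X : Finset (Fin N)) (Φ : Formula k N M) : Resampled X Φ Φ :=
  fun _ => ⟨fun hp => (mem_freeSlots.mp hp).2, fun _ => rfl⟩

lemma Resampled.symm (h : Resampled X Φ₀ Φ) : Resampled X Φ Φ₀ := by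
  intro p
  rw [h.freeSlots_eq]
  exact ⟨fun hp => (mem_freeSlots.mp hp).2, fun hp => ((h p).2 hp).symm⟩

lemma Resampled.trans {Φ₁ : Formula k N M} (h : Resampled X Φ₀ Φ) (h' : Resampled X Φ Φ₁) :
    Resampled X Φ₀ Φ₁ := by
  intro p
  have := h' p
  rw [h.freeSlots_eq] at this
  exact ⟨this.1, fun hp => (this.2 hp).trans ((h p).2 hp)⟩

lemma Resampled.degree_eq (h : Resampled X Φ₀ Φ) {l : Literal N} (hl : l.1 ∈ X) :
    degree Φ l = degree Φ₀ l := by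
  rw [RandomSAT.degree_eq, RandomSAT.degree_eq]
  congr 1
  exact Finset.filter_congr fun p _ => h.eq_literal_iff hl _ _

lemma Resampled.hasDegrees_iff (h : Resampled X Φ₀ Φ) {w : Fin N} (hw : w ∈ X) (a b : ℕ) :
    HasDegrees Φ a b w ↔ HasDegrees Φ₀ a b w := by
  rw [HasDegrees, HasDegrees, h.degree_eq (l := (w, true)) hw, h.degree_eq (l := (w, false)) hw]

lemma Resampled.eq_of_notMem_touched (h : Resampled X Φ₀ Φ) {i : Fin M} (hi : i ∉ touched Φ₀ X) :
    Φ i = Φ₀ i := by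
  ext1 j
  exact (h (i, j)).2 fun hp => hi (mem_freeSlots.mp hp).1

/-- If the resampled literals lie on distinct variables and the clauses of `w ∈ X` avoid the
shielding set, then the pruning leaves `w` and its clauses untouched. -/
lemma not_damaged_of_resampled {r : ℝ} {F : Finset (Fin N)} {a b : ℕ}
    (ha : |(a : ℝ) - k * r / 2| ≤ tol k) (hb : |(b : ℝ) - k * r / 2| ≤ tol k)
    (hsep : Separated Φ₀ X) (hsh : Shields r Φ₀ X F) (hres : Resampled X Φ₀ Φ)
    (hinj : ∀ p ∈ freeSlots Φ₀ X, ∀ q ∈ freeSlots Φ₀ X,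
      (Φ p.1 p.2).1 = (Φ q.1 q.2).1 → p = q)
    {w : Fin N} (hw : w ∈ X)
    (havoid : ∀ p ∈ freeSlots Φ₀ X, (∃ j, (Φ₀ p.1 j).1 = w) → (Φ p.1 p.2).1 ∉ F) :
    ¬ Damaged r Φ a b w := by
  classical
  rintro ⟨hdeg, hdam⟩
  apply hdam
  -- the pruning is confined to `F'`, whatever happens to the other elements of `X`
  set F' := F ∪ X.erase w with hF'
  have hwF : w ∉ F := fun h => Finset.disjoint_left.mp hsh.disj h hw
  have hwF' : w ∉ F' := by simp [hF', hwF]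
  -- clauses featuring `w` feature no variable from `F'`
  have hclean : ∀ i j, (Φ i j).1 = w → i ∉ heavyClauses Φ Finset.univ F' := by
    intro i j hij hi
    have hij0 : (Φ₀ i j).1 = w := by
      rw [← hres.eq_of_mem ((hres.mem_iff i j).mp (hij ▸ hw)), hij]
    have h3 := (mem_heavyClauses.mp hi).2
    obtain ⟨y, hy⟩ := Finset.card_pos.mp (lt_of_lt_of_le (by norm_num) h3)
    simp only [clauseVars, Finset.mem_inter, Finset.mem_image, Finset.mem_univ, true_and] at hy
    obtain ⟨⟨j', rfl⟩, hy⟩ := hy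
    by_cases hX : (Φ₀ i j').1 ∈ X
    · have : j = j' := hsep i j j' (hij0 ▸ hw) hX
      subst this
      rw [hij] at hy
      exact hwF' hy
    · have hp : (i, j') ∈ freeSlots Φ₀ X :=
        mem_freeSlots.mpr ⟨mem_touched.mpr ⟨j, hij0 ▸ hw⟩, hX⟩
      have h1 := havoid _ hp ⟨j, hij0⟩
      have h2 := (hres (i, j')).1 hp
      simp only [hF', Finset.mem_union, Finset.mem_erase] at hy
      tauto
  have hreg : ∀ A, Finset.univ \ heavyClauses Φ Finset.univ F' ⊆ A →
      irregularVars r Φ A ⊆ F' := by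
    intro A hA y hy
    by_contra hyF'
    refine notMem_irregularVars (fun s => ?_) hy
    by_cases hyw : y = w
    · subst hyw
      have hdA : degreeIn Φ A (y, s) = degree Φ (y, s) := by
        rw [degree, degreeIn, degreeIn]
        congr 1
        refine Finset.filter_congr fun p _ => ?_
        constructor
        · rintro ⟨_, h⟩; exact ⟨Finset.mem_univ _, h⟩
        · rintro ⟨_, h⟩
          exact ⟨hA (by simpa using hclean p.1 p.2 (by rw [h])), h⟩
      rw [hdA]
      cases s
      · rwa [hdeg.2]
      · rwa [hdeg.1]
    · have hyF : y ∉ F := fun h => hyF' (Finset.mem_union_left _ h)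
      have hyX : y ∉ X := fun h => hyF' (Finset.mem_union_right _ (by simp [hyw, h]))
      have h1 := abs_le.mp (hsh.degree_le y hyF hyX s)
      have h2 := hsh.occ_le y hyF hyX
      -- resampling creates at most one occurrence of `y`
      have hup : degreeIn Φ A (y, s) ≤ degree Φ₀ (y, s) + 1 := by
        refine (degreeIn_le_degree Φ A _).trans ?_
        rw [degree_eq, degree_eq]
        have hsub : (Finset.univ.filter fun p : Fin M × Fin k => Φ p.1 p.2 = (y, s)) ⊆
            (Finset.univ.filter fun p : Fin M × Fin k => Φ₀ p.1 p.2 = (y, s)) ∪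
            (freeSlots Φ₀ X).filter fun p => (Φ p.1 p.2).1 = y := by
          intro p
          simp only [Finset.mem_union, Finset.mem_filter, Finset.mem_univ, true_and]
          intro hp
          by_cases hpf : p ∈ freeSlots Φ₀ X
          · exact Or.inr ⟨hpf, by rw [hp]⟩
          · exact Or.inl (by rw [← (hres p).2 hpf, hp])
        refine (Finset.card_le_card hsub).trans ((Finset.card_union_le _ _).trans ?_)
        gcongr
        rw [Finset.card_le_one]
        intro p hp q hq
        rw [Finset.mem_filter] at hp hq
        exact hinj p hp.1 q hq.1 (hp.2.trans hq.2.symm)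
      have hlow : degree Φ₀ (y, s) ≤ degreeIn Φ A (y, s) +
          varDegreeIn Φ₀ (heavyClauses Φ₀ Finset.univ F) y := by
        have h3 : degree Φ₀ (y, s) ≤ degreeIn Φ₀
            (Finset.univ \ (touched Φ₀ X ∪ heavyClauses Φ₀ Finset.univ F)) (y, s) +
            degreeIn Φ₀ (touched Φ₀ X ∪ heavyClauses Φ₀ Finset.univ F) (y, s) := by
          apply degreeIn_le_add
          rw [Finset.sdiff_union_self_eq_union]
          exact Finset.subset_union_left
        have h4 : degreeIn Φ₀ (touched Φ₀ X ∪ heavyClauses Φ₀ Finset.univ F) (y, s) ≤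
            varDegreeIn Φ₀ (heavyClauses Φ₀ Finset.univ F) y := by
          apply Finset.card_le_card
          intro p
          simp only [Finset.mem_filter_univ, Finset.mem_union]
          rintro ⟨h5 | h5, h6⟩
          · exact absurd (by rw [h6]) (hsh.notTouched y hyF hyX p.1 h5 p.2)
          · exact ⟨h5, by rw [h6]⟩
        have h5 : degreeIn Φ₀
            (Finset.univ \ (touched Φ₀ X ∪ heavyClauses Φ₀ Finset.univ F)) (y, s) ≤
            degreeIn Φ A (y, s) := by
          apply Finset.card_le_card
          intro p
          simp only [Finset.mem_filter_univ, Finset.mem_sdiff, Finset.mem_union, not_or,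
            Finset.mem_univ, true_and]
          rintro ⟨⟨h6, h7⟩, h8⟩
          have h9 := hres.eq_of_notMem_touched h6
          refine ⟨hA ?_, by rw [h9, h8]⟩
          rw [Finset.mem_sdiff]
          refine ⟨Finset.mem_univ _, fun h10 => h7 ?_⟩
          rw [mem_heavyClauses] at h10 ⊢
          refine ⟨Finset.mem_univ _, h10.2.trans (Finset.card_le_card ?_)⟩
          intro z hz
          simp only [clauseVars, Finset.mem_inter, Finset.mem_image, Finset.mem_univ,
            true_and] at hz ⊢
          obtain ⟨⟨j, hj⟩, hz⟩ := hz
          rw [h9] at hj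
          refine ⟨⟨j, hj⟩, ?_⟩
          rcases Finset.mem_union.mp hz with hz | hz
          · exact hz
          · exact absurd (mem_touched.mpr ⟨j, hj ▸ (Finset.mem_erase.mp hz).2⟩) h6
        omega
      have hup' : (degreeIn Φ A (y, s) : ℝ) ≤ degree Φ₀ (y, s) + 1 := by exact_mod_cast hup
      have hlow' : (degree Φ₀ (y, s) : ℝ) ≤ degreeIn Φ A (y, s) +
          varDegreeIn Φ₀ (heavyClauses Φ₀ Finset.univ F) y := by exact_mod_cast hlow
      have h0 : (0 : ℝ) ≤ varDegreeIn Φ₀ (heavyClauses Φ₀ Finset.univ F) y := Nat.cast_nonneg _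
      rw [abs_le]
      constructor <;> linarith
  obtain ⟨hc, hv⟩ := pruneResult_bounds hreg
  have hwV : w ∈ prunedVars r Φ := hv (by simp [hwF'])
  have hwC : ∀ i j, (Φ i j).1 = w → i ∈ prunedClauses r Φ :=
    fun i j hij => hc (by simpa using hclean i j hij)
  refine ⟨hwV, ?_, ?_⟩
  · rw [prunedDegree_eq_degree hwV hwC, hdeg.1]
  · rw [prunedDegree_eq_degree hwV hwC, hdeg.2]

end Resample

section ProductCount

variable {ι γ : Type*} [Fintype ι] [DecidableEq ι] [DecidableEq γ]

/-- In a product of finite sets, the conditions `f p ∈ B p` for `p ∈ S` are independent. -/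
lemma card_filter_piFinset (t : ι → Finset γ) (S : Finset ι) (B : ι → Finset γ)
    (hB : ∀ p ∈ S, B p ⊆ t p) {n : ℕ} (hn : ∀ p ∈ S, (t p).card = n) :
    ((Fintype.piFinset t).filter fun f => ∀ p ∈ S, f p ∈ B p).card * n ^ S.card =
      (∏ p ∈ S, (B p).card) * (Fintype.piFinset t).card := by
  have h : ((Fintype.piFinset t).filter fun f => ∀ p ∈ S, f p ∈ B p) =
      Fintype.piFinset fun p => if p ∈ S then B p else t p := by
    ext f
    simp only [Finset.mem_filter, Fintype.mem_piFinset]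
    constructor
    · rintro ⟨h1, h2⟩ p
      split_ifs with hp
      · exact h2 p hp
      · exact h1 p
    · intro h1
      refine ⟨fun p => ?_, fun p hp => by simpa [hp] using h1 p⟩
      have := h1 p
      split_ifs at this with hp
      · exact hB p hp this
      · exact this
  rw [h, Fintype.card_piFinset, Fintype.card_piFinset]
  simp only [apply_ite Finset.card]
  rw [Finset.prod_ite, Finset.filter_mem_eq_inter, Finset.univ_inter,
    ← Finset.prod_filter_mul_prod_filter_not Finset.univ (· ∈ S) fun p => (t p).card,
    Finset.filter_mem_eq_inter, Finset.univ_inter, Finset.prod_congr rfl hn, Finset.prod_const]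
  ring

end ProductCount

section ResampleCount

variable {k N M : ℕ} {X : Finset (Fin N)} {Φ₀ : Formula k N M}

/-- The free slots of `Φ` in clauses that feature the variable `w`. -/
def freeSlotsAt (Φ : Formula k N M) (X : Finset (Fin N)) (w : Fin N) : Finset (Fin M × Fin k) :=
  (freeSlots Φ X).filter fun p => ∃ j, (Φ p.1 j).1 = w

/-- A variable with degrees `a` and `b` occurs in at most `a + b` clauses. -/
lemma card_clauses_featuring_le {a b : ℕ} {w : Fin N} (h : HasDegrees Φ₀ a b w) :
    (Finset.univ.filter fun i => ∃ j, (Φ₀ i j).1 = w).card ≤ a + b := by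
  classical
  have h1 : varDegreeIn Φ₀ Finset.univ w = a + b := by
    rw [← degreeIn_true_add_false, ← h.1, ← h.2]; rfl
  rw [← h1]
  refine le_trans (Finset.card_le_card ?_) (Finset.card_image_le (f := Prod.fst))
  intro i hi
  obtain ⟨j, hj⟩ := (Finset.mem_filter_univ _).mp hi
  exact Finset.mem_image.mpr ⟨(i, j), by simpa using hj, rfl⟩

lemma card_freeSlotsAt_le {a b : ℕ} {w : Fin N} (h : HasDegrees Φ₀ a b w) :
    (freeSlotsAt Φ₀ X w).card ≤ k * (a + b) := by
  classical
  have h1 : freeSlotsAt Φ₀ X w ⊆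
      (Finset.univ.filter fun i => ∃ j, (Φ₀ i j).1 = w) ×ˢ Finset.univ := by
    intro p hp
    have := (Finset.mem_filter.mp hp).2
    simpa using this
  refine (Finset.card_le_card h1).trans ?_
  rw [Finset.card_product, Finset.card_univ, Fintype.card_fin, mul_comm]
  gcongr
  exact card_clauses_featuring_le h

lemma card_touched_le {a b : ℕ} (h : ∀ w ∈ X, HasDegrees Φ₀ a b w) :
    (touched Φ₀ X).card ≤ X.card * (a + b) := by
  classical
  have h1 : touched Φ₀ X ⊆ X.biUnion fun w => Finset.univ.filter fun i => ∃ j, (Φ₀ i j).1 = w := by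
    intro i hi
    obtain ⟨j, hj⟩ := mem_touched.mp hi
    exact Finset.mem_biUnion.mpr ⟨_, hj, by simp⟩
  exact (Finset.card_le_card h1).trans
    (Finset.card_biUnion_le_card_mul _ _ _ fun w hw => card_clauses_featuring_le (h w hw))

lemma card_freeSlots_le {a b : ℕ} (h : ∀ w ∈ X, HasDegrees Φ₀ a b w) :
    (freeSlots Φ₀ X).card ≤ X.card * (a + b) * k := by
  have h1 : freeSlots Φ₀ X ⊆ touched Φ₀ X ×ˢ Finset.univ := by
    intro p hp
    simpa using (mem_freeSlots.mp hp).1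
  refine (Finset.card_le_card h1).trans ?_
  rw [Finset.card_product, Finset.card_univ, Fintype.card_fin]
  gcongr
  exact card_touched_le h

/-- The possible literals in each slot of a formula obtained from `Φ₀` by resampling. -/
def resampleRange (X : Finset (Fin N)) (Φ₀ : Formula k N M) (p : Fin M × Fin k) :
    Finset (Literal N) :=
  if p ∈ freeSlots Φ₀ X then Xᶜ ×ˢ Finset.univ else {Φ₀ p.1 p.2}

lemma resampled_iff (Φ : Formula k N M) :
    Resampled X Φ₀ Φ ↔
      (Equiv.curry (Fin M) (Fin k) (Literal N)).symm Φ ∈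
        Fintype.piFinset (resampleRange X Φ₀) := by
  rw [Fintype.mem_piFinset]
  refine forall_congr' fun p => ?_
  rw [resampleRange]
  split_ifs with hp <;> simp [hp, Function.uncurry]

open Classical in
lemma card_resampled (X : Finset (Fin N)) (Φ₀ : Formula k N M) :
    (Finset.univ.filter fun Φ : Formula k N M => Resampled X Φ₀ Φ).card =
      (Fintype.piFinset (resampleRange X Φ₀)).card := by
  refine Finset.card_equiv (Equiv.curry (Fin M) (Fin k) (Literal N)).symm fun Φ => ?_
  rw [Finset.mem_filter_univ, resampled_iff]

lemma card_compl_product_bool (X : Finset (Fin N)) :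
    (Xᶜ ×ˢ (Finset.univ : Finset Bool)).card = 2 * (N - X.card) := by
  rw [Finset.card_product, Finset.card_compl, Fintype.card_fin, Finset.card_univ,
    Fintype.card_bool, mul_comm]

/-- Two fixed free slots rarely receive literals on the same variable. -/
lemma card_collision_le {p q : Fin M × Fin k} (hp : p ∈ freeSlots Φ₀ X)
    (hq : q ∈ freeSlots Φ₀ X) (hpq : p ≠ q) (hX : X.card < N) :
    (((Fintype.piFinset (resampleRange X Φ₀)).filter fun f => (f p).1 = (f q).1).card : ℝ) ≤
      1 / ((N : ℝ) - X.card) * (Fintype.piFinset (resampleRange X Φ₀)).card := by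
  classical
  set Ω := Fintype.piFinset (resampleRange X Φ₀)
  set n := 2 * (N - X.card) with hn
  have hn0 : 0 < n := by omega
  have hrange : ∀ s ∈ freeSlots Φ₀ X, resampleRange X Φ₀ s = Xᶜ ×ˢ Finset.univ :=
    fun s hs => if_pos hs
  have h1 : Ω.filter (fun f => (f p).1 = (f q).1) ⊆ Xᶜ.biUnion fun x =>
      Ω.filter fun f => ∀ s ∈ ({p, q} : Finset (Fin M × Fin k)), f s ∈
        ({x} : Finset (Fin N)) ×ˢ (Finset.univ : Finset Bool) := by
    intro f hf
    rw [Finset.mem_filter] at hf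
    have h2 := Fintype.mem_piFinset.mp hf.1 p
    rw [hrange p hp, Finset.mem_product] at h2
    refine Finset.mem_biUnion.mpr ⟨(f p).1, h2.1, Finset.mem_filter.mpr ⟨hf.1, fun s hs => ?_⟩⟩
    rw [Finset.mem_product, Finset.mem_singleton]
    refine ⟨?_, Finset.mem_univ _⟩
    rcases Finset.mem_insert.mp hs with rfl | hs
    · rfl
    · rw [Finset.mem_singleton.mp hs, hf.2]
  have h2 : ∀ x ∈ Xᶜ, (Ω.filter fun f => ∀ s ∈ ({p, q} : Finset (Fin M × Fin k)), f s ∈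
        ({x} : Finset (Fin N)) ×ˢ (Finset.univ : Finset Bool)).card * n ^ 2 = 4 * Ω.card := by
    intro x hx
    have := card_filter_piFinset (resampleRange X Φ₀) {p, q}
      (fun _ => ({x} : Finset (Fin N)) ×ˢ (Finset.univ : Finset Bool)) (n := n) ?_ ?_
    · rw [Finset.card_pair hpq] at this
      rw [this, Finset.prod_const, Finset.card_pair hpq]
      simp [Ω]
    · intro s hs
      have hs' : s ∈ freeSlots Φ₀ X := by
        rcases Finset.mem_insert.mp hs with rfl | hs
        · exact hp
        · rwa [Finset.mem_singleton.mp hs]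
      rw [hrange s hs']
      exact Finset.product_subset_product_left (Finset.singleton_subset_iff.mpr hx)
    · intro s hs
      have hs' : s ∈ freeSlots Φ₀ X := by
        rcases Finset.mem_insert.mp hs with rfl | hs
        · exact hp
        · rwa [Finset.mem_singleton.mp hs]
      rw [hrange s hs', card_compl_product_bool]
  have h3 : (Ω.filter fun f => (f p).1 = (f q).1).card * n ^ 2 ≤ (N - X.card) * (4 * Ω.card) := by
    calc _ ≤ (∑ x ∈ Xᶜ, (Ω.filter fun f => ∀ s ∈ ({p, q} : Finset (Fin M × Fin k)), f s ∈
        ({x} : Finset (Fin N)) ×ˢ (Finset.univ : Finset Bool)).card) * n ^ 2 := by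
          gcongr
          exact (Finset.card_le_card h1).trans Finset.card_biUnion_le
      _ = ∑ x ∈ Xᶜ, 4 * Ω.card := by rw [Finset.sum_mul]; exact Finset.sum_congr rfl h2
      _ = _ := by rw [Finset.sum_const, Finset.card_compl, Fintype.card_fin, smul_eq_mul]
  have hNX : (0 : ℝ) < N - X.card := by
    rw [sub_pos]; exact_mod_cast hX
  have hnr : (n : ℝ) = 2 * ((N : ℝ) - X.card) := by
    rw [hn]; push_cast [Nat.cast_sub hX.le]; ring
  have h4 : ((Ω.filter fun f => (f p).1 = (f q).1).card : ℝ) * (2 * ((N : ℝ) - X.card)) ^ 2 ≤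
      (N - X.card) * (4 * Ω.card) := by
    rw [← hnr, ← Nat.cast_sub hX.le]; exact_mod_cast h3
  rw [one_div_mul_eq_div, le_div_iff₀ hNX]
  have h5 : ((Ω.filter fun f => (f p).1 = (f q).1).card : ℝ) * ((N : ℝ) - X.card) *
      (4 * ((N : ℝ) - X.card)) ≤ Ω.card * (4 * ((N : ℝ) - X.card)) := by nlinarith
  exact le_of_mul_le_mul_right h5 (by positivity)

/-- The probability that the resampled clauses of every `w ∈ X` meet a small set `F` is at most the
product of the individual bounds. -/
lemma card_forall_meet_le {F : Finset (Fin N)} {a b : ℕ} (hsep : Separated Φ₀ X)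
    (hdeg : ∀ w ∈ X, HasDegrees Φ₀ a b w) (hFX : Disjoint F X) (hX : X.card < N) :
    (((Fintype.piFinset (resampleRange X Φ₀)).filter fun f =>
      ∀ w ∈ X, ∃ p ∈ freeSlotsAt Φ₀ X w, (f p).1 ∈ F).card : ℝ) ≤
      (k * (a + b) * F.card / ((N : ℝ) - X.card)) ^ X.card *
        (Fintype.piFinset (resampleRange X Φ₀)).card := by
  classical
  set Ω := Fintype.piFinset (resampleRange X Φ₀)
  set n := 2 * (N - X.card) with hn
  have hNX : (0 : ℝ) < N - X.card := by
    rw [sub_pos]; exact_mod_cast hX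
  have hnr : (n : ℝ) = 2 * ((N : ℝ) - X.card) := by
    rw [hn]; push_cast [Nat.cast_sub hX.le]; ring
  -- a choice of a slot next to each `w ∈ X`; these slots are distinct as `X` is separated
  set H : Finset (∀ w ∈ X, Fin M × Fin k) := X.pi fun w => freeSlotsAt Φ₀ X w with hH
  let im : (∀ w ∈ X, Fin M × Fin k) → Finset (Fin M × Fin k) := fun h =>
    X.attach.image fun w => h w.1 w.2
  have h1 : Ω.filter (fun f => ∀ w ∈ X, ∃ p ∈ freeSlotsAt Φ₀ X w, (f p).1 ∈ F) ⊆
      H.biUnion fun h => Ω.filter fun f => ∀ s ∈ im h, f s ∈ F ×ˢ (Finset.univ : Finset Bool) := by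
    intro f hf
    rw [Finset.mem_filter] at hf
    choose h hh hF using hf.2
    refine Finset.mem_biUnion.mpr ⟨h, Finset.mem_pi.mpr hh, ?_⟩
    rw [Finset.mem_filter]
    refine ⟨hf.1, fun s hs => ?_⟩
    obtain ⟨w, -, rfl⟩ := Finset.mem_image.mp hs
    simpa using hF w.1 w.2
  have himcard : ∀ h ∈ H, (im h).card = X.card := by
    intro h hh
    rw [Finset.card_image_of_injective, Finset.card_attach]
    rintro ⟨w, hw⟩ ⟨w', hw'⟩ heq
    simp only at heq
    obtain ⟨-, j, hj⟩ := Finset.mem_filter.mp (Finset.mem_pi.mp hh w hw)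
    obtain ⟨-, j', hj'⟩ := Finset.mem_filter.mp (Finset.mem_pi.mp hh w' hw')
    rw [← heq] at hj'
    have := hsep _ j j' (hj ▸ hw) (hj' ▸ hw')
    subst this
    exact Subtype.ext (hj.symm.trans hj')
  have himfree : ∀ h ∈ H, ∀ s ∈ im h, s ∈ freeSlots Φ₀ X := by
    intro h hh s hs
    obtain ⟨w, -, rfl⟩ := Finset.mem_image.mp hs
    exact (Finset.mem_filter.mp (Finset.mem_pi.mp hh w.1 w.2)).1
  have h2 : ∀ h ∈ H, ((Ω.filter fun f => ∀ s ∈ im h, f s ∈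
      F ×ˢ (Finset.univ : Finset Bool)).card : ℝ) =
      (F.card / ((N : ℝ) - X.card)) ^ X.card * Ω.card := by
    intro h hh
    have := card_filter_piFinset (resampleRange X Φ₀) (im h)
      (fun _ => F ×ˢ (Finset.univ : Finset Bool)) (n := n) ?_ ?_
    · rw [himcard h hh, Finset.prod_const, himcard h hh, Finset.card_product, Finset.card_univ,
        Fintype.card_bool] at this
      have h3 : ((Ω.filter fun f => ∀ s ∈ im h, f s ∈
        F ×ˢ (Finset.univ : Finset Bool)).card : ℝ) * (2 * ((N : ℝ) - X.card)) ^ X.card =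
          ((F.card : ℝ) * 2) ^ X.card * Ω.card := by
        rw [← hnr]; exact_mod_cast this
      rw [div_pow, div_mul_eq_mul_div, eq_div_iff (by positivity)]
      rw [mul_pow, mul_pow] at h3
      have h4 : (2 : ℝ) ^ X.card ≠ 0 := by positivity
      apply mul_left_cancel₀ h4
      linear_combination h3
    · intro s hs
      rw [resampleRange, if_pos (himfree h hh s hs)]
      refine Finset.product_subset_product_left fun x hx => ?_
      rw [Finset.mem_compl]
      exact Finset.disjoint_left.mp hFX hx
    · intro s hs
      rw [resampleRange, if_pos (himfree h hh s hs), card_compl_product_bool]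
  have hHcard : H.card ≤ (k * (a + b)) ^ X.card := by
    rw [hH, Finset.card_pi]
    exact Finset.prod_le_pow_card _ _ _ fun w hw => card_freeSlotsAt_le (hdeg w hw)
  calc _ ≤ ∑ h ∈ H, ((Ω.filter fun f => ∀ s ∈ im h, f s ∈
        F ×ˢ (Finset.univ : Finset Bool)).card : ℝ) := by
        exact_mod_cast (Finset.card_le_card h1).trans Finset.card_biUnion_le
    _ = H.card * ((F.card / ((N : ℝ) - X.card)) ^ X.card * Ω.card) := by
        rw [Finset.sum_congr rfl h2, Finset.sum_const, nsmul_eq_mul]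
    _ ≤ ((k * (a + b)) ^ X.card) * ((F.card / ((N : ℝ) - X.card)) ^ X.card * Ω.card) := by
        gcongr
        exact_mod_cast hHcard
    _ = _ := by rw [← mul_assoc, ← mul_pow, mul_div_assoc]

open Classical in
/-- Given the formula outside the neighbourhood of `X`, it is unlikely that all variables of `X` are
damaged. -/
lemma card_resampled_damaged_le {r : ℝ} {F : Finset (Fin N)} {a b : ℕ}
    (ha : |(a : ℝ) - k * r / 2| ≤ tol k) (hb : |(b : ℝ) - k * r / 2| ≤ tol k)
    (hsep : Separated Φ₀ X) (hdeg : ∀ w ∈ X, HasDegrees Φ₀ a b w) (hsh : Shields r Φ₀ X F)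
    (hX : X.card < N) :
    ((Finset.univ.filter fun Φ : Formula k N M => Resampled X Φ₀ Φ ∧
      ∀ w ∈ X, Damaged r Φ a b w).card : ℝ) ≤
      ((k * (a + b) * F.card / ((N : ℝ) - X.card)) ^ X.card +
        (X.card * (a + b) * k) ^ 2 / ((N : ℝ) - X.card)) *
        (Finset.univ.filter fun Φ : Formula k N M => Resampled X Φ₀ Φ).card := by
  have hNX : (0 : ℝ) < N - X.card := by
    rw [sub_pos]; exact_mod_cast hX
  set Ω := Fintype.piFinset (resampleRange X Φ₀) with hΩ
  set pairs := (freeSlots Φ₀ X ×ˢ freeSlots Φ₀ X).filter (fun pq => pq.1 ≠ pq.2) with hpairs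
  set D₁ := Ω.filter fun f => ∀ w ∈ X, ∃ p ∈ freeSlotsAt Φ₀ X w, (f p).1 ∈ F with hD₁
  set D₂ := pairs.biUnion fun pq => Ω.filter fun f => (f pq.1).1 = (f pq.2).1 with hD₂
  have h1 : (Finset.univ.filter fun Φ : Formula k N M => Resampled X Φ₀ Φ ∧
      ∀ w ∈ X, Damaged r Φ a b w).card ≤ (D₁ ∪ D₂).card := by
    refine Finset.card_le_card_of_injOn (Equiv.curry (Fin M) (Fin k) (Literal N)).symm ?_
      (Equiv.injective _).injOn
    intro Φ hΦ
    obtain ⟨hres, hdam⟩ := (Finset.mem_filter_univ _).mp (Finset.mem_coe.mp hΦ)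
    have hmem := (resampled_iff Φ).mp hres
    by_contra hnot
    simp only [Finset.mem_coe, Finset.mem_union, not_or, hD₁, hD₂, Finset.mem_biUnion,
      Finset.mem_filter, not_and, not_forall, not_exists] at hnot
    obtain ⟨h2, hinj⟩ := hnot
    obtain ⟨w, hw, havoid⟩ := h2 hmem
    refine not_damaged_of_resampled ha hb hsep hsh hres ?_ hw ?_ (hdam w hw)
    · intro p hp q hq heq
      by_contra hpq
      exact hinj (p, q) (by simp [hpairs, hp, hq, hpq]) hmem heq
    · intro p hp hj
      exact havoid p (Finset.mem_filter.mpr ⟨hp, hj⟩)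
  have h3 : (D₂.card : ℝ) ≤ (X.card * (a + b) * k) ^ 2 / ((N : ℝ) - X.card) * Ω.card := by
    calc (D₂.card : ℝ) ≤ ∑ pq ∈ pairs, ((Ω.filter fun f => (f pq.1).1 = (f pq.2).1).card : ℝ) := by
          exact_mod_cast Finset.card_biUnion_le
      _ ≤ ∑ pq ∈ pairs, 1 / ((N : ℝ) - X.card) * Ω.card := by
          refine Finset.sum_le_sum fun pq hpq => ?_
          simp only [hpairs, Finset.mem_filter, Finset.mem_product] at hpq
          exact card_collision_le hpq.1.1 hpq.1.2 hpq.2 hX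
      _ ≤ ∑ pq ∈ freeSlots Φ₀ X ×ˢ freeSlots Φ₀ X, 1 / ((N : ℝ) - X.card) * Ω.card :=
          Finset.sum_le_sum_of_subset_of_nonneg (Finset.filter_subset _ _)
            fun _ _ _ => by positivity
      _ = (freeSlots Φ₀ X).card ^ 2 / ((N : ℝ) - X.card) * Ω.card := by
          rw [Finset.sum_const, Finset.card_product, nsmul_eq_mul]; push_cast; ring
      _ ≤ _ := by
          gcongr
          exact_mod_cast card_freeSlots_le hdeg
  have h4 : (D₁.card : ℝ) ≤ _ := card_forall_meet_le hsep hdeg hsh.disj hX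
  have h5 : ((D₁ ∪ D₂).card : ℝ) ≤ D₁.card + D₂.card := by
    exact_mod_cast Finset.card_union_le _ _
  rw [card_resampled, add_mul]
  calc _ ≤ ((D₁ ∪ D₂).card : ℝ) := by exact_mod_cast h1
    _ ≤ D₁.card + D₂.card := h5
    _ ≤ _ := add_le_add h4 h3

end ResampleCount

/-! ### Most variables with given degrees survive the pruning -/

/-- A bound for the density of `B` in each class of an equivalence relation that meets `B` is a
bound for the density of `B` in any union of classes containing `B`. -/
lemma pr_le_mul_pr_of_classes {Ω : Type*} [Fintype Ω] (s : Setoid Ω) {B G : Ω → Prop}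
    {ρ : ℝ} (hρ : 0 ≤ ρ) (hBG : ∀ ω, B ω → G ω) (hG : ∀ ω ω', s ω ω' → G ω → G ω')
    (h : ∀ ω, B ω → pr (fun ω' => s ω ω' ∧ B ω') ≤ ρ * pr (fun ω' => s ω ω')) :
    pr B ≤ ρ * pr G := by
  classical
  rcases isEmpty_or_nonempty Ω with hΩ | hΩ
  · simp [pr]
  have hc : (0 : ℝ) < Fintype.card Ω := by exact_mod_cast Fintype.card_pos
  have h' : ∀ ω, B ω → ((Finset.univ.filter fun ω' => s ω ω' ∧ B ω').card : ℝ) ≤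
      ρ * (Finset.univ.filter fun ω' => s ω ω').card := by
    intro ω hω
    have := h ω hω
    rwa [pr_eq, pr_eq, ← mul_div_assoc, div_le_div_iff_of_pos_right hc] at this
  rw [pr_eq, pr_eq, ← mul_div_assoc, div_le_div_iff_of_pos_right hc]
  have e1 := Finset.card_eq_sum_card_fiberwise (f := fun ω => (Quotient.mk s ω))
    (s := Finset.univ.filter B) (t := Finset.univ) (fun _ _ => Finset.mem_univ _)
  have e2 := Finset.card_eq_sum_card_fiberwise (f := fun ω => (Quotient.mk s ω))
    (s := Finset.univ.filter G) (t := Finset.univ) (fun _ _ => Finset.mem_univ _)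
  rw [e1, e2]
  push_cast
  rw [Finset.mul_sum]
  refine Finset.sum_le_sum fun c _ => ?_
  rcases ((Finset.univ.filter B).filter fun ω => Quotient.mk s ω = c).eq_empty_or_nonempty
    with h0 | ⟨ω, hω⟩
  · rw [h0]; simp; positivity
  · simp only [Finset.mem_filter, Finset.mem_univ, true_and] at hω
    obtain ⟨hωB, rfl⟩ := hω
    have a1 : ((Finset.univ.filter B).filter fun ω' => Quotient.mk s ω' = Quotient.mk s ω) =
        Finset.univ.filter fun ω' => s ω ω' ∧ B ω' := by
      ext ω'
      simp only [Finset.mem_filter, Finset.mem_univ, true_and, Quotient.eq]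
      exact ⟨fun ⟨x, y⟩ => ⟨s.symm y, x⟩, fun ⟨x, y⟩ => ⟨y, s.symm x⟩⟩
    have a2 : ((Finset.univ.filter G).filter fun ω' => Quotient.mk s ω' = Quotient.mk s ω) =
        Finset.univ.filter fun ω' => s ω ω' := by
      ext ω'
      simp only [Finset.mem_filter, Finset.mem_univ, true_and, Quotient.eq]
      exact ⟨fun ⟨_, y⟩ => s.symm y, fun x => ⟨hG _ _ x (hBG _ hωB), s.symm x⟩⟩
    rw [a1, a2]
    exact h' ω hωB

section Moments

variable {k N M : ℕ}

/-- `card_resampled_damaged_le` averaged over the classes of formulas that arise from one another by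
resampling the neighbourhood of `X`. The degrees of the elements of `X` are constant on each class,
so the bound comes with the probability that these degrees are as prescribed. -/
lemma pr_all_damaged_le {r f : ℝ} {a b : ℕ} (hf : 0 ≤ f) (X : Finset (Fin N)) (hX : X.card < N)
    (ha : |(a : ℝ) - k * r / 2| ≤ tol k) (hb : |(b : ℝ) - k * r / 2| ≤ tol k) :
    pr (fun Φ : Formula k N M => Separated Φ X ∧ (∃ F, Shields r Φ X F ∧ (F.card : ℝ) ≤ f) ∧
      ∀ w ∈ X, Damaged r Φ a b w) ≤
      ((k * (a + b) * f / ((N : ℝ) - X.card)) ^ X.card +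
        (X.card * (a + b) * k) ^ 2 / ((N : ℝ) - X.card)) *
        pr (fun Φ : Formula k N M => ∀ w ∈ X, HasDegrees Φ a b w) := by
  classical
  have hNX : (0 : ℝ) < N - X.card := by
    rw [sub_pos]; exact_mod_cast hX
  refine pr_le_mul_pr_of_classes (s := ⟨Resampled X, ⟨Resampled.refl X, Resampled.symm,
    Resampled.trans⟩⟩) (by positivity) ?_ ?_ ?_
  · rintro Φ ⟨-, -, h⟩ w hw
    exact (h w hw).1
  · intro Φ Φ' hres h w hw
    exact (Resampled.hasDegrees_iff hres hw a b).mpr (h w hw)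
  · rintro Φ₀ ⟨hsep, ⟨F, hsh, hF⟩, hdam⟩
    have h1 := card_resampled_damaged_le ha hb hsep (fun w hw => (hdam w hw).1) hsh hX
    refine (pr_mono (Q := fun Φ => Resampled X Φ₀ Φ ∧ ∀ w ∈ X, Damaged r Φ a b w)
      fun Φ h => ⟨h.1, h.2.2.2⟩).trans ?_
    have e : pr (fun Φ => Resampled X Φ₀ Φ) =
      pr (fun Φ => (⟨Resampled X, ⟨Resampled.refl X, Resampled.symm,
        Resampled.trans⟩⟩ : Setoid (Formula k N M)) Φ₀ Φ) := rfl
    rw [← e, pr_eq, pr_eq, ← mul_div_assoc]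
    gcongr
    refine h1.trans ?_
    gcongr

lemma pr_not_separated_le (hN : 0 < N) (X : Finset (Fin N)) :
    pr (fun Φ : Formula k N M => ¬ Separated Φ X) ≤ M * k ^ 2 * ((X.card : ℝ) / N) ^ 2 := by
  classical
  have : Nonempty (Literal N) := ⟨(⟨0, hN⟩, true)⟩
  set J : Finset (Fin k × Fin k) := Finset.univ.filter fun j => j.1 ≠ j.2 with hJ
  calc _ ≤ pr (fun Φ : Formula k N M => ∃ i ∈ (Finset.univ : Finset (Fin M)), ∃ j ∈ J,
        (Φ i j.1).1 ∈ X ∧ (Φ i j.2).1 ∈ X) := by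
        apply pr_mono
        intro Φ hΦ
        simp only [Separated, not_forall] at hΦ
        obtain ⟨i, j, j', h1, h2, h3⟩ := hΦ
        exact ⟨i, Finset.mem_univ _, (j, j'), by simpa [hJ] using h3, h1, h2⟩
    _ ≤ ∑ i : Fin M, ∑ j ∈ J, pr (fun Φ : Formula k N M => (Φ i j.1).1 ∈ X ∧ (Φ i j.2).1 ∈ X) := by
        refine (pr_exists_le _ _).trans (Finset.sum_le_sum fun i _ => pr_exists_le _ _)
    _ = ∑ i : Fin M, ∑ j ∈ J, ((X.card : ℝ) / N) ^ 2 := by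
        refine Finset.sum_congr rfl fun i _ => Finset.sum_congr rfl fun j hj => ?_
        have h1 := pr_forall_mem (ι := Fin M) {i}
          (fun c : Fin k → Literal N => (c j.1).1 ∈ X ∧ (c j.2).1 ∈ X)
        have h2 := pr_forall_mem (ι := Fin k) {j.1, j.2} (fun l : Literal N => l.1 ∈ X)
        rw [Finset.card_pair (by simpa [hJ] using hj), pr_literal_mem hN] at h2
        simp only [Finset.mem_singleton, forall_eq, Finset.card_singleton, pow_one] at h1
        simp only [Finset.mem_insert, Finset.mem_singleton, forall_eq_or_imp, forall_eq] at h2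
        rw [← h2, ← h1]
    _ ≤ _ := by
        rw [Finset.sum_const, Finset.sum_const, Finset.card_univ, Fintype.card_fin, nsmul_eq_mul,
          nsmul_eq_mul, ← mul_assoc]
        gcongr
        have : J.card ≤ k * k := by
          refine (Finset.card_filter_le _ _).trans ?_
          simp
        rw [sq]
        exact_mod_cast this

/-- In a typical formula a shielding set is obtained by closing up the set of stray variables and
neighbours of `X`. -/
lemma exists_shields {r u : ℝ} {Φ : Formula k N M} {X : Finset (Fin N)} {a b : ℕ}
    (hk : 2 * k ≤ tol k / 2 - 1) (hk0 : 0 < tol k / 2 - 1)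
    (hstray : ((strayVars r Φ).card : ℝ) ≤ u * N) (hΦ : Expanding Φ (4 * u * N))
    (hdeg : ∀ w ∈ X, HasDegrees Φ a b w) (hX : (X.card * (a + b) * k : ℝ) ≤ u * N) :
    ∃ F, Shields r Φ X F ∧ (F.card : ℝ) ≤ 4 * u * N := by
  classical
  set Q := (touched Φ X).biUnion (clauseVars Φ) with hQ
  have hQcard : (Q.card : ℝ) ≤ u * N := by
    refine le_trans ?_ hX
    have h1 : Q.card ≤ (touched Φ X).card * k := by
      refine Finset.card_biUnion_le_card_mul _ _ _ fun i _ => ?_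
      exact Finset.card_image_le.trans (by simp)
    exact_mod_cast h1.trans (by gcongr; exact card_touched_le hdeg)
  obtain ⟨F, hF0, hFcard, hF⟩ := exists_closed_superset (v := 2 * u * N) (t := tol k / 2 - 1)
    (by convert hΦ using 1; ring) hk0 hk (strayVars r Φ ∪ Q) (by
      have : ((strayVars r Φ ∪ Q).card : ℝ) ≤ (strayVars r Φ).card + Q.card := by
        exact_mod_cast Finset.card_union_le _ _
      linarith)
  have hnot : ∀ y ∉ F \ X, y ∉ X → y ∉ F := fun y h1 h2 h3 => h1 (by simp [h2, h3])
  refine ⟨F \ X, ⟨Finset.sdiff_disjoint, ?_, ?_, ?_⟩, ?_⟩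
  · intro y hy hyX i hi j hij
    refine hnot y hy hyX (hF0 (Finset.mem_union_right _ (Finset.mem_biUnion.mpr ⟨i, hi, ?_⟩)))
    simp only [clauseVars, Finset.mem_image, Finset.mem_univ, true_and]
    exact ⟨j, hij⟩
  · intro y hy hyX
    exact notMem_strayVars.mp fun h => hnot y hy hyX (hF0 (Finset.mem_union_left _ h))
  · intro y hy hyX
    refine le_trans ?_ (hF y (hnot y hy hyX))
    exact_mod_cast varDegreeIn_mono Φ (heavyClauses_mono Φ le_rfl Finset.sdiff_subset) y
  · have : ((F \ X).card : ℝ) ≤ F.card := by exact_mod_cast Finset.card_le_card Finset.sdiff_subset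
    linarith

open Classical in
/-- The `m`-th power of a cardinality counts the `m`-tuples, repetitions allowed. -/
lemma card_filter_pow_eq_sum (P : Fin N → Prop) (m : ℕ) :
    ((Finset.univ.filter P).card : ℝ) ^ m =
      ∑ x : Fin m → Fin N, if ∀ i, P (x i) then (1 : ℝ) else 0 := by
  have h : (Finset.univ.filter fun x : Fin m → Fin N => ∀ i, P (x i)) =
      Fintype.piFinset fun _ : Fin m => Finset.univ.filter P := by
    ext x; simp
  rw [Finset.sum_boole, h, Fintype.card_piFinset]
  simp

open Classical in
/-- The number of damaged variables. -/
noncomputable def damagedCount (r : ℝ) (Φ : Formula k N M) (a b : ℕ) : ℕ :=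
  (Finset.univ.filter fun w => Damaged r Φ a b w).card

/-- The `m`-th moment of the number of damaged variables is smaller than the `m`-th moment of the
number of variables with the given degrees by an exponential factor. -/
lemma ex_damagedCount_pow_le {r u : ℝ} {a b m : ℕ} (hN : 0 < N) (hm : 2 * m ≤ N) (hm0 : 0 < m)
    (hu : 0 ≤ u) (ha : |(a : ℝ) - k * r / 2| ≤ tol k) (hb : |(b : ℝ) - k * r / 2| ≤ tol k)
    (hk : 2 * k ≤ tol k / 2 - 1) (hk0 : 0 < tol k / 2 - 1)
    (hη : k * (a + b) * (8 * u) ≤ 1 / 8) (hX : (m * (a + b) * k : ℝ) ≤ u * N) :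
    ex (fun Φ : Formula k N M => ((damagedCount r Φ a b : ℝ) / N) ^ m) ≤
      (1 - (N.descFactorial m : ℝ) / N ^ m) + M * k ^ 2 * ((m : ℝ) / N) ^ 2 +
      pr (fun Φ : Formula k N M =>
        ¬ (((strayVars r Φ).card : ℝ) ≤ u * N ∧ Expanding Φ (4 * u * N))) +
      ((1 / 8) ^ m + 2 * (m * (a + b) * k) ^ 2 / N) *
        ex (fun Φ : Formula k N M => ((degCount Φ a b : ℝ) / N) ^ m) := by
  classical
  have hN' : (0 : ℝ) < N := by exact_mod_cast hN
  have hm' : 2 * (m : ℝ) ≤ N := by exact_mod_cast hm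
  set q := pr (fun Φ : Formula k N M =>
        ¬ (((strayVars r Φ).card : ℝ) ≤ u * N ∧ Expanding Φ (4 * u * N)))
  set A := (M : ℝ) * k ^ 2 * ((m : ℝ) / N) ^ 2
  set ρ := (1 / 8 : ℝ) ^ m + 2 * (m * (a + b) * k) ^ 2 / N
  have hρ : 0 ≤ ρ := by positivity
  have key : ∀ x : Fin m → Fin N, pr (fun Φ : Formula k N M => ∀ i, Damaged r Φ a b (x i)) ≤
      (if ¬ Function.Injective x then 1 else 0) + (A + q) +
        ρ * pr (fun Φ : Formula k N M => ∀ i, HasDegrees Φ a b (x i)) := by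
    intro x
    have h0 : 0 ≤ ρ * pr (fun Φ : Formula k N M => ∀ i, HasDegrees Φ a b (x i)) :=
      mul_nonneg hρ (pr_nonneg _)
    have hA : 0 ≤ A := by positivity
    have hq : 0 ≤ q := pr_nonneg _
    -- tuples with repetitions are rare; for the others the set of entries has `m` elements
    by_cases hx : Function.Injective x
    · rw [if_neg (not_not.mpr hx), zero_add]
      set X := Finset.univ.image x with hXdef
      have hXcard : X.card = m := by
        rw [hXdef, Finset.card_image_of_injective _ hx]; simp
      have hlt : X.card < N := by omega
      have hall : ∀ P : Fin N → Prop, (∀ w ∈ X, P w) ↔ ∀ i, P (x i) := by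
        intro P; simp [hXdef]
      have h1 := pr_all_damaged_le (M := M) (f := 4 * u * N) (by positivity) X hlt ha hb
      have h2 := pr_not_separated_le (k := k) (M := M) hN X
      rw [hXcard] at h1 h2
      simp only [hall] at h1
      have hNm : (N : ℝ) / 2 ≤ N - m := by linarith
      have h3 : (k * (a + b) * (4 * u * N) / ((N : ℝ) - m)) ^ m +
          (m * (a + b) * k : ℝ) ^ 2 / ((N : ℝ) - m) ≤ ρ := by
        have h4 : k * (a + b) * (4 * u * N) / ((N : ℝ) - m) ≤ 1 / 8 := by
          calc k * (a + b) * (4 * u * N) / ((N : ℝ) - m)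
              ≤ k * (a + b) * (4 * u * N) / (N / 2) := by gcongr
            _ = k * (a + b) * (8 * u) := by field_simp; ring
            _ ≤ _ := hη
        have h5 : (m * (a + b) * k : ℝ) ^ 2 / ((N : ℝ) - m) ≤
            (m * (a + b) * k : ℝ) ^ 2 / (N / 2) := by
          gcongr
        have h6 : (m * (a + b) * k : ℝ) ^ 2 / (N / 2) = 2 * (m * (a + b) * k) ^ 2 / N := by
          field_simp
        rw [h6] at h5
        have h7 : 0 ≤ k * (a + b) * (4 * u * N) / ((N : ℝ) - m) :=
          div_nonneg (by positivity) (by linarith)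
        exact add_le_add (pow_le_pow_left₀ h7 h4 m) h5
      calc _ ≤ pr (fun Φ : Formula k N M => ¬ Separated Φ X ∨
            (¬ (((strayVars r Φ).card : ℝ) ≤ u * N ∧ Expanding Φ (4 * u * N)) ∨
            (Separated Φ X ∧ (∃ F, Shields r Φ X F ∧ (F.card : ℝ) ≤ 4 * u * N) ∧
              ∀ i, Damaged r Φ a b (x i)))) := by
            apply pr_mono
            intro Φ hΦ
            by_cases hs : Separated Φ X
            · by_cases ht : ((strayVars r Φ).card : ℝ) ≤ u * N ∧ Expanding Φ (4 * u * N)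
              · refine Or.inr (Or.inr ⟨hs, ?_, hΦ⟩)
                refine exists_shields (a := a) (b := b) hk hk0 ht.1 ht.2 ?_ (by rwa [hXcard])
                exact (hall fun w => HasDegrees Φ a b w).mpr fun i => (hΦ i).1
              · exact Or.inr (Or.inl ht)
            · exact Or.inl hs
        _ ≤ A + (q + ρ * pr (fun Φ : Formula k N M => ∀ i, HasDegrees Φ a b (x i))) := by
            refine (pr_or_le _ _).trans (add_le_add h2 ((pr_or_le _ _).trans ?_))
            refine add_le_add le_rfl (h1.trans ?_)
            exact mul_le_mul_of_nonneg_right h3 (pr_nonneg _)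
        _ = _ := by ring
    · rw [if_pos hx]
      have := pr_le_one (fun Φ : Formula k N M => ∀ i, Damaged r Φ a b (x i))
      linarith
  have hpow : (0 : ℝ) < (N : ℝ) ^ m := by positivity
  have e1 : ex (fun Φ : Formula k N M => ((damagedCount r Φ a b : ℝ) / N) ^ m) =
      (1 / (N : ℝ) ^ m) * ∑ x : Fin m → Fin N,
        pr (fun Φ : Formula k N M => ∀ i, Damaged r Φ a b (x i)) := by
    simp_rw [← ex_indicator]
    rw [← ex_finset_sum, ← ex_const_mul]
    congr 1; ext Φ
    rw [div_pow, one_div_mul_eq_div]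
    congr 1
    refine (card_filter_pow_eq_sum (fun w => Damaged r Φ a b w) m).trans ?_
    exact Finset.sum_congr rfl fun x _ => by congr!
  have e2 : ex (fun Φ : Formula k N M => ((degCount Φ a b : ℝ) / N) ^ m) =
      (1 / (N : ℝ) ^ m) * ∑ x : Fin m → Fin N,
        pr (fun Φ : Formula k N M => ∀ i, HasDegrees Φ a b (x i)) := by
    simp_rw [← ex_indicator]
    rw [← ex_finset_sum, ← ex_const_mul]
    congr 1; ext Φ
    rw [div_pow, one_div_mul_eq_div]
    congr 1
    refine Eq.trans ?_ ((card_filter_pow_eq_sum (fun w => HasDegrees Φ a b w) m).trans ?_)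
    · rw [degCount]; congr!
    · exact Finset.sum_congr rfl fun x _ => by congr!
  -- the number of tuples with repetitions
  have e3 : (∑ x : Fin m → Fin N, if ¬ Function.Injective x then (1 : ℝ) else 0) =
      N ^ m - N.descFactorial m := by
    have h1 := Finset.card_filter_add_card_filter_not
      (s := (Finset.univ : Finset (Fin m → Fin N))) Function.Injective
    have h2 : (Finset.univ.filter fun x : Fin m → Fin N => Function.Injective x).card =
        N.descFactorial m := by
      have := Fintype.card_embedding_eq (α := Fin m) (β := Fin N)
      rw [Fintype.card_fin, Fintype.card_fin] at this
      rw [← this, ← Fintype.card_subtype]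
      exact Fintype.card_congr (Equiv.subtypeInjectiveEquivEmbedding _ _)
    rw [h2, Finset.card_univ, Fintype.card_fun, Fintype.card_fin, Fintype.card_fin] at h1
    rw [Finset.sum_boole, eq_sub_iff_add_eq, add_comm]
    exact_mod_cast h1
  rw [e1, e2]
  calc _ ≤ (1 / (N : ℝ) ^ m) * ∑ x : Fin m → Fin N,
        ((if ¬ Function.Injective x then 1 else 0) + (A + q) +
        ρ * pr (fun Φ : Formula k N M => ∀ i, HasDegrees Φ a b (x i))) := by
        gcongr with x; exact key x
    _ = _ := by
        rw [Finset.sum_add_distrib, Finset.sum_add_distrib, e3, ← Finset.mul_sum, Finset.sum_const,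
          Finset.card_univ, Fintype.card_fun, Fintype.card_fin, Fintype.card_fin, nsmul_eq_mul]
        push_cast
        field_simp
        ring

end Moments

section WhpDamaged

variable {k : ℕ} {M : ℕ → ℕ}

/-- If about a fraction `P` of the variables has degrees `a` and `b`, then with high probability a
fraction of at most `P / 2` is damaged. By Markov's inequality for the `m`-th moment the exceptional
probability is asymptotically at most `(1 / 2) ^ m`, and `m` is arbitrary. -/
lemma whp_damagedCount_le {r u κ P : ℝ} {a b : ℕ} (hu : 0 < u) (hP : 0 < P)
    (hM : ∀ᶠ N : ℕ in atTop, (M N : ℝ) ≤ κ * N)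
    (ha : |(a : ℝ) - k * r / 2| ≤ tol k) (hb : |(b : ℝ) - k * r / 2| ≤ tol k)
    (hk : 2 * k ≤ tol k / 2 - 1) (hk0 : 0 < tol k / 2 - 1)
    (hη : k * (a + b) * (8 * u) ≤ 1 / 8)
    (htyp : Whp (fun N (Φ : Formula k N (M N)) =>
      ((strayVars r Φ).card : ℝ) ≤ u * N ∧ Expanding Φ (4 * u * N)))
    (hdeg : Whp (fun N (Φ : Formula k N (M N)) => (degCount Φ a b : ℝ) / N ≤ 2 * P)) :
    Whp (fun N (Φ : Formula k N (M N)) => (damagedCount r Φ a b : ℝ) / N ≤ P / 2) := by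
  have hmain : ∀ m : ℕ, 0 < m → ∃ g : ℕ → ℝ, Tendsto g atTop (𝓝 ((1 / 2) ^ m)) ∧
      ∀ᶠ N in atTop, pr (fun Φ : Formula k N (M N) =>
        ¬ (damagedCount r Φ a b : ℝ) / N ≤ P / 2) ≤ g N := by
    intro m hm
    refine ⟨fun N => (2 / P) ^ m * ((1 - (N.descFactorial m : ℝ) / N ^ m) +
      κ * k ^ 2 * m ^ 2 / N + pr (fun Φ : Formula k N (M N) =>
        ¬ (((strayVars r Φ).card : ℝ) ≤ u * N ∧ Expanding Φ (4 * u * N))) +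
      ((1 / 8) ^ m + 2 * (m * (a + b) * k) ^ 2 / N) * ((2 * P) ^ m +
        pr (fun Φ : Formula k N (M N) => ¬ (degCount Φ a b : ℝ) / N ≤ 2 * P))), ?_, ?_⟩
    · have t1 : Tendsto (fun N : ℕ => 1 - (N.descFactorial m : ℝ) / N ^ m) atTop (𝓝 (1 - 1)) := by
        refine tendsto_const_nhds.sub ?_
        refine (Asymptotics.isEquivalent_iff_tendsto_one ?_).mp (isEquivalent_descFactorial m)
        filter_upwards [eventually_gt_atTop 0] with N hN
        positivity
      have t2 := tendsto_const_div_atTop_nhds_zero_nat (κ * k ^ 2 * m ^ 2 : ℝ)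
      have t3 := tendsto_const_div_atTop_nhds_zero_nat (2 * (m * (a + b) * k) ^ 2 : ℝ)
      have t4 := (((t1.add t2).add htyp).add ((t3.const_add ((1 / 8 : ℝ) ^ m)).mul
        (hdeg.const_add ((2 * P) ^ m)))).const_mul ((2 / P) ^ m)
      have hlim : (2 / P) ^ m * (1 - 1 + 0 + 0 + ((1 / 8 : ℝ) ^ m + 0) * ((2 * P) ^ m + 0)) =
          (1 / 2) ^ m := by
        rw [sub_self, add_zero, add_zero, zero_add, add_zero, add_zero, ← mul_pow, ← mul_pow]
        congr 1
        field_simp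
        norm_num
      rwa [hlim] at t4
    · filter_upwards [hM, eventually_ge_atTop (2 * m), eventually_gt_atTop 0,
        (tendsto_natCast_atTop_atTop.const_mul_atTop hu).eventually_ge_atTop
          (m * (a + b) * k : ℝ)] with N hMN hmN hN hXN
      have hN' : (0 : ℝ) < N := by exact_mod_cast hN
      have h1 := ex_damagedCount_pow_le (M := M N) hN hmN hm hu.le ha hb hk hk0 hη hXN
      have : Nonempty (Formula k N (M N)) := ⟨fun _ _ => (⟨0, hN⟩, true)⟩
      have h2 : ex (fun Φ : Formula k N (M N) => ((degCount Φ a b : ℝ) / N) ^ m) ≤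
          (2 * P) ^ m + pr (fun Φ : Formula k N (M N) => ¬ (degCount Φ a b : ℝ) / N ≤ 2 * P) := by
        classical
        rw [← ex_indicator, ← ex_const (Ω := Formula k N (M N)) ((2 * P) ^ m), ← ex_add]
        apply ex_mono
        intro Φ
        split_ifs with h
        · rw [add_zero]
          gcongr
        · have h3 : (degCount Φ a b : ℝ) / N ≤ 1 := by
            rw [div_le_one hN']
            have := Finset.card_le_univ (Finset.univ.filter fun x : Fin N =>
              degree Φ (x, true) = a ∧ degree Φ (x, false) = b)
            rw [Fintype.card_fin] at this
            exact_mod_cast this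
          have h4 : ((degCount Φ a b : ℝ) / N) ^ m ≤ 1 := pow_le_one₀ (by positivity) h3
          have : 0 < (2 * P) ^ m := by positivity
          linarith
      have h5 : (M N : ℝ) * k ^ 2 * ((m : ℝ) / N) ^ 2 ≤ κ * k ^ 2 * m ^ 2 / N := by
        calc (M N : ℝ) * k ^ 2 * ((m : ℝ) / N) ^ 2 ≤ (κ * N) * k ^ 2 * ((m : ℝ) / N) ^ 2 := by
              gcongr
          _ = _ := by field_simp
      have h6 : (P / 2) ^ m * pr (fun Φ : Formula k N (M N) =>
          ¬ (damagedCount r Φ a b : ℝ) / N ≤ P / 2) ≤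
          ex (fun Φ : Formula k N (M N) => ((damagedCount r Φ a b : ℝ) / N) ^ m) := by
        refine le_trans ?_ (mul_pr_le_ex (fun Φ => by positivity) ((P / 2) ^ m))
        gcongr
        apply pr_mono
        intro Φ hΦ
        push Not at hΦ
        gcongr
      have h7 : pr (fun Φ : Formula k N (M N) => ¬ (damagedCount r Φ a b : ℝ) / N ≤ P / 2) =
          (2 / P) ^ m * ((P / 2) ^ m * pr (fun Φ : Formula k N (M N) =>
          ¬ (damagedCount r Φ a b : ℝ) / N ≤ P / 2)) := by
        rw [← mul_assoc, ← mul_pow]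
        have : 2 / P * (P / 2) = 1 := by field_simp
        rw [this]; simp
      rw [h7]
      gcongr
      refine h6.trans (h1.trans ?_)
      gcongr
  refine tendsto_order.mpr ⟨fun c hc => Eventually.of_forall fun N => hc.trans_le (pr_nonneg _),
    fun ε hε => ?_⟩
  obtain ⟨m, hm⟩ := exists_pow_lt_of_lt_one hε (by norm_num : (1 / 2 : ℝ) < 1)
  obtain ⟨g, hg, hle⟩ := hmain (m + 1) (Nat.succ_pos m)
  have hlt : (1 / 2 : ℝ) ^ (m + 1) < ε := by
    refine lt_of_le_of_lt ?_ hm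
    exact pow_le_pow_of_le_one (by norm_num) (by norm_num) (Nat.le_succ m)
  filter_upwards [hle, hg.eventually (gt_mem_nhds hlt)] with N h1 h2
  exact h1.trans_lt h2

end WhpDamaged

/-! ### Stray variables -/

section Stray

variable {k N M : ℕ}

/-- A sum over the variables that are not stray can be evaluated from the degree statistics. -/
lemma sum_compl_strayVars {r : ℝ} (Φ : Formula k N M) (g : ℕ → ℕ → ℝ) :
    ∑ x ∈ (strayVars r Φ)ᶜ, g (degree Φ (x, true)) (degree Φ (x, false)) =
      ∑ ab ∈ window (k * r / 2) (tol k / 2) ×ˢ window (k * r / 2) (tol k / 2),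
        g ab.1 ab.2 * degCount Φ ab.1 ab.2 := by
  classical
  have hmaps : ∀ x ∈ (strayVars r Φ)ᶜ, (degree Φ (x, true), degree Φ (x, false)) ∈
      window (k * r / 2) (tol k / 2) ×ˢ window (k * r / 2) (tol k / 2) := by
    intro x hx
    rw [Finset.mem_compl, notMem_strayVars] at hx
    rw [Finset.mem_product, mem_window, mem_window]
    exact ⟨hx true, hx false⟩
  rw [← Finset.sum_fiberwise_of_maps_to hmaps]
  refine Finset.sum_congr rfl fun ab hab => ?_
  rw [Finset.mem_product, mem_window, mem_window] at hab
  have h : (strayVars r Φ)ᶜ.filter (fun x => (degree Φ (x, true), degree Φ (x, false)) = ab) =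
      Finset.univ.filter fun x : Fin N =>
        degree Φ (x, true) = ab.1 ∧ degree Φ (x, false) = ab.2 := by
    ext x
    simp only [Finset.mem_filter, Finset.mem_univ, true_and, Finset.mem_compl, notMem_strayVars,
      Prod.ext_iff, and_iff_right_iff_imp]
    rintro ⟨h1, h2⟩ s
    cases s
    · rw [h2]; exact hab.2
    · rw [h1]; exact hab.1
  rw [Finset.sum_congr rfl (g := fun _ => g ab.1 ab.2), h, Finset.sum_const, nsmul_eq_mul, degCount,
    mul_comm]
  intro x hx
  have := (Finset.mem_filter.mp hx).2
  rw [← this]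

lemma sum_degree_pair (Φ : Formula k N M) :
    ∑ x : Fin N, (degree Φ (x, true) + degree Φ (x, false)) = M * k := by
  have := sum_varDegreeIn Φ Finset.univ
  rw [Finset.card_univ, Fintype.card_fin] at this
  rw [← this]
  exact Finset.sum_congr rfl fun x _ => degreeIn_true_add_false Φ Finset.univ x

end Stray

section WhpStray

variable {k : ℕ} {M : ℕ → ℕ} {μ : ℝ}

/-- Finite weighted sums of degree statistics are asymptotically at least their Poisson values. -/
lemma whp_weighted_degCount (hμ : 0 < μ)
    (hM : Tendsto (fun N : ℕ => ((M N * k : ℕ) : ℝ) / (2 * N)) atTop (𝓝 μ))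
    (H : Finset (ℕ × ℕ)) (g : ℕ → ℕ → ℝ) (hg : ∀ a b, 0 ≤ g a b) {δ : ℝ} (hδ : 0 < δ) :
    Whp (fun N (Φ : Formula k N (M N)) =>
      ∑ ab ∈ H, g ab.1 ab.2 * (poi μ ab.1 * poi μ ab.2) - δ ≤
        (∑ ab ∈ H, g ab.1 ab.2 * degCount Φ ab.1 ab.2) / N) := by
  set G := ∑ ab ∈ H, g ab.1 ab.2 with hG
  have hG0 : 0 ≤ G := Finset.sum_nonneg fun ab _ => hg _ _
  have h := Whp.forall_mem H (P := fun ab N (Φ : Formula k N (M N)) =>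
    |(degCount Φ ab.1 ab.2 : ℝ) / N - poi μ ab.1 * poi μ ab.2| ≤ δ / (G + 1))
    fun ab _ => whp_degCount hμ hM ab.1 ab.2 (by positivity)
  refine h.mono (Eventually.of_forall fun N Φ hΦ => ?_)
  have h1 : ∑ ab ∈ H, g ab.1 ab.2 * (poi μ ab.1 * poi μ ab.2 - δ / (G + 1)) ≤
      ∑ ab ∈ H, g ab.1 ab.2 * ((degCount Φ ab.1 ab.2 : ℝ) / N) := by
    refine Finset.sum_le_sum fun ab hab => ?_
    have := (abs_le.mp (hΦ ab hab)).1
    exact mul_le_mul_of_nonneg_left (by linarith) (hg _ _)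
  simp_rw [mul_sub, Finset.sum_sub_distrib, ← Finset.sum_mul, ← mul_div_assoc] at h1
  rw [← Finset.sum_div, ← hG] at h1
  have h2 : G * δ / (G + 1) ≤ δ := by
    rw [div_le_iff₀ (by positivity)]; nlinarith
  linarith

/-- With high probability there are few stray variables. -/
lemma whp_card_strayVars_le {r u : ℝ} (hμ : 0 < k * r / 2)
    (hM : Tendsto (fun N : ℕ => ((M N * k : ℕ) : ℝ) / (2 * N)) atTop (𝓝 (k * r / 2)))
    (hT0 : 0 ≤ tol k) (hT : tol k ≤ k * r / 2) (hu : 0 < u) (hu1 : u ≤ 1)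
    (hρ : Real.exp (-((tol k / 2) ^ 2 / (4 * (k * r / 2)))) ≤ u / 8) :
    Whp (fun N (Φ : Formula k N (M N)) => ((strayVars r Φ).card : ℝ) ≤ u * N) := by
  have hw := (window_pair_sums hμ (by linarith) (by linarith) hρ (by linarith)).1
  have h := whp_weighted_degCount hμ hM
    (window (k * r / 2) (tol k / 2) ×ˢ window (k * r / 2) (tol k / 2)) (fun _ _ => 1)
    (fun _ _ => zero_le_one) (half_pos hu)
  refine h.mono ?_
  filter_upwards [eventually_gt_atTop 0] with N hN Φ hΦ
  have hN' : (0 : ℝ) < N := by exact_mod_cast hN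
  rw [← sum_compl_strayVars Φ fun _ _ => 1, Finset.sum_product] at hΦ
  simp only [one_mul, Finset.sum_const, Finset.card_compl, Fintype.card_fin, nsmul_eq_mul,
    mul_one] at hΦ
  have hle : (strayVars r Φ).card ≤ N := by simpa using Finset.card_le_univ (strayVars r Φ)
  rw [le_div_iff₀ hN', Nat.cast_sub hle] at hΦ
  nlinarith

/-- With high probability the stray variables have few occurrences in total. -/
lemma whp_sum_degree_strayVars_le {r u : ℝ} (hμ : 0 < k * r / 2)
    (hM : Tendsto (fun N : ℕ => ((M N * k : ℕ) : ℝ) / (2 * N)) atTop (𝓝 (k * r / 2)))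
    (hT0 : 0 ≤ tol k) (hT : tol k ≤ k * r / 2) (hu : 0 < u) (hu1 : u ≤ 1)
    (hρ : Real.exp (-((tol k / 2) ^ 2 / (4 * (k * r / 2)))) ≤ u / 8) :
    Whp (fun N (Φ : Formula k N (M N)) =>
      ∑ x ∈ strayVars r Φ, ((degree Φ (x, true) : ℝ) + degree Φ (x, false)) ≤
        2 * k * r * u * N) := by
  classical
  have hw := (window_pair_sums hμ (by linarith) (by linarith) hρ (by linarith)).2
  have h := whp_weighted_degCount hμ hM
    (window (k * r / 2) (tol k / 2) ×ˢ window (k * r / 2) (tol k / 2))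
    (fun a b => (a : ℝ) + b) (fun _ _ => by positivity) (mul_pos hμ hu)
  have hM' : ∀ᶠ N : ℕ in atTop, ((M N * k : ℕ) : ℝ) / (2 * N) ≤ k * r / 2 + (k * r / 2) * u / 2 :=
    (hM.eventually (gt_mem_nhds (by linarith [mul_pos hμ hu]))).mono fun N h => le_of_lt h
  refine h.mono ?_
  filter_upwards [eventually_gt_atTop 0, hM'] with N hN hMN Φ hΦ
  have hN' : (0 : ℝ) < N := by exact_mod_cast hN
  rw [← sum_compl_strayVars Φ fun a b => (a : ℝ) + b, Finset.sum_product] at hΦ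
  have htot : (∑ x ∈ strayVars r Φ, ((degree Φ (x, true) : ℝ) + degree Φ (x, false))) +
      ∑ x ∈ (strayVars r Φ)ᶜ, ((degree Φ (x, true) : ℝ) + degree Φ (x, false)) =
      ((M N * k : ℕ) : ℝ) := by
    rw [Finset.sum_add_sum_compl, ← sum_degree_pair Φ]
    push_cast; rfl
  rw [div_le_iff₀ (by positivity)] at hMN
  rw [le_div_iff₀ hN'] at hΦ
  have h1 : (2 * (k * r / 2) * (1 - 8 * (u / 8)) - k * r / 2 * u) * N ≤
      ∑ x ∈ (strayVars r Φ)ᶜ, ((degree Φ (x, true) : ℝ) + degree Φ (x, false)) := by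
    refine le_trans ?_ hΦ
    gcongr
  linarith

end WhpStray

/-! ### The properties of the pruned formula -/

section Deterministic

variable {k N M : ℕ}

/-- Every variable with degrees `a`, `b` that is not damaged contributes its positive literal. -/
lemma degreeFraction_ge {r : ℝ} (Φ : Formula k N M) (a b : ℕ) :
    ((degCount Φ a b : ℝ) - damagedCount r Φ a b) / (2 * N) ≤ degreeFraction r Φ a b := by
  classical
  rw [degreeFraction]
  gcongr
  rw [sub_le_iff_le_add]
  have h : (Finset.univ.filter fun w : Fin N => HasDegrees Φ a b w) ⊆
      (((prunedLits r Φ).filter fun l => (prunedDegree r Φ l : ℤ) = a ∧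
        (prunedDegree r Φ (neg l) : ℤ) = b).image Prod.fst) ∪
      Finset.univ.filter fun w : Fin N => Damaged r Φ a b w := by
    intro w hw
    rw [Finset.mem_filter_univ] at hw
    by_cases hd : Damaged r Φ a b w
    · exact Finset.mem_union_right _ (by simpa using hd)
    · refine Finset.mem_union_left _ (Finset.mem_image.mpr ⟨(w, true), ?_, rfl⟩)
      have hgood : w ∈ prunedVars r Φ ∧ prunedDegree r Φ (w, true) = a ∧
          prunedDegree r Φ (w, false) = b := by
        by_contra hnot; exact hd ⟨hw, hnot⟩
      simp [prunedLits, neg, hgood]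
  have h1 := (Finset.card_le_card h).trans ((Finset.card_union_le _ _).trans
    (Nat.add_le_add_right Finset.card_image_le _))
  have h2 : degCount Φ a b = (Finset.univ.filter fun w : Fin N => HasDegrees Φ a b w).card := by
    rw [degCount]; congr!
  have h3 : damagedCount r Φ a b =
      (Finset.univ.filter fun w : Fin N => Damaged r Φ a b w).card := by
    rw [damagedCount]
  rw [h2, h3]
  exact_mod_cast h1

/-- Integers within the tolerance of `k r / 2` are positive, hence natural numbers. -/
lemma exists_nat_of_window {r : ℝ} (hT : tol k < k * r / 2) {d : ℤ}
    (hd : |(d : ℝ) - k * r / 2| ≤ tol k) :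
    ∃ a : ℕ, d = a ∧ |(a : ℝ) - k * r / 2| ≤ tol k := by
  have h0 : (0 : ℝ) < d := by linarith [(abs_le.mp hd).1]
  have h1 : 0 ≤ d := by exact_mod_cast h0.le
  lift d to ℕ using h1
  exact ⟨d, rfl, by exact_mod_cast hd⟩

/-- The properties of the pruned formula hold for every expanding formula with few stray variables
and nearly Poisson degree statistics, provided that not too many variables are damaged. -/
lemma pruningGood_of_statistics {r u c : ℝ} {Φ : Formula k N M} (hN : 0 < N)
    (hT : tol k < k * r / 2) (hu : 0 < u)
    (hk : 2 * k ≤ tol k / 2)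
    (hu1 : (8 * k + 8) * u ≤ Real.exp (-(k : ℝ) ^ 2))
    (hu2 : 10 * k * r * u ≤ Real.exp (-(k : ℝ) ^ 2))
    (hT0 : 0 < tol k)
    (hstray : ((strayVars r Φ).card : ℝ) ≤ u * N) (hexp : Expanding Φ (4 * u * N))
    (hsum : ∑ x ∈ strayVars r Φ, ((degree Φ (x, true) : ℝ) + degree Φ (x, false)) ≤
      2 * k * r * u * N)
    (happrox : ∀ a ∈ window (k * r / 2) (tol k), ∀ b ∈ window (k * r / 2) (tol k),
      |(degCount Φ a b : ℝ) / N - poi (k * r / 2) a * poi (k * r / 2) b| ≤ u)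
    (hlower : ∀ a ∈ window (k * r / 2) (tol k), ∀ b ∈ window (k * r / 2) (tol k),
      2 * c ≤ (degCount Φ a b : ℝ) / N - (damagedCount r Φ a b : ℝ) / N) :
    PruningGood r 1 c Φ := by
  classical
  have hN' : (0 : ℝ) < N := by exact_mod_cast hN
  have hk0 : (0 : ℝ) ≤ k := Nat.cast_nonneg k
  have huN : 0 < u * N := by positivity
  obtain ⟨F, hF0, hFcard, hF⟩ := exists_closed_superset (v := 2 * u * N) (t := tol k / 2)
    (by convert hexp using 1; ring) (by linarith) hk (strayVars r Φ) (by linarith)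
  obtain ⟨hclauses, hvars⟩ := prune_bounds_of_closed hF0 hF
  have hremoved : Finset.univ \ prunedVars r Φ ⊆ F := by
    intro x hx
    by_contra hxF
    exact (Finset.mem_sdiff.mp hx).2 (hvars (by simp [hxF]))
  have hremcard : ((Finset.univ \ prunedVars r Φ).card : ℝ) ≤ 4 * u * N := by
    have : ((Finset.univ \ prunedVars r Φ).card : ℝ) ≤ F.card := by
      exact_mod_cast Finset.card_le_card hremoved
    linarith
  have h4u : 4 * u ≤ Real.exp (-(k : ℝ) ^ 2) := by nlinarith
  constructor
  · intro σ' hσ'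
    exact exists_extension hexp hremcard σ' hσ'
  · have h1 : ((Finset.univ \ prunedVars r Φ).card : ℝ) = N - (prunedVars r Φ).card := by
      rw [Finset.card_sdiff_of_subset (Finset.subset_univ _), Finset.card_univ, Fintype.card_fin,
        Nat.cast_sub (by simpa using Finset.card_le_univ (prunedVars r Φ))]
    have h2 : 4 * u * N ≤ Real.exp (-(k : ℝ) ^ 2) * N := by gcongr
    linarith
  · push_cast
    have h1 : ∑ x ∈ Finset.univ \ prunedVars r Φ,
        ((degree Φ (x, true) : ℝ) + degree Φ (x, false)) ≤
        ∑ x ∈ F, ((degree Φ (x, true) : ℝ) + degree Φ (x, false)) :=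
      Finset.sum_le_sum_of_subset_of_nonneg hremoved fun _ _ _ => by positivity
    have h2 : ∑ x ∈ F, ((degree Φ (x, true) : ℝ) + degree Φ (x, false)) =
        ∑ x ∈ F \ strayVars r Φ, ((degree Φ (x, true) : ℝ) + degree Φ (x, false)) +
        ∑ x ∈ strayVars r Φ, ((degree Φ (x, true) : ℝ) + degree Φ (x, false)) :=
      (Finset.sum_sdiff hF0).symm
    have h3 : ∑ x ∈ F \ strayVars r Φ, ((degree Φ (x, true) : ℝ) + degree Φ (x, false)) ≤
        F.card * (2 * k * r) := by
      calc _ ≤ ∑ x ∈ F \ strayVars r Φ, (2 * k * r : ℝ) := by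
            refine Finset.sum_le_sum fun x hx => ?_
            have h4 := notMem_strayVars.mp (Finset.mem_sdiff.mp hx).2
            have h5 := (abs_le.mp (h4 true)).2
            have h6 := (abs_le.mp (h4 false)).2
            linarith
        _ = (F \ strayVars r Φ).card * (2 * k * r) := by rw [Finset.sum_const, nsmul_eq_mul]
        _ ≤ _ := by
            have : (0 : ℝ) ≤ 2 * k * r := by linarith
            gcongr
            exact Finset.sdiff_subset
    have h4 : (F.card : ℝ) * (2 * k * r) ≤ (4 * u * N) * (2 * k * r) := by
      have : (0 : ℝ) ≤ 2 * k * r := by linarith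
      gcongr
      linarith
    have h5 : 10 * k * r * u * N ≤ Real.exp (-(k : ℝ) ^ 2) * N := by gcongr
    linarith
  · intro dp dm hdp hdm
    obtain ⟨a, rfl, ha⟩ := exists_nat_of_window hT hdp
    obtain ⟨b, rfl, hb⟩ := exists_nat_of_window hT hdm
    refine le_trans ?_ (degreeFraction_ge Φ a b)
    have := hlower a (mem_window.mpr ha) b (mem_window.mpr hb)
    rw [← sub_div, le_div_iff₀ hN'] at this
    rw [le_div_iff₀ (by positivity)]
    linarith
  · intro dp dm hdp hdm
    obtain ⟨a, rfl, ha⟩ := exists_nat_of_window hT hdp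
    obtain ⟨b, rfl, hb⟩ := exists_nat_of_window hT hdm
    have hμ : 0 ≤ k * r / 2 := by linarith
    rw [poissonProb_natCast hμ, poissonProb_natCast hμ]
    have h1 := abs_degreeFraction_sub_le hN (by linarith) hexp hclauses hvars a b
    have h2 := abs_le.mp (happrox a (mem_window.mpr ha) b (mem_window.mpr hb))
    have h3 := abs_le.mp (happrox b (mem_window.mpr hb) a (mem_window.mpr ha))
    rw [mul_comm (poi _ b)] at h3
    have h4 : (k + 1) * (4 * u * N) / N = (k + 1) * (4 * u) := by field_simp
    rw [h4] at h1
    have h5 := abs_le.mp h1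
    have h6 : (k + 1) * (4 * u) + u ≤ Real.exp (-(k : ℝ) ^ 2) := by nlinarith
    rw [one_mul, abs_le]
    constructor <;> linarith

end Deterministic

/-- For fixed `k` and `r` subject to finitely many numerical inequalities, the pruned formula has
the required properties with high probability. -/
lemma exists_whp_pruningGood {k : ℕ} {r u : ℝ} (hr : 0 < r)
    (hT : tol k < k * r / 2) (hu : 0 < u) (hu0 : u ≤ 1)
    (hk : 2 * k ≤ tol k / 2 - 1) (hT0 : 0 < tol k / 2 - 1)
    (hu1 : (8 * k + 8) * u ≤ Real.exp (-(k : ℝ) ^ 2))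
    (hu2 : 10 * k * r * u ≤ Real.exp (-(k : ℝ) ^ 2))
    (hu3 : Real.exp 1 ^ 2 * k ^ 3 * (2 * r) * (4 * u) ≤ 1 / 2)
    (hu4 : k * (2 * k * r) * (8 * u) ≤ 1 / 8)
    (hρ : Real.exp (-((tol k / 2) ^ 2 / (4 * (k * r / 2)))) ≤ u / 8) :
    ∃ c : ℝ, 0 < c ∧ Whp (fun N (Φ : Formula k N ⌈r * N⌉₊) => PruningGood r 1 c Φ) := by
  have hT0' : 0 < tol k := by linarith
  have hμ : 0 < k * r / 2 := hT0'.trans hT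
  set μ := k * r / 2 with hμdef
  set H := window μ (tol k) ×ˢ window μ (tol k) with hH
  have hlim : Tendsto (fun N : ℕ => (⌈r * N⌉₊ : ℝ) / N) atTop (𝓝 r) :=
    (tendsto_nat_ceil_mul_div_atTop hr.le).comp tendsto_natCast_atTop_atTop
  have hM : Tendsto (fun N : ℕ => ((⌈r * N⌉₊ * k : ℕ) : ℝ) / (2 * N)) atTop (𝓝 μ) := by
    have := hlim.const_mul ((k : ℝ) / 2)
    rw [show (k : ℝ) / 2 * r = μ by rw [hμdef]; ring] at this
    refine this.congr fun N => ?_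
    push_cast
    rw [div_mul_div_comm, mul_comm (k : ℝ)]
  have hMle : ∀ᶠ N : ℕ in atTop, (⌈r * N⌉₊ : ℝ) ≤ 2 * r * N := by
    filter_upwards [hlim.eventually (gt_mem_nhds (show r < 2 * r by linarith)),
      eventually_gt_atTop 0] with N h1 h2
    have h2' : (0 : ℝ) < N := by exact_mod_cast h2
    exact ((div_lt_iff₀ h2').mp h1).le
  obtain ⟨c, hc0, hc⟩ : ∃ c : ℝ, 0 < c ∧ ∀ ab ∈ H, c ≤ poi μ ab.1 * poi μ ab.2 / 8 := by
    rcases H.eq_empty_or_nonempty with h | h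
    · exact ⟨1, one_pos, by simp [h]⟩
    · obtain ⟨ab, -, hmin⟩ := H.exists_min_image (fun ab => poi μ ab.1 * poi μ ab.2 / 8) h
      have h1 := poi_pos hμ ab.1
      have h2 := poi_pos hμ ab.2
      exact ⟨_, by positivity, hmin⟩
  refine ⟨c, hc0, ?_⟩
  have hstray := whp_card_strayVars_le hμ hM hT0'.le hT.le hu hu0 hρ
  have hexp : Whp (fun N (Φ : Formula k N ⌈r * N⌉₊) => Expanding Φ (4 * u * N)) :=
    whp_expanding hMle hu3
  have htyp := hstray.and hexp
  have hsum := whp_sum_degree_strayVars_le hμ hM hT0'.le hT.le hu hu0 hρ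
  have happrox := Whp.forall_mem H (P := fun ab N (Φ : Formula k N ⌈r * N⌉₊) =>
    |(degCount Φ ab.1 ab.2 : ℝ) / N - poi μ ab.1 * poi μ ab.2| ≤ u)
    fun ab _ => whp_degCount hμ hM ab.1 ab.2 hu
  have hquarter := Whp.forall_mem H (P := fun ab N (Φ : Formula k N ⌈r * N⌉₊) =>
    |(degCount Φ ab.1 ab.2 : ℝ) / N - poi μ ab.1 * poi μ ab.2| ≤ poi μ ab.1 * poi μ ab.2 / 4)
    fun ab _ => whp_degCount hμ hM ab.1 ab.2 (by
      have h1 := poi_pos hμ ab.1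
      have h2 := poi_pos hμ ab.2
      positivity)
  have hdam := Whp.forall_mem H (P := fun ab N (Φ : Formula k N ⌈r * N⌉₊) =>
    (damagedCount r Φ ab.1 ab.2 : ℝ) / N ≤ poi μ ab.1 * poi μ ab.2 / 2) (fun ab hab => by
      have h1 := poi_pos hμ ab.1
      have h2 := poi_pos hμ ab.2
      rw [hH, Finset.mem_product, mem_window, mem_window] at hab
      refine whp_damagedCount_le hu (mul_pos h1 h2) hMle hab.1 hab.2 hk hT0 ?_ htyp ?_
      · refine le_trans ?_ hu4
        have h3 := (abs_le.mp hab.1).2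
        have h4 := (abs_le.mp hab.2).2
        have h5 : (ab.1 : ℝ) + ab.2 ≤ 2 * k * r := by
          rw [hμdef] at h3 h4 hT; linarith
        gcongr
      · refine (whp_degCount hμ hM ab.1 ab.2 (mul_pos h1 h2)).mono
          (Eventually.of_forall fun N Φ h => ?_)
        linarith [(abs_le.mp h).2])
  refine ((htyp.and hsum).and (happrox.and (hquarter.and hdam))).mono ?_
  filter_upwards [eventually_gt_atTop 0] with N hN Φ hΦ
  obtain ⟨⟨⟨h1, h2⟩, h3⟩, h4, h5, h6⟩ := hΦ
  refine pruningGood_of_statistics hN hT hu (by linarith) hu1 hu2 hT0' h1 h2 h3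
    (fun a ha b hb => h4 (a, b) (Finset.mem_product.mpr ⟨ha, hb⟩)) fun a ha b hb => ?_
  have hab : (a, b) ∈ H := Finset.mem_product.mpr ⟨ha, hb⟩
  have h7 := (abs_le.mp (h5 _ hab)).1
  have h8 := h6 _ hab
  have h9 := hc _ hab
  simp only at h7 h8 h9
  linarith

/-! ### Large clause length -/

/-- The factor `exp(-k²)` beats every `2 ^ O(k)`. -/
lemma exp_sq_bound {k : ℕ} (hk : 6 ≤ k) :
    128 * (k : ℝ) ^ 3 * 2 ^ k * Real.exp (-(k : ℝ) ^ 2) ≤ 1 := by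
  have hk' : (6 : ℝ) ≤ k := by exact_mod_cast hk
  have h1 : (128 : ℝ) ≤ Real.exp 5 := by
    have : (2.7 : ℝ) ^ 5 ≤ Real.exp 1 ^ 5 := by
      gcongr; linarith [Real.exp_one_gt_d9]
    rw [← Real.exp_nat_mul] at this
    norm_num at this ⊢
    linarith
  have h2 : (k : ℝ) ≤ Real.exp k := by linarith [Real.add_one_le_exp (k : ℝ)]
  have h3 : (2 : ℝ) ^ k ≤ Real.exp k := by
    calc (2 : ℝ) ^ k ≤ Real.exp 1 ^ k := by gcongr; linarith [Real.exp_one_gt_d9]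
      _ = Real.exp k := by rw [← Real.exp_nat_mul, mul_one]
  calc 128 * (k : ℝ) ^ 3 * 2 ^ k * Real.exp (-(k : ℝ) ^ 2)
      ≤ Real.exp 5 * Real.exp k ^ 3 * Real.exp k * Real.exp (-(k : ℝ) ^ 2) := by gcongr
    _ = Real.exp (5 + 3 * k + k + -(k : ℝ) ^ 2) := by
        rw [← Real.exp_nat_mul, Real.exp_add, Real.exp_add, Real.exp_add]; norm_num
    _ ≤ Real.exp 0 := by gcongr; nlinarith
    _ = 1 := Real.exp_zero

lemma tol_sq (k : ℕ) : tol k ^ 2 = (k : ℝ) ^ 6 * 2 ^ k := by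
  rw [tol, mul_pow, ← pow_mul, ← Real.rpow_natCast (2 ^ ((k : ℝ) / 2)),
    ← Real.rpow_mul (by norm_num)]
  norm_num

lemma pow_three_le_tol (k : ℕ) : (k : ℝ) ^ 3 ≤ tol k := by
  rw [tol]
  refine le_mul_of_one_le_right (by positivity) ?_
  exact Real.one_le_rpow (by norm_num) (by positivity)

lemma exists_whp_pruningGood_of_large {k : ℕ} {r : ℝ} (hk : 6 ≤ k) (hr1 : 2 ^ k / 2 ≤ r)
    (hr2 : r ≤ 2 ^ k) (hk4 : 16 * (k : ℝ) ^ 4 < 2 ^ k) :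
    ∃ c : ℝ, 0 < c ∧ Whp (fun N (Φ : Formula k N ⌈r * N⌉₊) => PruningGood r 1 c Φ) := by
  have hk' : (6 : ℝ) ≤ k := by exact_mod_cast hk
  have h2k : (0 : ℝ) < 2 ^ k := by positivity
  have hr : 0 < r := by linarith
  set E := Real.exp (-(k : ℝ) ^ 2) with hE
  have hE0 : 0 < E := Real.exp_pos _
  have hE1 : E ≤ 1 := Real.exp_le_one_iff.mpr (by nlinarith)
  have hb := exp_sq_bound hk
  have hk3 : (1 : ℝ) ≤ k ^ 3 := one_le_pow₀ (by linarith)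
  have hkk3 : (k : ℝ) ≤ k ^ 3 := le_self_pow₀ (by linarith) (by norm_num)
  have hk23 : (k : ℝ) ^ 2 ≤ k ^ 3 := pow_le_pow_right₀ (by linarith) (by norm_num)
  have h2k1 : (1 : ℝ) ≤ 2 ^ k := one_le_pow₀ (by norm_num)
  have htol := pow_three_le_tol k
  have hpow : (36 : ℝ) * k ≤ k ^ 3 := by nlinarith
  -- all numerical conditions follow with error parameter `exp(-k²)²`
  refine exists_whp_pruningGood (u := E ^ 2) hr ?_ (by positivity) (pow_le_one₀ hE0.le hE1)
    (by linarith) (by linarith) ?_ ?_ ?_ ?_ ?_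
  · refine lt_of_pow_lt_pow_left₀ 2 (by positivity) ?_
    rw [tol_sq]
    have h1 : (k * (2 ^ k / 2) / 2 : ℝ) ^ 2 ≤ (k * r / 2) ^ 2 := by gcongr
    refine lt_of_lt_of_le ?_ h1
    have h3 : (0 : ℝ) < k ^ 2 * 2 ^ k := by positivity
    nlinarith [mul_lt_mul_of_pos_left hk4 h3]
  · have h1 : (8 * k + 8 : ℝ) ≤ 128 * k ^ 3 * 2 ^ k := by nlinarith
    calc (8 * k + 8 : ℝ) * E ^ 2 ≤ 128 * k ^ 3 * 2 ^ k * E ^ 2 := by gcongr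
      _ = (128 * k ^ 3 * 2 ^ k * E) * E := by ring
      _ ≤ 1 * E := by gcongr
      _ = E := one_mul _
  · calc 10 * (k : ℝ) * r * E ^ 2 ≤ 128 * k ^ 3 * 2 ^ k * E ^ 2 := by gcongr; norm_num
      _ = (128 * k ^ 3 * 2 ^ k * E) * E := by ring
      _ ≤ 1 * E := by gcongr
      _ = E := one_mul _
  · have he : Real.exp 1 ^ 2 ≤ 8 := by
      have : Real.exp 1 ≤ 2.8 := by linarith [Real.exp_one_lt_d9]
      calc Real.exp 1 ^ 2 ≤ 2.8 ^ 2 := by gcongr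
        _ ≤ 8 := by norm_num
    have h1 : E ^ 2 ≤ E := by nlinarith
    calc Real.exp 1 ^ 2 * k ^ 3 * (2 * r) * (4 * E ^ 2)
        ≤ 8 * k ^ 3 * (2 * 2 ^ k) * (4 * E) := by gcongr
      _ = (128 * k ^ 3 * 2 ^ k * E) / 2 := by ring
      _ ≤ 1 / 2 := by linarith
  · calc k * (2 * k * r) * (8 * E ^ 2) = 16 * k ^ 2 * r * (E * E) := by ring
      _ ≤ 16 * k ^ 3 * 2 ^ k * (E * 1) := by gcongr
      _ = (128 * k ^ 3 * 2 ^ k * E) / 8 := by ring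
      _ ≤ 1 / 8 := by linarith
  · have h1 : (8 : ℝ) ≤ Real.exp 3 := by
      have : (2.7 : ℝ) ^ 3 ≤ Real.exp 1 ^ 3 := by
        gcongr; linarith [Real.exp_one_gt_d9]
      rw [← Real.exp_nat_mul] at this
      norm_num at this ⊢
      linarith
    have h2 : (2 * (k : ℝ) ^ 2 + 3) ≤ (tol k / 2) ^ 2 / (4 * (k * r / 2)) := by
      rw [div_pow, tol_sq, le_div_iff₀ (by positivity)]
      have h3 : (k : ℝ) ^ 6 * 2 ^ k / 2 ^ 2 ≥ k ^ 6 * r / 4 := by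
        have : (k : ℝ) ^ 6 * r ≤ k ^ 6 * 2 ^ k := by gcongr
        linarith
      refine le_trans ?_ h3
      have h4 : (2 * (k : ℝ) ^ 2 + 3) * 8 ≤ k ^ 5 := by
        have : (216 : ℝ) ≤ k ^ 3 := by nlinarith
        have h5 : (216 : ℝ) * k ^ 2 ≤ k ^ 3 * k ^ 2 := by gcongr
        nlinarith
      have h6 : (2 * (k : ℝ) ^ 2 + 3) * 8 * (k * r) ≤ k ^ 5 * (k * r) := by gcongr
      nlinarith
    rw [le_div_iff₀ (by norm_num)]
    calc Real.exp (-((tol k / 2) ^ 2 / (4 * (k * r / 2)))) * 8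
        ≤ Real.exp (-(2 * (k : ℝ) ^ 2 + 3)) * Real.exp 3 := by gcongr
      _ = E ^ 2 := by
        rw [hE, ← Real.exp_nat_mul, ← Real.exp_add]; congr 1; push_cast; ring

/-- All that is needed about `ε` is that it tends to zero. -/
lemma eventually_density_bounds {ε : ℕ → ℝ}
    (hε : ε =Θ[atTop] fun k : ℕ => (2 : ℝ) ^ (-(k : ℝ) / 3)) :
    ∀ᶠ k : ℕ in atTop, 2 ^ k / 2 ≤ density ε k ∧ density ε k ≤ 2 ^ k := by
  have h0 : Tendsto (fun k : ℕ => (2 : ℝ) ^ (-(k : ℝ) / 3)) atTop (𝓝 0) := by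
    have h1 : (2 : ℝ) ^ (-(1 / 3) : ℝ) < 1 :=
      Real.rpow_lt_one_of_one_lt_of_neg (by norm_num) (by norm_num)
    refine (tendsto_pow_atTop_nhds_zero_of_lt_one (by positivity) h1).congr fun k => ?_
    rw [← Real.rpow_natCast, ← Real.rpow_mul (by norm_num)]
    congr 1
    ring
  have hε0 : Tendsto ε atTop (𝓝 0) := hε.1.trans_tendsto h0
  filter_upwards [hε0.eventually (Metric.ball_mem_nhds (0 : ℝ) one_pos),
    eventually_ge_atTop 4] with k hk hk4
  rw [Real.dist_eq, sub_zero, abs_lt] at hk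
  have h1 := Real.log_two_gt_d9
  have h2 := Real.log_two_lt_d9
  have h3 : (16 : ℝ) ≤ 2 ^ k := by
    calc (16 : ℝ) = 2 ^ 4 := by norm_num
      _ ≤ 2 ^ k := pow_le_pow_right₀ (by norm_num) hk4
  rw [density]
  constructor <;> nlinarith

end RandomSAT

/-- With `r = 2^k ln 2 - (1 + ln 2)/2 - ε_k`, `ε_k = Θ_k(2^{-k/3})` and `M = ⌈rN⌉`: for all large
enough `k`, the uniformly random formula has the three properties with probability tending to `1`
as `N → ∞`. -/
theorem mainTheorem4 :
    ∃ C : ℝ, 0 < C ∧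
      ∀ ε : ℕ → ℝ, (ε =Θ[atTop] fun k : ℕ => (2 : ℝ) ^ (-(k : ℝ) / 3)) →
        ∀ᶠ k : ℕ in atTop, ∃ c : ℝ, 0 < c ∧
          Tendsto
            (fun N : ℕ =>
              ProbabilityTheory.uniformOn
                (Set.univ : Set (RandomSAT.Formula k N ⌈RandomSAT.density ε k * N⌉₊))
                {Φ | RandomSAT.PruningGood (RandomSAT.density ε k) C c Φ})
            atTop (𝓝 1) := by
  refine ⟨1, one_pos, fun ε hε => ?_⟩
  have hpow : ∀ᶠ k : ℕ in atTop, 16 * (k : ℝ) ^ 4 < 2 ^ k := by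
    have h := tendsto_pow_const_div_const_pow_of_one_lt 4 (show (1 : ℝ) < 2 by norm_num)
    filter_upwards [h.eventually (gt_mem_nhds (show (0 : ℝ) < 1 / 16 by norm_num))] with k hk
    rw [div_lt_iff₀ (by positivity)] at hk
    linarith
  filter_upwards [RandomSAT.eventually_density_bounds hε, hpow, eventually_ge_atTop 6]
    with k hr hk4 hk6
  obtain ⟨c, hc, h⟩ := RandomSAT.exists_whp_pruningGood_of_large hk6 hr.1 hr.2 hk4
  refine ⟨c, hc, h.tendsto_uniformOn ?_⟩
  filter_upwards [eventually_gt_atTop 0] with N hN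
  exact ⟨fun _ _ => (⟨0, hN⟩, true)⟩
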